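/- Let $n\ge 3$ and write $n=2m$ or $n=2m+1$. Let $\mathfrak g=\mathfrak{osp}(n|2)$ be the orthosymplectic Lie superalgebra over $\mathbb C$, let $\mathfrak h$ be its Cartan subalgebra of diagonal matrices (in a basis in which the invariant form is the standard split one), and let $\epsilon_1,\dots,\epsilon_m,\delta$ be the standard basis of $\mathfrak h^*$. The distinguished positive even roots $\Delta_0^+$ are $\epsilon_j\pm\epsilon_k$ $(1\le j<k\le m)$ and $2\delta$, together with $\epsilon_i$ $(1\le i\le m)$ if $n$ is odd; the positive odd roots $\Delta_1^+$ are $\delta\pm\epsilon_i$ $(1\le i\le m)$, together with $\delta$ if $n$ is odd. Let $\mathfrak g=\bigoplus_{k=-2}^{2}\mathfrak g_k$ be the $\mathbb Z$-grading by the coefficient of $\delta$ in the roots, so that $\mathfrak g_0\cong\mathfrak{o}(n)\oplus\mathbb C$, and put $\mathfrak u=\mathfrak g_1\oplus\mathfrak g_2$. For a weight $\lambda\in\mathfrak h^*$ let $L_\lambda$ and $L^{(0)}_\lambda$ denote the irreducible $\mathfrak g$-module and the irreducible $\mathfrak g_0$-module with highest weight $\lambda$, with respect to the positive roots of $\mathfrak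 g$ and the positive roots $\Delta_0^+\setminus\{2\delta\}$ of $\mathfrak g_0$. If $L^{(0)}_\lambda$ is finite dimensional, let $$M_\lambda=\operatorname{Ind}^{\mathfrak g}_{\mathfrak g_0\oplus\mathfrak u}L^{(0)}_\lambda,\qquad \mathfrak u L^{(0)}_\lambda=0,$$ be the generalized Verma module. For a $\mathfrak g$-module $V$ that is the direct sum of finite-dimensional weight spaces $V_\mu$, let $\operatorname{ch}V=\sum_{\mu\in\mathfrak h^*}(\dim V_\mu)\,e^\mu$ be its formal character. Then the module $L_0$ is the trivial one-dimensional module, the $\mathfrak g_0$-modules $L^{(0)}_{i\epsilon_1-i\delta}$ $(i\ge 0)$ are finite dimensional, the modules $L_0$ and $M_{i\epsilon_1-i\delta}$ $(i\ge0)$ have formal characters, and $$\operatorname{ch}L_0=\sum_{i=0}^\infty(-1)^i\operatorname{ch}M_{i\epsilon_1-i\delta},$$ where for each weight $\mu$ only finitely many terms of the series have a nonzero coefficient at $e^\mu$. -/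

import Mathlib

open scoped Matrix TensorProduct

noncomputable section

namespace Osp

/-! ### The general linear Lie superalgebra of `ℂ^{n|2}`, where `n = 2 * m + r` -/

/-- Index set of the basis of `ℂ^{n|2}`, `n = 2 * m + r` with `r = 0` or `r = 1`: the first summand
indexes the even basis vectors, the second one the two odd basis vectors. -/
abbrev Idx (m r : ℕ) : Type := ((Fin m ⊕ Fin m) ⊕ Fin r) ⊕ Fin 2

/-- Parity of a basis vector of `ℂ^{n|2}`. -/
def parity {m r : ℕ} : Idx m r → ZMod 2 := Sum.elim (fun _ => 0) (fun _ => 1)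

/-- The underlying superspace `End ℂ^{n|2}` of `gl(n|2)`. -/
abbrev Gl (m r : ℕ) : Type := Matrix (Idx m r) (Idx m r) ℂ

/-- The sign `(-1)^{a b}`. -/
def ksign (a b : ZMod 2) : ℂ := (-1) ^ (a.val * b.val)

/-- The homogeneous vectors of degree `τ` in `ℂ^{n|2}`. -/
def vecPart (m r : ℕ) (τ : ZMod 2) : Submodule ℂ (Idx m r → ℂ) where
  carrier := {x | ∀ i, parity i ≠ τ → x i = 0}
  add_mem' hx hy i hi := by simp [hx i hi, hy i hi]
  zero_mem' i _ := rfl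
  smul_mem' c x hx i hi := by simp [hx i hi]

/-- `gl(n|2)_ς`: the endomorphisms that map `V_τ` into `V_{ς + τ}`, written as matrices. -/
def glPart (m r : ℕ) (ς : ZMod 2) : Submodule ℂ (Gl m r) where
  carrier := {X | ∀ i j, parity i ≠ ς + parity j → X i j = 0}
  add_mem' hx hy i j hi := by simp [hx i j hi, hy i j hi]
  zero_mem' i j _ := rfl
  smul_mem' c x hx i j hi := by simp [hx i j hi]

/-- The homogeneous component of degree `ς` of a matrix. -/
def comp {m r : ℕ} (ς : ZMod 2) : Gl m r →ₗ[ℂ] Gl m r where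
  toFun X := Matrix.of fun i j => if parity i = ς + parity j then X i j else 0
  map_add' X Y := by ext i j; simp only [Matrix.of_apply, Matrix.add_apply]; split_ifs <;> simp
  map_smul' c X := by ext i j; simp

/-- The superbracket of `gl(n|2)`, the bilinear extension of
`[ξ, η] = ξ η - (-1)^{deg ξ deg η} η ξ`; see `superBracket_of_mem`. -/
def superBracket {m r : ℕ} (X Y : Gl m r) : Gl m r :=
  ∑ a : ZMod 2, ∑ b : ZMod 2,
    (comp a X * comp b Y - ksign a b • (comp b Y * comp a X))

theorem comp_of_mem {m r : ℕ} {a : ZMod 2} {X : Gl m r} (hX : X ∈ glPart m r a) (b : ZMod 2) :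
    comp b X = if b = a then X else 0 := by
  ext i j
  by_cases h : b = a
  · subst h
    by_cases h' : parity i = b + parity j
    · simp [comp, h']
    · simp [comp, h', hX i j h']
  · by_cases h' : parity i = b + parity j
    · have : parity i ≠ a + parity j := fun h2 => h (add_right_cancel (h'.symm.trans h2))
      simp [comp, h, hX i j this]
    · simp [comp, h, h']

/-- On homogeneous elements the superbracket is the usual supercommutator. -/
theorem superBracket_of_mem {m r : ℕ} {a b : ZMod 2} {X Y : Gl m r}
    (hX : X ∈ glPart m r a) (hY : Y ∈ glPart m r b) :
    superBracket X Y = X * Y - ksign a b • (Y * X) := by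
  unfold superBracket
  rw [Finset.sum_eq_single a, Finset.sum_eq_single b]
  · simp [comp_of_mem hX, comp_of_mem hY]
  · intro c _ hc; simp [comp_of_mem hY, hc]
  · simp
  · intro c _ hc; simp [comp_of_mem hX, hc]
  · simp

theorem superBracket_add_left {m r : ℕ} (X X' Y : Gl m r) :
    superBracket (X + X') Y = superBracket X Y + superBracket X' Y := by
  simp only [superBracket, map_add, add_mul, mul_add, smul_add, ← Finset.sum_add_distrib]
  refine Finset.sum_congr rfl fun a _ => Finset.sum_congr rfl fun b _ => ?_
  abel

theorem superBracket_add_right {m r : ℕ} (X Y Y' : Gl m r) :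
    superBracket X (Y + Y') = superBracket X Y + superBracket X Y' := by
  simp only [superBracket, map_add, add_mul, mul_add, smul_add, ← Finset.sum_add_distrib]
  refine Finset.sum_congr rfl fun a _ => Finset.sum_congr rfl fun b _ => ?_
  abel

theorem superBracket_smul_right {m r : ℕ} (c : ℂ) (X Y : Gl m r) :
    superBracket X (c • Y) = c • superBracket X Y := by
  simp only [superBracket, map_smul, Matrix.mul_smul, Matrix.smul_mul, Finset.smul_sum, smul_sub,
    smul_comm c]

/-- A Lie subsuperalgebra of `gl(n|2)`: a graded subspace closed under the superbracket. -/
structure SubSuperalgebra (m r : ℕ) where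
  carrier : Submodule ℂ (Gl m r)
  comp_mem : ∀ (ς : ZMod 2) (x : Gl m r), x ∈ carrier → comp ς x ∈ carrier
  bracket_mem : ∀ x y : Gl m r, x ∈ carrier → y ∈ carrier → superBracket x y ∈ carrier

/-! ### The orthosymplectic Lie superalgebra -/

/-- The matrix of the form `F`: the blocks `(0, 1; 1, 0)` and (for odd `n`) `1` on the even part,
the block `(0, 1; -1, 0)` on the odd part. -/
def formMatrix (m r : ℕ) : Gl m r :=
  Matrix.fromBlocks (Matrix.fromBlocks (Matrix.fromBlocks 0 1 1 0) 0 0 1) 0 0 !![0, 1; -1, 0]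

/-- The form `F` on `ℂ^{n|2}`. -/
def form {m r : ℕ} (x y : Idx m r → ℂ) : ℂ := x ⬝ᵥ (formMatrix m r *ᵥ y)

/-- `osp(n|2)_ς`. -/
def ospPart (m r : ℕ) (ς : ZMod 2) : Submodule ℂ (Gl m r) where
  carrier := {X | X ∈ glPart m r ς ∧ ∀ τ : ZMod 2, ∀ x ∈ vecPart m r τ, ∀ y : Idx m r → ℂ,
    form (X *ᵥ x) y = -ksign ς τ * form x (X *ᵥ y)}
  add_mem' := by
    rintro X Y ⟨hX, hX'⟩ ⟨hY, hY'⟩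
    refine ⟨(glPart m r ς).add_mem hX hY, fun τ x hx y => ?_⟩
    have h1 := hX' τ x hx y
    have h2 := hY' τ x hx y
    simp only [form, Matrix.add_mulVec, add_dotProduct, Matrix.mulVec_add, dotProduct_add] at h1 h2 ⊢
    rw [h1, h2]; ring
  zero_mem' := ⟨(glPart m r ς).zero_mem, fun τ x hx y => by simp [form]⟩
  smul_mem' := by
    rintro c X ⟨hX, hX'⟩
    refine ⟨(glPart m r ς).smul_mem c hX, fun τ x hx y => ?_⟩
    have h1 := hX' τ x hx y
    simp only [form, Matrix.smul_mulVec, smul_dotProduct, Matrix.mulVec_smul, dotProduct_smul,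
      smul_eq_mul] at h1 ⊢
    rw [h1]; ring

theorem mulVec_mem_vecPart {m r : ℕ} {a τ : ZMod 2} {X : Gl m r} {x : Idx m r → ℂ}
    (hX : X ∈ glPart m r a) (hx : x ∈ vecPart m r τ) : X *ᵥ x ∈ vecPart m r (a + τ) := by
  intro i hi
  change ∑ j, X i j * x j = 0
  refine Finset.sum_eq_zero fun j _ => ?_
  by_cases hj : parity j = τ
  · have : X i j = 0 := hX i j (by rwa [hj])
    simp [this]
  · simp [hx j hj]

theorem mul_mem_glPart {m r : ℕ} {a b : ZMod 2} {X Y : Gl m r}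
    (hX : X ∈ glPart m r a) (hY : Y ∈ glPart m r b) : X * Y ∈ glPart m r (a + b) := by
  intro i j hij
  rw [Matrix.mul_apply]
  refine Finset.sum_eq_zero fun k _ => ?_
  by_cases hk : parity k = b + parity j
  · have : X i k = 0 := hX i k (by rwa [hk, ← add_assoc])
    simp [this]
  · simp [hY k j hk]

theorem ksign_add_right (a b c : ZMod 2) : ksign a (b + c) = ksign a b * ksign a c := by
  have key : ∀ a : ZMod 2, a = 0 ∨ a = 1 := by decide
  have h : (1 + 1 : ZMod 2) = 0 := by decide
  rcases key a with rfl | rfl <;> rcases key b with rfl | rfl <;> rcases key c with rfl | rfl <;>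
    simp [ksign, h, ZMod.val_one]

theorem ksign_comm (a b : ZMod 2) : ksign a b = ksign b a := by
  unfold ksign; rw [mul_comm]

theorem ksign_mul_self (a b : ZMod 2) : ksign a b * ksign a b = 1 := by
  unfold ksign; rw [← mul_pow]; norm_num

theorem superBracket_mem_ospPart {m r : ℕ} {a b : ZMod 2} {X Y : Gl m r}
    (hX : X ∈ ospPart m r a) (hY : Y ∈ ospPart m r b) :
    superBracket X Y ∈ ospPart m r (a + b) := by
  rw [superBracket_of_mem hX.1 hY.1]
  refine ⟨sub_mem (mul_mem_glPart hX.1 hY.1)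
    (Submodule.smul_mem _ _ (add_comm b a ▸ mul_mem_glPart hY.1 hX.1)), fun τ x hx y => ?_⟩
  have h1 : form ((X * Y) *ᵥ x) y
      = ksign a (b + τ) * ksign b τ * form x ((Y * X) *ᵥ y) := by
    rw [← Matrix.mulVec_mulVec, hX.2 _ _ (mulVec_mem_vecPart hY.1 hx) y, hY.2 τ x hx,
      Matrix.mulVec_mulVec]
    ring
  have h2 : form ((Y * X) *ᵥ x) y
      = ksign b (a + τ) * ksign a τ * form x ((X * Y) *ᵥ y) := by
    rw [← Matrix.mulVec_mulVec, hY.2 _ _ (mulVec_mem_vecPart hX.1 hx) y, hX.2 τ x hx,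
      Matrix.mulVec_mulVec]
    ring
  have e1 : form ((X * Y - ksign a b • (Y * X)) *ᵥ x) y
      = form ((X * Y) *ᵥ x) y - ksign a b * form ((Y * X) *ᵥ x) y := by
    simp [form, Matrix.sub_mulVec, Matrix.smul_mulVec, sub_dotProduct]
  have e2 : form x ((X * Y - ksign a b • (Y * X)) *ᵥ y)
      = form x ((X * Y) *ᵥ y) - ksign a b * form x ((Y * X) *ᵥ y) := by
    simp [form, Matrix.sub_mulVec, Matrix.smul_mulVec, Matrix.mulVec_sub, Matrix.mulVec_smul]
  rw [e1, e2, h1, h2, ksign_add_right a, ksign_add_right b, ksign_comm (a + b) τ,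
    ksign_add_right τ, ksign_comm b a, ksign_comm τ a, ksign_comm τ b]
  linear_combination (-ksign a τ * ksign b τ * form x ((X * Y) *ᵥ y)) * ksign_mul_self a b

/-- The Lie superalgebra `osp(n|2) = osp(n|2)_0 ⊕ osp(n|2)_1`, `n = 2 * m + r`. -/
def osp (m r : ℕ) : SubSuperalgebra m r where
  carrier := ospPart m r 0 ⊔ ospPart m r 1
  comp_mem := by
    intro ς x hx
    obtain ⟨x0, h0, x1, h1, rfl⟩ := Submodule.mem_sup.1 hx
    rw [map_add, comp_of_mem h0.1, comp_of_mem h1.1]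
    refine add_mem ?_ ?_
    · split_ifs
      · exact Submodule.mem_sup_left h0
      · exact zero_mem _
    · split_ifs
      · exact Submodule.mem_sup_right h1
      · exact zero_mem _
  bracket_mem := by
    intro x y hx hy
    obtain ⟨x0, hx0, x1, hx1, rfl⟩ := Submodule.mem_sup.1 hx
    obtain ⟨y0, hy0, y1, hy1, rfl⟩ := Submodule.mem_sup.1 hy
    rw [superBracket_add_left, superBracket_add_right, superBracket_add_right]
    have e : (1 + 1 : ZMod 2) = 0 := by decide
    have h00 := superBracket_mem_ospPart hx0 hy0
    have h01 := superBracket_mem_ospPart hx0 hy1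
    have h10 := superBracket_mem_ospPart hx1 hy0
    have h11 := superBracket_mem_ospPart hx1 hy1
    rw [add_zero] at h00 h10
    rw [zero_add] at h01
    rw [e] at h11
    exact add_mem
      (add_mem (Submodule.mem_sup_left h00) (Submodule.mem_sup_right h01))
      (add_mem (Submodule.mem_sup_right h10) (Submodule.mem_sup_left h11))

/-! ### Cartan subalgebra, weights and roots -/

/-- The Cartan subalgebra `𝔥`: the diagonal matrices in `osp(n|2)`. -/
def cartan (m r : ℕ) : Submodule ℂ (Gl m r) where
  carrier := {X | X ∈ (osp m r).carrier ∧ X.IsDiag}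
  add_mem' hX hY := ⟨add_mem hX.1 hY.1, hX.2.add hY.2⟩
  zero_mem' := ⟨zero_mem _, Matrix.isDiag_zero⟩
  smul_mem' c _ hX := ⟨Submodule.smul_mem _ c hX.1, hX.2.smul c⟩

/-- Weights: the elements of `𝔥^*`. -/
abbrev Weight (m r : ℕ) : Type := Module.Dual ℂ (cartan m r)

/-- A diagonal entry as a linear functional on `𝔥`. -/
def entry {m r : ℕ} (k : Idx m r) : Weight m r where
  toFun H := H.1 k k
  map_add' _ _ := rfl
  map_smul' _ _ := rfl

/-- The weight `ε_{i+1}` (`i : Fin m` is counted from `0`): the weight of the `i`-th even basis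
vector. -/
def ε {m r : ℕ} (i : Fin m) : Weight m r := entry (Sum.inl (Sum.inl (Sum.inl i)))

/-- The weight `δ`: the weight of the first odd basis vector. -/
def δ {m r : ℕ} : Weight m r := entry (Sum.inr 0)

/-- The positive even roots `Δ_0^+` of the distinguished root system. -/
def evenPosRoots (m r : ℕ) : Set (Weight m r) :=
  {α | ∃ j k : Fin m, j < k ∧ (α = ε j + ε k ∨ α = ε j - ε k)} ∪ {(2 : ℂ) • δ} ∪
    {α | r = 1 ∧ ∃ i : Fin m, α = ε i}

/-- The positive odd roots `Δ_1^+` of the distinguished root system. -/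
def oddPosRoots (m r : ℕ) : Set (Weight m r) :=
  {α | ∃ i : Fin m, α = δ + ε i ∨ α = δ - ε i} ∪ {α | r = 1 ∧ α = δ}

/-- The root space `𝔤_α` of `𝔤 = osp(n|2)`. -/
def rootSpace {m r : ℕ} (α : Weight m r) : Submodule ℂ (Gl m r) where
  carrier := {X | X ∈ (osp m r).carrier ∧ ∀ H : cartan m r, superBracket H.1 X = α H • X}
  add_mem' hX hY := ⟨add_mem hX.1 hY.1, fun H => by
    rw [superBracket_add_right, hX.2, hY.2, smul_add]⟩
  zero_mem' := ⟨zero_mem _, fun H => by simp [superBracket]⟩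
  smul_mem' c _ hX := ⟨Submodule.smul_mem _ c hX.1, fun H => by
    rw [superBracket_smul_right, hX.2, smul_comm]⟩

/-! ### The `ℤ`-grading -/

/-- The grading element of `𝔥`, on which `δ` is `1` and every `ε_i` is `0`. -/
def gradingElement (m r : ℕ) : Gl m r := Matrix.diagonal (Sum.elim (fun _ => 0) ![1, -1])

/-- The piece `𝔤_k` of the `ℤ`-grading of `𝔤 = osp(n|2)`: the sum of the root spaces
(`𝔥` included for the root `0`) whose root has `δ`-coefficient `k`, that is, the `k`-eigenspace
of the grading element. Hence `𝔤_0` is spanned by `𝔥` and the root spaces of the roots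
`±α`, `α ∈ Δ_0^+ \ {2δ}`, `𝔤_1` by the root spaces of the roots in `Δ_1^+`,
and `𝔤_2` is the root space of `2δ`. -/
def gradedPiece (m r : ℕ) (k : ℤ) : Submodule ℂ (Gl m r) where
  carrier := {X | X ∈ (osp m r).carrier ∧ superBracket (gradingElement m r) X = (k : ℂ) • X}
  add_mem' hX hY := ⟨add_mem hX.1 hY.1, by rw [superBracket_add_right, hX.2, hY.2, smul_add]⟩
  zero_mem' := ⟨zero_mem _, by simp [superBracket]⟩
  smul_mem' c _ hX := ⟨Submodule.smul_mem _ c hX.1, by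
    rw [superBracket_smul_right, hX.2, smul_comm]⟩

theorem comp_mem_glPart {m r : ℕ} (a : ZMod 2) (X : Gl m r) : comp a X ∈ glPart m r a := by
  intro i j hij
  simp [comp, hij]

theorem comp_zero_add_comp_one {m r : ℕ} (X : Gl m r) : comp 0 X + comp 1 X = X := by
  ext i j
  have key : ∀ p q : ZMod 2, (p = q ∧ p ≠ 1 + q) ∨ (p ≠ q ∧ p = 1 + q) := by decide
  rcases key (parity i) (parity j) with ⟨h1, h2⟩ | ⟨h1, h2⟩
  · have h2' : ¬ parity i = 1 + parity j := h2
    simp [comp, h1]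
  · have h1' : ¬ parity i = parity j := h1
    simp [comp, h2]

theorem gradingElement_mem {m r : ℕ} : gradingElement m r ∈ glPart m r 0 := by
  intro i j hij
  refine Matrix.diagonal_apply_ne _ ?_
  rintro rfl
  exact hij (by simp)

/-- Bracketing with an even element is taking the commutator. -/
theorem superBracket_even_left {m r : ℕ} {X : Gl m r} (hX : X ∈ glPart m r 0) (Y : Gl m r) :
    superBracket X Y = X * Y - Y * X := by
  have h0 := superBracket_of_mem hX (comp_mem_glPart 0 Y)
  have h1 := superBracket_of_mem hX (comp_mem_glPart 1 Y)
  have k0 : ksign 0 0 = 1 := by simp [ksign]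
  have k1 : ksign 0 1 = 1 := by simp [ksign]
  rw [k0, one_smul] at h0
  rw [k1, one_smul] at h1
  conv_lhs => rw [← comp_zero_add_comp_one Y]
  conv_rhs => rw [← comp_zero_add_comp_one Y]
  rw [superBracket_add_right, h0, h1]
  noncomm_ring

theorem comp_superBracket_even_left {m r : ℕ} {X : Gl m r} (hX : X ∈ glPart m r 0)
    (a : ZMod 2) (Y : Gl m r) : comp a (superBracket X Y) = superBracket X (comp a Y) := by
  have hm : ∀ b, superBracket X (comp b Y) ∈ glPart m r b := fun b => by
    rw [superBracket_even_left hX]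
    refine sub_mem ?_ ?_
    · simpa using mul_mem_glPart hX (comp_mem_glPart b Y)
    · simpa using mul_mem_glPart (comp_mem_glPart b Y) hX
  conv_lhs => rw [← comp_zero_add_comp_one Y]
  rw [superBracket_add_right, map_add, comp_of_mem (hm 0), comp_of_mem (hm 1)]
  have key : ∀ a : ZMod 2, a = 0 ∨ a = 1 := by decide
  rcases key a with rfl | rfl <;> simp

/-- The Lie algebra `𝔤_0 ≅ 𝔬(n) ⊕ ℂ`. -/
def levi (m r : ℕ) : SubSuperalgebra m r where
  carrier := gradedPiece m r 0
  comp_mem := by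
    rintro ς x ⟨hx, hx'⟩
    refine ⟨(osp m r).comp_mem ς x hx, ?_⟩
    rw [← comp_superBracket_even_left gradingElement_mem, hx', map_smul]
  bracket_mem := by
    rintro x y ⟨hx, hx'⟩ ⟨hy, hy'⟩
    refine ⟨(osp m r).bracket_mem x y hx hy, ?_⟩
    simp only [Int.cast_zero, zero_smul] at hx' hy' ⊢
    have hc : ∀ z : Gl m r, superBracket (gradingElement m r) z = 0 → ∀ a,
        Commute (gradingElement m r) (comp a z) := fun z hz a => by
      have := comp_superBracket_even_left gradingElement_mem a z
      rw [hz, map_zero, superBracket_even_left gradingElement_mem] at this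
      exact sub_eq_zero.1 this.symm
    rw [superBracket_even_left gradingElement_mem, sub_eq_zero]
    change Commute _ _
    refine Commute.sum_right _ _ _ fun a _ => Commute.sum_right _ _ _ fun b _ => ?_
    exact ((hc x hx' a).mul_right (hc y hy' b)).sub_right
      (((hc y hy' b).mul_right (hc x hx' a)).smul_right _)

/-- The nilradical `𝔲 = 𝔤_1 ⊕ 𝔤_2` of the parabolic subalgebra `𝔤_0 ⊕ 𝔲`. -/
def nilradical (m r : ℕ) : Submodule ℂ (Gl m r) := gradedPiece m r 1 ⊔ gradedPiece m r 2

/-! ### Enveloping algebras and highest weight modules -/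

variable {m r : ℕ}

/-- The defining relations `x y - (-1)^{deg x deg y} y x = [x, y]` (for homogeneous `x`, `y`) of the
universal enveloping algebra of a Lie superalgebra. -/
inductive EnvRel (𝔞 : SubSuperalgebra m r) :
    TensorAlgebra ℂ 𝔞.carrier → TensorAlgebra ℂ 𝔞.carrier → Prop
  | mk (a b : ZMod 2) (x y : 𝔞.carrier) (hx : x.1 ∈ glPart m r a) (hy : y.1 ∈ glPart m r b) :
      EnvRel 𝔞
        (TensorAlgebra.ι ℂ x * TensorAlgebra.ι ℂ y -
          ksign a b • (TensorAlgebra.ι ℂ y * TensorAlgebra.ι ℂ x))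
        (TensorAlgebra.ι ℂ ⟨superBracket x.1 y.1, 𝔞.bracket_mem x.1 y.1 x.2 y.2⟩)

/-- The universal enveloping algebra `U(𝔞)` of a Lie superalgebra. Modules over `𝔞` are modules
over `U(𝔞)`. -/
def Env (𝔞 : SubSuperalgebra m r) : Type := RingQuot (EnvRel 𝔞)

instance (𝔞 : SubSuperalgebra m r) : Ring (Env 𝔞) := inferInstanceAs (Ring (RingQuot (EnvRel 𝔞)))

instance (𝔞 : SubSuperalgebra m r) : Algebra ℂ (Env 𝔞) :=
  inferInstanceAs (Algebra ℂ (RingQuot (EnvRel 𝔞)))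

/-- The canonical map `𝔞 → U(𝔞)`. -/
def env (𝔞 : SubSuperalgebra m r) : 𝔞.carrier →ₗ[ℂ] Env 𝔞 :=
  (RingQuot.mkAlgHom ℂ (EnvRel 𝔞)).toLinearMap ∘ₗ TensorAlgebra.ι ℂ

/-- The left ideal of `U(𝔞)` generated by the root vectors in `𝔞` of the roots in `P` and by
`H - lam(H)`, `H ∈ 𝔥`. If `P` is the set of positive roots of `𝔞`, the quotient of `U(𝔞)` by it is
the Verma module of highest weight `lam`. -/
def vermaIdeal (𝔞 : SubSuperalgebra m r) (P : Set (Weight m r)) (lam : Weight m r) :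
    Submodule (Env 𝔞) (Env 𝔞) :=
  Submodule.span (Env 𝔞)
    ({u | ∃ x : 𝔞.carrier, (∃ α ∈ P, x.1 ∈ rootSpace α) ∧ u = env 𝔞 x} ∪
      {u | ∃ (x : 𝔞.carrier) (H : cartan m r), x.1 = H.1 ∧
        u = env 𝔞 x - algebraMap ℂ (Env 𝔞) (lam H)})

/-- The sum of all proper left ideals containing `vermaIdeal`, that is, the preimage in `U(𝔞)` of
the maximal proper submodule of the Verma module. -/
def maxIdeal (𝔞 : SubSuperalgebra m r) (P : Set (Weight m r)) (lam : Weight m r) :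
    Submodule (Env 𝔞) (Env 𝔞) :=
  sSup {I | vermaIdeal 𝔞 P lam ≤ I ∧ I ≠ ⊤}

/-- The irreducible `𝔞`-module with highest weight `lam` (with respect to the positive roots `P`):
the irreducible quotient of the Verma module. -/
abbrev IrrModule (𝔞 : SubSuperalgebra m r) (P : Set (Weight m r)) (lam : Weight m r) : Type :=
  Env 𝔞 ⧸ maxIdeal 𝔞 P lam

/-- `L_lam`, the irreducible `osp(n|2)`-module with highest weight `lam`. -/
abbrev L (lam : Weight m r) : Type :=
  IrrModule (osp m r) (evenPosRoots m r ∪ oddPosRoots m r) lam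

/-- `L^{(0)}_lam`, the irreducible `𝔤_0`-module with highest weight `lam`. -/
abbrev LeviL (lam : Weight m r) : Type :=
  IrrModule (levi m r) (evenPosRoots m r \ {(2 : ℂ) • δ}) lam

/-- The submodule of `U(𝔤) ⊗ V` by which one divides to get the induced module: it identifies
`u x ⊗ v` with `u ⊗ x v` for `x ∈ 𝔤_0 ⊕ 𝔲`, where `𝔲` acts on `V` by zero. -/
def indRel (V : Type) [AddCommGroup V] [Module ℂ V] [Module (Env (levi m r)) V] :
    Submodule (Env (osp m r)) (Env (osp m r) ⊗[ℂ] V) :=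
  Submodule.span (Env (osp m r))
    ({t | ∃ (x : (levi m r).carrier) (y : (osp m r).carrier) (v : V), y.1 = x.1 ∧
        t = env (osp m r) y ⊗ₜ[ℂ] v - 1 ⊗ₜ[ℂ] (env (levi m r) x • v)} ∪
      {t | ∃ (y : (osp m r).carrier) (v : V), y.1 ∈ nilradical m r ∧
        t = env (osp m r) y ⊗ₜ[ℂ] v})

/-- The induced module `Ind_{𝔤_0 ⊕ 𝔲}^{𝔤} V`, where the `𝔤_0`-module `V` is extended by
`𝔲 V = 0`. -/
abbrev Ind (V : Type) [AddCommGroup V] [Module ℂ V] [Module (Env (levi m r)) V] : Type :=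
  (Env (osp m r) ⊗[ℂ] V) ⧸ indRel V

/-- The generalized Verma module `M_lam`. -/
abbrev M (lam : Weight m r) : Type := Ind (m := m) (r := r) (LeviL lam)

/-! ### Formal characters -/

/-- The weight space `V_μ` of an `osp(n|2)`-module `V`. -/
def weightSpace (V : Type) [AddCommGroup V] [Module ℂ V] [Module (Env (osp m r)) V]
    [IsScalarTower ℂ (Env (osp m r)) V] (μ : Weight m r) : Submodule ℂ V where
  carrier := {v | ∀ H : cartan m r, env (osp m r) ⟨H.1, H.2.1⟩ • v = μ H • v}
  add_mem' hv hw H := by rw [smul_add, smul_add, hv H, hw H]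
  zero_mem' H := by simp
  smul_mem' c v hv H := by
    rw [← algebraMap_smul (Env (osp m r)) c v, ← mul_smul, ← Algebra.commutes, mul_smul, hv H,
      algebraMap_smul, algebraMap_smul, smul_comm]

/-- `V` is the sum of its weight spaces and these are finite dimensional, so that `V` has a formal
character. -/
def HasCharacter (m r : ℕ) (V : Type) [AddCommGroup V] [Module ℂ V] [Module (Env (osp m r)) V]
    [IsScalarTower ℂ (Env (osp m r)) V] : Prop :=
  (⨆ μ : Weight m r, weightSpace V μ) = ⊤ ∧
    ∀ μ : Weight m r, FiniteDimensional ℂ (weightSpace V μ)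

/-- The formal character `ch V = ∑_μ dim V_μ e^μ`, as the function `μ ↦ dim V_μ` on `𝔥^*`. -/
def ch (V : Type) [AddCommGroup V] [Module ℂ V] [Module (Env (osp m r)) V]
    [IsScalarTower ℂ (Env (osp m r)) V] : Weight m r → ℤ :=
  fun μ => (Module.finrank ℂ (weightSpace V μ) : ℤ)

end Osp

end

/-! Write `q` for `e^{-δ}`, and `S^i`, `Λ^j`, `H_i` for the characters of the symmetric powers, the
exterior powers and the harmonic polynomials of degree `i` of `ℂ^n`. The opposite nilradical
consists of a copy of `ℂ^n` in odd degree, with weights `χ - δ`, and one even vector of weight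
`-2δ`. The Levi module of highest weight `iε₁ - iδ` is the space of harmonic polynomials of degree
`i`, shifted by `-iδ`. Hence `ch M_i = q^i H_i · (∑ q^j Λ^j) / (1 - q²)`. Since the Laplacian is
surjective, `H_i = S^i - S^{i-2}`, so `∑ (-1)^i q^i H_i = (1 - q²) ∑ (-1)^i q^i S^i`. The factor `1
- q²` cancels, and the Koszul identity `(∑ (-1)^i q^i S^i)(∑ q^j Λ^j) = 1` leaves the trivial
character. In coefficients this is `sum_neg_one_pow_mul_of_telescoping` followed by
`sum_neg_one_pow_mul_symExtMult`.

The two structural inputs, the shape of the Levi modules and the freeness of `M_i` over the opposite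
nilradical, both come from one explicit representation. Let `gl(n|2)` act by quadratic expressions
in creation and annihilation operators for two copies of `ℂ^{n|2}`, the second with reversed parity,
and allow negative exponents in the bosonic variables of the odd basis vectors. For harmonic `p` of
degree `i`, fill the fermionic state of weight `δ` and give the bosonic variable of weight `δ` the
exponent `-i-1`. These vectors have `δ`-coefficient `-i`, are killed by `𝔲`
(`fockAct_nilradical_embed`) and form an irreducible Levi module (`eq_harmonic_of_rot_mem`).

Spanning of `M_i` by ordered monomials is a straightening argument (`lowerSpan_eq_top`).
Independence is proved on the Fock space: the part of a monomial's value with the most fermions is a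
single term, and its coefficient is nonzero because negative exponents are never differentiated to
zero (`eq_zero_of_sum_lowerMonomial_smul_embed`). Frobenius reciprocity transfers this to `M_i`
(`indSum_leviL_bijective`).

The irreducible modules are quotients by the sum of all proper left ideals above the Verma ideal.
They are recognised in concrete models through `maxIdeal_eq_of_isCoatom`: a maximal left ideal
containing the Verma ideal is already this sum. For `L_0` that ideal is the kernel of the
augmentation. -/

noncomputable section

namespace Osp

variable {m r : ℕ}

/-! ### Matrix entries of elements of `osp(n|2)` -/

/-- Index set of the basis of the even part `ℂ^n`. -/
abbrev EvenIdx (m r : ℕ) : Type := (Fin m ⊕ Fin m) ⊕ Fin r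

/-- The involution of the even indices given by the form. -/
def evenDual (w : EvenIdx m r) : EvenIdx m r := Sum.map Sum.swap id w

/-- The involution of the indices: `dual i` is the index of the basis vector paired with the
`i`-th one. -/
def dual (i : Idx m r) : Idx m r := Sum.map evenDual Fin.rev i

@[simp] theorem evenDual_evenDual (w : EvenIdx m r) : evenDual (evenDual w) = w := by
  rcases w with (w | w) | w <;> rfl

@[simp] theorem dual_dual (i : Idx m r) : dual (dual i) = i := by
  rcases i with i | i <;> simp [dual]

theorem dual_injective : Function.Injective (dual : Idx m r → Idx m r) :=
  Function.LeftInverse.injective dual_dual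

theorem dual_eq_comm {i j : Idx m r} : dual i = j ↔ i = dual j := by
  constructor <;> rintro rfl <;> simp

theorem evenDual_eq_comm {i j : EvenIdx m r} : evenDual i = j ↔ i = evenDual j := by
  constructor <;> rintro rfl <;> simp

@[simp] theorem dual_inl (w : EvenIdx m r) : dual (Sum.inl w) = Sum.inl (evenDual w) := rfl

@[simp] theorem dual_inr_zero : dual (Sum.inr 0 : Idx m r) = Sum.inr 1 := rfl

@[simp] theorem dual_inr_one : dual (Sum.inr 1 : Idx m r) = Sum.inr 0 := rfl

@[simp] theorem parity_inl (w : EvenIdx m r) : parity (Sum.inl w : Idx m r) = 0 := rfl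

@[simp] theorem parity_inr (k : Fin 2) : parity (Sum.inr k : Idx m r) = 1 := rfl

@[simp] theorem parity_dual (i : Idx m r) : parity (dual i) = parity i := by
  rcases i with i | i <;> rfl

@[simp] theorem ksign_zero_left (a : ZMod 2) : ksign 0 a = 1 := by simp [ksign]

@[simp] theorem ksign_zero_right (a : ZMod 2) : ksign a 0 = 1 := by simp [ksign]

@[simp] theorem ksign_one_one : ksign 1 1 = -1 := by simp [ksign, ZMod.val_one]

theorem zmod_two_cases (a : ZMod 2) : a = 0 ∨ a = 1 := by revert a; decide

theorem zmod_two_one_add_one : (1 + 1 : ZMod 2) = 0 := by decide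

/-- The sign `F(e_i, e_{dual i})`. -/
def formSign : Idx m r → ℂ := Sum.elim (fun _ => 1) ![1, -1]

@[simp] theorem formSign_inl (w : EvenIdx m r) : formSign (Sum.inl w : Idx m r) = 1 := rfl

@[simp] theorem formSign_inr_zero : formSign (Sum.inr 0 : Idx m r) = 1 := rfl

@[simp] theorem formSign_inr_one : formSign (Sum.inr 1 : Idx m r) = -1 := rfl

theorem formSign_mul_self (i : Idx m r) : formSign i * formSign i = 1 := by
  rcases i with i | i
  · simp
  · fin_cases i <;> simp

theorem formMatrix_mulVec (y : Idx m r → ℂ) (i : Idx m r) :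
    (formMatrix m r *ᵥ y) i = formSign i * y (dual i) := by
  simp only [Matrix.mulVec, dotProduct, formMatrix, Fintype.sum_sum_type]
  rcases i with ((i | i) | i) | i
  · simp [dual, evenDual, Matrix.one_apply]
  · simp [dual, evenDual, Matrix.one_apply]
  · simp [dual, evenDual, Matrix.one_apply]
  · fin_cases i <;> simp [dual, Fin.rev]

theorem form_eq_sum (x y : Idx m r → ℂ) : form x y = ∑ i, x i * (formSign i * y (dual i)) := by
  simp only [form, dotProduct, formMatrix_mulVec]

/-- The sign relating the entries of an element of `osp(n|2)`. -/
def adjSign (i j : Idx m r) : ℂ := ksign (parity i + parity j) (parity j) * formSign i * formSign j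

theorem adjSign_mul_self (i j : Idx m r) : adjSign i j * adjSign i j = 1 := by
  unfold adjSign
  linear_combination (formSign i * formSign i * (formSign j * formSign j)) *
    ksign_mul_self (parity i + parity j) (parity j) + (formSign j * formSign j) *
    formSign_mul_self i + formSign_mul_self j

@[simp] theorem adjSign_dual (i j : Idx m r) : adjSign (dual j) (dual i) = adjSign i j := by
  unfold adjSign
  rcases i with i | i <;> rcases j with j | j
  · simp
  · fin_cases j <;> simp
  · fin_cases i <;> simp
  · fin_cases i <;> fin_cases j <;> simp [zmod_two_one_add_one]

@[simp] theorem adjSign_inl_inl (i j : EvenIdx m r) :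
    adjSign (Sum.inl i : Idx m r) (Sum.inl j) = 1 := by simp [adjSign]

@[simp] theorem adjSign_self (i : Idx m r) : adjSign i i = 1 := by
  have h : parity i + parity i = 0 := by
    rcases zmod_two_cases (parity i) with h | h <;> rw [h] <;> decide
  simp [adjSign, h, formSign_mul_self]

/-- Testing invariance of the form on pairs of basis vectors gives the entry relation, because each
basis vector pairs with exactly one other. The sign `adjSign` does not mention `ς`, since `ς` is
determined by `i` and `j` wherever the entry can be nonzero. -/
theorem mem_ospPart_iff {ς : ZMod 2} {X : Gl m r} :
    X ∈ ospPart m r ς ↔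
      X ∈ glPart m r ς ∧ ∀ i j, X i j = -adjSign i j * X (dual j) (dual i) := by
  constructor
  · rintro ⟨h1, h2⟩
    refine ⟨h1, fun i j => ?_⟩
    by_cases hp : parity i = ς + parity j
    · have hx : (Pi.single j 1 : Idx m r → ℂ) ∈ vecPart m r (parity j) := by
        intro k hk
        exact Pi.single_eq_of_ne (fun h => hk (by rw [h])) _
      have h := h2 _ _ hx (Pi.single (dual i) 1)
      rw [form_eq_sum, form_eq_sum, Finset.sum_eq_single i, Finset.sum_eq_single j] at h
      · have hς : ς = parity i + parity j := by
          rw [hp, add_assoc]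
          rcases zmod_two_cases (parity j) with h | h <;> rw [h] <;>
            simp [zmod_two_one_add_one]
        simp only [Matrix.mulVec_single_one, Pi.single_eq_same, Matrix.col_apply, mul_one,
          one_mul] at h
        unfold adjSign
        rw [← hς]
        linear_combination formSign i * h - X i j * formSign_mul_self i
      · intro b _ hb; simp [hb]
      · simp
      · intro b _ hb
        rw [Pi.single_eq_of_ne (fun h => hb (dual_injective h)), mul_zero, mul_zero]
      · simp
    · rw [h1 i j hp, h1, mul_zero]
      intro h
      apply hp
      simp only [parity_dual] at h
      rw [h, ← add_assoc]
      rcases zmod_two_cases ς with h | h <;> rw [h] <;> simp [zmod_two_one_add_one]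
  · rintro ⟨h1, h2⟩
    refine ⟨h1, fun τ x hx y => ?_⟩
    rw [form_eq_sum, form_eq_sum]
    simp only [Matrix.mulVec, dotProduct, Finset.sum_mul, Finset.mul_sum]
    rw [Finset.sum_comm]
    refine Finset.sum_congr rfl fun j _ => ?_
    -- Reindexing by `dual` aligns the two double sums term by term.
    refine Fintype.sum_equiv (Function.Involutive.toPerm dual dual_dual) _ _ fun i => ?_
    obtain ⟨i, rfl⟩ : ∃ k, i = dual k := ⟨dual i, by simp⟩
    rw [dual_dual, show Function.Involutive.toPerm dual dual_dual (dual i) = i from dual_dual i]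
    by_cases hj : parity j = τ
    · by_cases hp : parity i = ς + parity j
      · rw [h2 (dual i) j, dual_dual]
        have hς : ς = parity i + parity j := by
          rw [hp, add_assoc]
          rcases zmod_two_cases (parity j) with h | h <;> rw [h] <;>
            simp [zmod_two_one_add_one]
        unfold adjSign
        rw [← hj, hς, parity_dual]
        linear_combination (-ksign (parity i + parity j) (parity j) * formSign j * X (dual j) i *
          x j * y i) * formSign_mul_self (dual i)
      · have e1 : X (dual i) j = 0 := h1 _ _ (by simpa using hp)
        have e2 : X (dual j) i = 0 := by
          have := h2 (dual j) i
          rw [dual_dual, e1, mul_zero] at this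
          exact this
        simp [e1, e2]
    · simp [hx j hj]

/-- The entry relation is the same for both parities, and it couples only entries of equal parity,
so it passes to and from homogeneous components. -/
theorem mem_osp_iff {X : Gl m r} :
    X ∈ (osp m r).carrier ↔ ∀ i j, X i j = -adjSign i j * X (dual j) (dual i) := by
  constructor
  · intro h
    obtain ⟨x0, h0, x1, h1, rfl⟩ := Submodule.mem_sup.1 h
    intro i j
    have e0 := (mem_ospPart_iff.1 h0).2 i j
    have e1 := (mem_ospPart_iff.1 h1).2 i j
    rw [Matrix.add_apply, Matrix.add_apply, e0, e1]
    ring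
  · intro h
    have key : ∀ ς, comp ς X ∈ ospPart m r ς := fun ς => by
      refine mem_ospPart_iff.2 ⟨comp_mem_glPart ς X, fun i j => ?_⟩
      have : parity j = ς + parity i ↔ parity i = ς + parity j := by
        revert ς; generalize parity i = a; generalize parity j = b; revert a b; decide
      simp only [comp, LinearMap.coe_mk, AddHom.coe_mk, Matrix.of_apply, parity_dual, this]
      split_ifs
      · exact h i j
      · simp
    rw [← comp_zero_add_comp_one X]
    exact add_mem (Submodule.mem_sup_left (key 0)) (Submodule.mem_sup_right (key 1))

/-! ### Root vectors -/

/-- The skew part of a matrix unit; these elements span `osp(n|2)`. -/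
def rootVec (i j : Idx m r) : Gl m r :=
  Matrix.single i j 1 - adjSign i j • Matrix.single (dual j) (dual i) 1

theorem rootVec_apply (i j k l : Idx m r) :
    rootVec i j k l =
      (if i = k ∧ j = l then 1 else 0) - adjSign i j * (if dual j = k ∧ dual i = l then 1 else 0) := by
  simp [rootVec, Matrix.single_apply]

theorem rootVec_mem_osp (i j : Idx m r) : rootVec i j ∈ (osp m r).carrier := by
  rw [mem_osp_iff]
  intro k l
  rw [rootVec_apply, rootVec_apply]
  have e1 : (dual j = k ∧ dual i = l) ↔ (i = dual l ∧ j = dual k) := by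
    rw [dual_eq_comm, dual_eq_comm, and_comm]
  have e2 : (dual j = dual l ∧ dual i = dual k) ↔ (i = k ∧ j = l) := by
    rw [dual_injective.eq_iff, dual_injective.eq_iff, and_comm]
  rw [if_congr e1 rfl rfl, if_congr e2 rfl rfl]
  by_cases h1 : i = k ∧ j = l
  · obtain ⟨rfl, rfl⟩ := h1
    by_cases h2 : i = dual j ∧ j = dual i
    · rw [if_pos h2]; simp only [and_self, if_true]; linear_combination - adjSign_mul_self i j
    · rw [if_neg h2]; simp only [and_self, if_true]; linear_combination - adjSign_mul_self i j
  · rw [if_neg h1]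
    by_cases h2 : i = dual l ∧ j = dual k
    · obtain ⟨rfl, rfl⟩ := h2
      simp
    · rw [if_neg h2]; simp

theorem rootVec_mem_glPart (i j : Idx m r) :
    rootVec i j ∈ glPart m r (parity i + parity j) := by
  have key : ∀ a b : ZMod 2, a = a + b + b ∧ b = a + b + a := by decide
  intro k l hkl
  rw [rootVec_apply, if_neg, if_neg]
  · simp
  · rintro ⟨rfl, rfl⟩
    exact hkl (by simpa using (key _ _).2)
  · rintro ⟨rfl, rfl⟩
    exact hkl (key _ _).1

/-- The form is symmetric on the even part, so this matrix unit is its own adjoint and its skew part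
vanishes. This is why `2ε_i` is not a root. -/
theorem rootVec_eq_zero {i : EvenIdx m r} :
    rootVec (Sum.inl i : Idx m r) (Sum.inl (evenDual i)) = 0 := by
  ext k l
  rw [rootVec_apply]
  simp

/-- `X` is its own skew part. The factor `1/2` appears because `(i, j)` and `(dual j, dual i)` give
proportional root vectors. -/
theorem osp_eq_sum_rootVec {X : Gl m r} (hX : X ∈ (osp m r).carrier) :
    X = ∑ i, ∑ j, (X i j / 2) • rootVec i j := by
  have h := mem_osp_iff.1 hX
  ext k l
  simp only [Matrix.sum_apply, Matrix.smul_apply, rootVec_apply, smul_eq_mul, mul_sub,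
    Finset.sum_sub_distrib]
  have e1 : ∑ i, ∑ j, X i j / 2 * (if i = k ∧ j = l then (1 : ℂ) else 0) = X k l / 2 := by
    rw [Finset.sum_eq_single k, Finset.sum_eq_single l]
    · simp
    · intro b _ hb; simp [hb]
    · simp
    · intro b _ hb; simp [hb]
    · simp
  have e2 : ∑ i, ∑ j, X i j / 2 * (adjSign i j * (if dual j = k ∧ dual i = l then (1 : ℂ) else 0))
      = - (X k l / 2) := by
    rw [Finset.sum_eq_single (dual l), Finset.sum_eq_single (dual k)]
    · rw [h k l, ← adjSign_dual k l]; simp; ring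
    · intro b _ hb
      rw [if_neg]; · simp
      rintro ⟨rfl, -⟩; simp at hb
    · simp
    · intro b _ hb
      refine Finset.sum_eq_zero fun j _ => ?_
      rw [if_neg]; · simp
      rintro ⟨-, rfl⟩; simp at hb
    · simp
  rw [e1, e2]; ring

theorem diag_mem_glPart {X : Gl m r} (hX : X.IsDiag) : X ∈ glPart m r 0 := fun i j hij =>
  hX (fun h => hij (by rw [h, zero_add]))

theorem superBracket_diag_apply {X : Gl m r} (hX : X.IsDiag) (Y : Gl m r) (i j : Idx m r) :
    superBracket X Y i j = (X i i - X j j) * Y i j := by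
  rw [superBracket_even_left (diag_mem_glPart hX), Matrix.sub_apply, Matrix.mul_apply,
    Matrix.mul_apply, Finset.sum_eq_single i, Finset.sum_eq_single j]
  · ring
  · intro b _ hb; rw [hX hb, mul_zero]
  · simp
  · intro b _ hb; rw [hX hb.symm, zero_mul]
  · simp

theorem cartan_apply_dual (H : cartan m r) (i : Idx m r) :
    H.1 (dual i) (dual i) = - H.1 i i := by
  have := mem_osp_iff.1 H.2.1 i i
  rw [adjSign_self] at this
  rw [this]; ring

@[simp] theorem entry_dual (i : Idx m r) : entry (dual i) = - (entry i : Weight m r) := by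
  ext H
  exact cartan_apply_dual H i

theorem superBracket_cartan_rootVec (H : cartan m r) (i j : Idx m r) :
    superBracket H.1 (rootVec i j) = (H.1 i i - H.1 j j) • rootVec i j := by
  ext k l
  rw [superBracket_diag_apply H.2.2, Matrix.smul_apply, smul_eq_mul, rootVec_apply]
  by_cases h1 : i = k ∧ j = l
  · obtain ⟨rfl, rfl⟩ := h1; rfl
  · rw [if_neg h1]
    by_cases h2 : dual j = k ∧ dual i = l
    · obtain ⟨rfl, rfl⟩ := h2
      simp only [cartan_apply_dual]
      ring
    · rw [if_neg h2]; simp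

theorem rootVec_mem_rootSpace (i j : Idx m r) :
    rootVec i j ∈ rootSpace (entry i - entry j : Weight m r) :=
  ⟨rootVec_mem_osp i j, fun H => superBracket_cartan_rootVec H i j⟩

theorem rootVec_self_isDiag (i : Idx m r) : (rootVec i i).IsDiag := by
  intro k l hkl
  rw [rootVec_apply, if_neg, if_neg]
  · simp
  · rintro ⟨rfl, h⟩; exact hkl h
  · rintro ⟨rfl, h⟩; exact hkl h

theorem rootVec_self_mem_cartan (i : Idx m r) : rootVec i i ∈ cartan m r :=
  ⟨rootVec_mem_osp i i, rootVec_self_isDiag i⟩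

/-- A diagonal matrix with antisymmetric entries is in the Cartan subalgebra. -/
theorem diagonal_mem_cartan {d : Idx m r → ℂ} (hd : ∀ i, d (dual i) = - d i) :
    Matrix.diagonal d ∈ cartan m r := by
  refine ⟨mem_osp_iff.2 fun i j => ?_, Matrix.isDiag_diagonal d⟩
  by_cases h : i = j
  · subst h; simp [hd]
  · rw [Matrix.diagonal_apply_ne _ h, Matrix.diagonal_apply_ne _ (fun e => h (dual_injective e).symm)]
    simp

/-- The `δ`-coefficient of the weight of a basis vector. -/
def deltaDeg : Idx m r → ℤ := Sum.elim (fun _ => 0) ![1, -1]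

@[simp] theorem deltaDeg_inl (w : EvenIdx m r) : deltaDeg (Sum.inl w : Idx m r) = 0 := rfl

@[simp] theorem deltaDeg_inr_zero : deltaDeg (Sum.inr 0 : Idx m r) = 1 := rfl

@[simp] theorem deltaDeg_inr_one : deltaDeg (Sum.inr 1 : Idx m r) = -1 := rfl

@[simp] theorem deltaDeg_dual (i : Idx m r) : deltaDeg (dual i) = - deltaDeg i := by
  rcases i with i | i
  · simp
  · fin_cases i <;> simp

theorem gradingElement_apply (i : Idx m r) : gradingElement m r i i = deltaDeg i := by
  rcases i with i | i
  · simp [gradingElement]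
  · fin_cases i <;> simp [gradingElement]

theorem gradingElement_mem_cartan : gradingElement m r ∈ cartan m r := by
  refine diagonal_mem_cartan fun i => ?_
  rcases i with i | i
  · simp
  · fin_cases i <;> simp

theorem mem_gradedPiece_iff {k : ℤ} {X : Gl m r} :
    X ∈ gradedPiece m r k ↔
      X ∈ (osp m r).carrier ∧ ∀ i j, deltaDeg i - deltaDeg j ≠ k → X i j = 0 := by
  refine and_congr_right fun _ => ⟨fun h i j hij => ?_, fun h => ?_⟩
  · have := congrFun (congrFun h i) j
    rw [superBracket_diag_apply gradingElement_mem_cartan.2, Matrix.smul_apply, smul_eq_mul,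
      gradingElement_apply, gradingElement_apply] at this
    by_contra hne
    apply hij
    exact_mod_cast mul_right_cancel₀ hne this
  · ext i j
    rw [superBracket_diag_apply gradingElement_mem_cartan.2, Matrix.smul_apply, smul_eq_mul,
      gradingElement_apply, gradingElement_apply]
    by_cases hij : deltaDeg i - deltaDeg j = k
    · rw [← hij]; push_cast; rfl
    · rw [h i j hij]; simp

theorem rootVec_mem_gradedPiece (i j : Idx m r) :
    rootVec i j ∈ gradedPiece m r (deltaDeg i - deltaDeg j) := by
  refine mem_gradedPiece_iff.2 ⟨rootVec_mem_osp i j, fun k l hkl => ?_⟩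
  rw [rootVec_apply, if_neg, if_neg]
  · simp
  · rintro ⟨rfl, rfl⟩; apply hkl; simp; ring
  · rintro ⟨rfl, rfl⟩; exact hkl rfl

theorem mem_levi_iff {X : Gl m r} :
    X ∈ (levi m r).carrier ↔
      X ∈ (osp m r).carrier ∧ ∀ i j, deltaDeg i ≠ deltaDeg j → X i j = 0 := by
  refine mem_gradedPiece_iff.trans (and_congr_right fun _ => ?_)
  simp [sub_eq_zero]

theorem rootVec_mem_levi {i j : Idx m r} (h : deltaDeg i = deltaDeg j) :
    rootVec i j ∈ (levi m r).carrier := by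
  have := rootVec_mem_gradedPiece i j
  rwa [h, sub_self] at this

theorem levi_le_osp : (levi m r).carrier ≤ (osp m r).carrier := fun _ h => h.1

theorem cartan_mem_levi (H : cartan m r) : H.1 ∈ (levi m r).carrier :=
  mem_levi_iff.2 ⟨H.2.1, fun _ _ h => H.2.2 (fun e => h (by rw [e]))⟩

/-! ### The positive system -/

/-- A function on the indices that is positive on the positive roots. -/
def height : Idx m r → ℤ
  | Sum.inl (Sum.inl (Sum.inl k)) => (m : ℤ) - k
  | Sum.inl (Sum.inl (Sum.inr k)) => (k : ℤ) - m
  | Sum.inl (Sum.inr _) => 0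
  | Sum.inr k => ![(m : ℤ) + 1, - (m : ℤ) - 1] k

theorem height_dual (i : Idx m r) : height (dual i) = - height i := by
  rcases i with ((i | i) | i) | i
  · simp [height, evenDual]
  · simp [height, evenDual]
  · simp [height, evenDual]
  · fin_cases i <;> simp [height] <;> ring

/-- A Cartan element on which the positive roots take positive integral values. -/
def heightElement (m r : ℕ) : cartan m r :=
  ⟨Matrix.diagonal fun i => (height i : ℂ), diagonal_mem_cartan fun i => by
    rw [height_dual]; simp⟩

theorem heightElement_apply (i : Idx m r) : (heightElement m r).1 i i = height i := by
  simp [heightElement]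

/-- Regularity of the height element: a root vector of height zero must be diagonal. All middle
indices have height `0`, so there may be at most one of them. -/
theorem height_injective (hr : r ≤ 1) : Function.Injective (height : Idx m r → ℤ) := by
  intro i j h
  rcases i with ((i | i) | i) | i <;> rcases j with ((j | j) | j) | j
  all_goals try fin_cases i
  all_goals try fin_cases j
  all_goals simp [height] at h ⊢
  all_goals omega

theorem entry_pos (k : Fin m) :
    entry (Sum.inl (Sum.inl (Sum.inl k))) = (ε k : Weight m r) := rfl

theorem entry_neg (k : Fin m) :
    entry (Sum.inl (Sum.inl (Sum.inr k))) = (-ε k : Weight m r) :=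
  entry_dual (Sum.inl (Sum.inl (Sum.inl k)))

theorem entry_mid (k : Fin r) : entry (Sum.inl (Sum.inr k)) = (0 : Weight m r) := by
  have h := entry_dual (m := m) (Sum.inl (Sum.inr k))
  ext H
  have := LinearMap.congr_fun h H
  rw [LinearMap.neg_apply] at this
  change entry (Sum.inl (Sum.inr k)) H = _ at this
  rw [LinearMap.zero_apply]
  linear_combination this / 2

theorem entry_delta : entry (Sum.inr 0) = (δ : Weight m r) := rfl

theorem entry_neg_delta : entry (Sum.inr 1) = (-δ : Weight m r) := entry_dual (Sum.inr 0)

/-- A check over all pairs of indices that the height ordering induces the distinguished positive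
system. The vanishing alternative is only used for `i` paired with its dual, where the weight would
be `2ε_i`. -/
theorem rootVec_eq_zero_or_pos (hr : r ≤ 1) (i j : Idx m r) (h : height j < height i) :
    rootVec i j = 0 ∨ (entry i - entry j : Weight m r) ∈ evenPosRoots m r ∪ oddPosRoots m r := by
  rcases i with ((i | i) | i) | i <;> rcases j with ((j | j) | j) | j
  all_goals try (fin_cases i)
  all_goals try (fin_cases j)
  all_goals simp [height] at h
  all_goals simp only [entry_pos, entry_neg, entry_mid, entry_delta, entry_neg_delta,
    Fin.zero_eta, Fin.mk_one, sub_neg_eq_add, zero_sub, sub_zero, zero_add]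
  · exact Or.inr (Or.inl (Or.inl (Or.inl ⟨i, j, by omega, Or.inr rfl⟩)))
  · rcases lt_trichotomy i j with hij | rfl | hij
    · exact Or.inr (Or.inl (Or.inl (Or.inl ⟨i, j, hij, Or.inl rfl⟩)))
    · exact Or.inl rootVec_eq_zero
    · exact Or.inr (Or.inl (Or.inl (Or.inl ⟨j, i, hij, Or.inl (add_comm _ _)⟩)))
  · have hr1 : r = 1 := by have := j.2; omega
    exact Or.inr (Or.inl (Or.inr ⟨hr1, i, rfl⟩))
  · omega
  · exact Or.inr (Or.inr (Or.inl ⟨i, Or.inl (add_comm _ _)⟩))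
  · omega
  · exact Or.inr (Or.inl (Or.inl (Or.inl ⟨j, i, by omega, Or.inr (by abel)⟩)))
  · omega
  · omega
  · exact Or.inr (Or.inr (Or.inl ⟨i, Or.inr (by abel)⟩))
  · omega
  · have hr1 : r = 1 := by have := i.2; omega
    exact Or.inr (Or.inl (Or.inr ⟨hr1, j, rfl⟩))
  · omega
  · have hr1 : r = 1 := by have := i.2; omega
    exact Or.inr (Or.inr (Or.inr ⟨hr1, rfl⟩))
  · exact Or.inr (Or.inr (Or.inl ⟨j, Or.inr rfl⟩))
  · omega
  · exact Or.inr (Or.inr (Or.inl ⟨j, Or.inl rfl⟩))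
  · omega
  · have hr1 : r = 1 := by have := j.2; omega
    exact Or.inr (Or.inr (Or.inr ⟨hr1, rfl⟩))
  · omega
  · exact Or.inr (Or.inl (Or.inl (Or.inr (two_smul ℂ _).symm)))
  · omega

/-- The grading element as an element of the Cartan subalgebra. -/
def gradingCartan (m r : ℕ) : cartan m r := ⟨gradingElement m r, gradingElement_mem_cartan⟩

theorem entry_gradingCartan (i : Idx m r) : entry i (gradingCartan m r) = deltaDeg i :=
  gradingElement_apply i

@[simp] theorem ε_gradingCartan (i : Fin m) : (ε i : Weight m r) (gradingCartan m r) = 0 := by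
  rw [← entry_pos, entry_gradingCartan]; simp

@[simp] theorem δ_gradingCartan : (δ : Weight m r) (gradingCartan m r) = 1 := by
  rw [← entry_delta, entry_gradingCartan]; simp

theorem mem_levi_roots_of_pos {α : Weight m r} (h : α ∈ evenPosRoots m r ∪ oddPosRoots m r)
    (h0 : α (gradingCartan m r) = 0) : α ∈ evenPosRoots m r \ {(2 : ℂ) • δ} := by
  have h2 : α ≠ (2 : ℂ) • δ := by rintro rfl; simp at h0
  refine ⟨?_, h2⟩
  rcases h with h | ⟨i, rfl | rfl⟩ | ⟨-, rfl⟩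
  · exact h
  all_goals simp at h0

end Osp

end

/-! ### Enveloping algebras, recognition of irreducible quotients, and the trivial module -/

noncomputable section

namespace Osp

variable {m r : ℕ}

set_option linter.unusedSectionVars false

/-! ### Enveloping algebras -/

section Env

variable {𝔞 : SubSuperalgebra m r}

theorem env_mul_env {a b : ZMod 2} (x y : 𝔞.carrier) (hx : x.1 ∈ glPart m r a)
    (hy : y.1 ∈ glPart m r b) :
    env 𝔞 x * env 𝔞 y = ksign a b • (env 𝔞 y * env 𝔞 x) +
      env 𝔞 ⟨superBracket x.1 y.1, 𝔞.bracket_mem x.1 y.1 x.2 y.2⟩ := by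
  have h := RingQuot.mkAlgHom_rel ℂ (EnvRel.mk (𝔞 := 𝔞) a b x y hx hy)
  rw [map_sub, map_smul, map_mul, map_mul] at h
  exact sub_eq_iff_eq_add'.1 h

/-- A linear map respecting the superbracket extends to the enveloping algebra. -/
def Env.lift {A : Type*} [Ring A] [Algebra ℂ A] (f : 𝔞.carrier →ₗ[ℂ] A)
    (hf : ∀ (a b : ZMod 2) (x y : 𝔞.carrier), x.1 ∈ glPart m r a → y.1 ∈ glPart m r b →
      f x * f y - ksign a b • (f y * f x) =
        f ⟨superBracket x.1 y.1, 𝔞.bracket_mem x.1 y.1 x.2 y.2⟩) : Env 𝔞 →ₐ[ℂ] A :=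
  RingQuot.liftAlgHom ℂ (s := EnvRel 𝔞) ⟨TensorAlgebra.lift ℂ f, by
    rintro _ _ ⟨a, b, x, y, hx, hy⟩
    simpa using hf a b x y hx hy⟩

@[simp] theorem Env.lift_env {A : Type*} [Ring A] [Algebra ℂ A] (f : 𝔞.carrier →ₗ[ℂ] A) (hf)
    (x : 𝔞.carrier) : Env.lift f hf (env 𝔞 x) = f x := by
  have := RingQuot.liftAlgHom_mkAlgHom_apply (S := ℂ) (s := EnvRel 𝔞) (TensorAlgebra.lift ℂ f) (by
    rintro _ _ ⟨a, b, x, y, hx, hy⟩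
    simpa using hf a b x y hx hy) (TensorAlgebra.ι ℂ x)
  rw [TensorAlgebra.lift_ι_apply] at this
  exact this

theorem Env.induction {C : Env 𝔞 → Prop} (u : Env 𝔞)
    (algebraMap : ∀ c : ℂ, C (algebraMap ℂ (Env 𝔞) c)) (env : ∀ x, C (env 𝔞 x))
    (mul : ∀ u v, C u → C v → C (u * v)) (add : ∀ u v, C u → C v → C (u + v)) : C u := by
  obtain ⟨t, rfl⟩ := RingQuot.mkAlgHom_surjective ℂ (EnvRel 𝔞) u
  induction t using TensorAlgebra.induction with
  | algebraMap c => rw [AlgHom.commutes]; exact algebraMap c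
  | ι x => exact env x
  | mul a b ha hb => rw [map_mul]; exact mul _ _ ha hb
  | add a b ha hb => rw [map_add]; exact add _ _ ha hb

variable {Q : Type*} [AddCommGroup Q] [Module ℂ Q] [Module (Env 𝔞) Q] [IsScalarTower ℂ (Env 𝔞) Q]

theorem smul_mem_of_env_smul_mem {T : Submodule ℂ Q} (h : ∀ x, ∀ t ∈ T, env 𝔞 x • t ∈ T)
    (u : Env 𝔞) : ∀ t ∈ T, u • t ∈ T := by
  induction u using Env.induction with
  | algebraMap c => intro t ht; rw [algebraMap_smul]; exact T.smul_mem c ht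
  | env x => exact h x
  | mul u v hu hv => intro t ht; rw [mul_smul]; exact hu _ (hv _ ht)
  | add u v hu hv => intro t ht; rw [add_smul]; exact T.add_mem (hu _ ht) (hv _ ht)

theorem Env.smul_comm_complex (u : Env 𝔞) (c : ℂ) (q : Q) : u • (c • q) = c • (u • q) := by
  rw [← algebraMap_smul (Env 𝔞) c q, ← mul_smul, ← Algebra.commutes, mul_smul, algebraMap_smul]

/-- The action of an element of the enveloping algebra as a linear map. -/
def act (Q : Type*) [AddCommGroup Q] [Module ℂ Q] [Module (Env 𝔞) Q] [IsScalarTower ℂ (Env 𝔞) Q]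
    (u : Env 𝔞) : Q →ₗ[ℂ] Q where
  toFun q := u • q
  map_add' := smul_add u
  map_smul' c q := Env.smul_comm_complex u c q

@[simp] theorem act_apply (u : Env 𝔞) (q : Q) : act Q u q = u • q := rfl

/-- The smallest subspace that contains `V₀` and is stable under the elements of `S`. -/
def genBy (S : Set 𝔞.carrier) (V₀ : Submodule ℂ Q) : Submodule ℂ Q :=
  sInf {T | V₀ ≤ T ∧ ∀ y ∈ S, ∀ t ∈ T, env 𝔞 y • t ∈ T}

theorem genBy_le {S : Set 𝔞.carrier} {V₀ T : Submodule ℂ Q} (h : V₀ ≤ T)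
    (hT : ∀ y ∈ S, ∀ t ∈ T, env 𝔞 y • t ∈ T) : genBy S V₀ ≤ T := sInf_le ⟨h, hT⟩

theorem le_genBy (S : Set 𝔞.carrier) (V₀ : Submodule ℂ Q) : V₀ ≤ genBy S V₀ :=
  le_sInf fun _ h => h.1

theorem env_smul_mem_genBy {S : Set 𝔞.carrier} {V₀ : Submodule ℂ Q} {y : 𝔞.carrier} (hy : y ∈ S)
    {t : Q} (ht : t ∈ genBy S V₀) : env 𝔞 y • t ∈ genBy S V₀ := by
  rw [genBy, Submodule.mem_sInf] at ht ⊢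
  exact fun T hT => hT.2 y hy t (ht T hT)

theorem env_smul_mem_of_homogeneous {T : Submodule ℂ Q} {t : Q}
    (h : ∀ (a : ZMod 2) (x : 𝔞.carrier), x.1 ∈ glPart m r a → env 𝔞 x • t ∈ T) (x : 𝔞.carrier) :
    env 𝔞 x • t ∈ T := by
  have hx : x = ⟨comp 0 x.1, 𝔞.comp_mem 0 x.1 x.2⟩ + ⟨comp 1 x.1, 𝔞.comp_mem 1 x.1 x.2⟩ :=
    Subtype.ext (comp_zero_add_comp_one x.1).symm
  rw [hx, map_add, add_smul]
  exact T.add_mem (h 0 _ (comp_mem_glPart 0 _)) (h 1 _ (comp_mem_glPart 1 _))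

/-- If `𝔞 V₀` is contained in the subspace generated from `V₀` by a set of homogeneous elements
of `𝔞`, then this subspace is a submodule. -/
theorem env_smul_mem_genBy_of_forall {S : Set 𝔞.carrier} (hS : ∀ y ∈ S, ∃ b, y.1 ∈ glPart m r b)
    {V₀ : Submodule ℂ Q} (hV : ∀ x, ∀ v ∈ V₀, env 𝔞 x • v ∈ genBy S V₀) (x : 𝔞.carrier) {t : Q}
    (ht : t ∈ genBy S V₀) : env 𝔞 x • t ∈ genBy S V₀ := by
  -- All `x` are treated at once: in `x y t = ± y x t + [x, y] t` the last term needs the hypothesis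
  -- on `t` for the new element `[x, y]`.
  let T : Submodule ℂ Q := ⨅ x : 𝔞.carrier, (genBy S V₀).comap (act Q (env 𝔞 x))
  have hT : ∀ t, t ∈ T ↔ ∀ x, env 𝔞 x • t ∈ genBy S V₀ := fun t => by
    simp [T, Submodule.mem_iInf]
  suffices h : genBy S V₀ ≤ genBy S V₀ ⊓ T from (hT t).1 (h ht).2 x
  refine genBy_le (le_inf (le_genBy S V₀) fun v hv => (hT v).2 fun x => hV x v hv) ?_
  rintro y hy t ⟨ht, ht'⟩
  refine ⟨env_smul_mem_genBy hy ht, (hT _).2 ?_⟩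
  obtain ⟨b, hb⟩ := hS y hy
  refine env_smul_mem_of_homogeneous fun a x hx => ?_
  rw [← mul_smul, env_mul_env x y hx hb, add_smul, smul_assoc, mul_smul]
  exact add_mem (Submodule.smul_mem _ _ (env_smul_mem_genBy hy ((hT t).1 ht' x))) ((hT t).1 ht' _)

theorem genBy_eq_top {S : Set 𝔞.carrier} (hS : ∀ y ∈ S, ∃ b, y.1 ∈ glPart m r b)
    {V₀ : Submodule ℂ Q} (hV : ∀ x, ∀ v ∈ V₀, env 𝔞 x • v ∈ genBy S V₀)
    (hgen : Submodule.span (Env 𝔞) (V₀ : Set Q) = ⊤) : genBy S V₀ = ⊤ := by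
  let T : Submodule (Env 𝔞) Q :=
    { (genBy S V₀) with
      smul_mem' := fun u t ht => smul_mem_of_env_smul_mem
        (fun x t ht => env_smul_mem_genBy_of_forall hS hV x ht) u t ht }
  have hT : T = ⊤ := by
    rw [← top_le_iff, ← hgen, Submodule.span_le]
    exact le_genBy S V₀
  ext t
  have : t ∈ T := by rw [hT]; trivial
  exact ⟨fun _ => trivial, fun _ => this⟩

end Env

/-! ### Highest weight modules -/

section HighestWeight

variable {𝔞 : SubSuperalgebra m r} {P : Set (Weight m r)} {lam : Weight m r}

theorem eigenspace_map {Q R : Type*} [AddCommGroup Q] [Module ℂ Q] [Module (Env 𝔞) Q]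
    [IsScalarTower ℂ (Env 𝔞) Q] [AddCommGroup R] [Module ℂ R] [Module (Env 𝔞) R]
    [IsScalarTower ℂ (Env 𝔞) R] (u : Env 𝔞) (c : ℂ) (f : Q →ₗ[ℂ] R)
    (hf : ∀ q, f (u • q) = u • f q) :
    (Module.End.eigenspace (act Q u) c) ≤ (Module.End.eigenspace (act R u) c).comap f := by
  intro q hq
  rw [Submodule.mem_comap, Module.End.mem_eigenspace_iff, act_apply, ← hf]
  rw [Module.End.mem_eigenspace_iff, act_apply] at hq
  rw [hq, map_smul]

/-- A set of elements of `𝔞`, spanning it, of the three kinds used in the study of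
highest weight modules. -/
def triangularSet (𝔞 : SubSuperalgebra m r) (P : Set (Weight m r)) (ρ : cartan m r) :
    Set 𝔞.carrier :=
  {y | (∃ α ∈ P, y.1 ∈ rootSpace α) ∨ y.1 ∈ cartan m r ∨
    ((∃ b, y.1 ∈ glPart m r b) ∧ ∃ k : ℕ, 0 < k ∧ superBracket ρ.1 y.1 = -(k : ℂ) • y.1)}

/-- The highest weight vector has `ρ`-eigenvalue `lam ρ`, and the lowering elements generate the
Verma module from it, each subtracting a positive integer. So everything outside the line of that
vector lies in other eigenspaces. No Poincaré–Birkhoff–Witt theorem is used, and the coefficient `a`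
is not claimed to be unique. -/
theorem exists_smul_add_mem_eigenspaces (ρ : 𝔞.carrier) (hρ : ρ.1 ∈ cartan m r)
    (hdec : Submodule.span ℂ (triangularSet 𝔞 P ⟨ρ.1, hρ⟩) = ⊤) :
    ∀ q : Env 𝔞 ⧸ vermaIdeal 𝔞 P lam, ∃ (a : ℂ) (d : Env 𝔞 ⧸ vermaIdeal 𝔞 P lam),
      d ∈ (⨆ c : ℂ, ⨆ (_ : c ≠ lam ⟨ρ.1, hρ⟩), Module.End.eigenspace (act _ (env 𝔞 ρ)) c) ∧
      q = a • Submodule.Quotient.mk 1 + d := by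
  set I := vermaIdeal 𝔞 P lam
  set v : Env 𝔞 ⧸ I := Submodule.Quotient.mk 1
  set c₀ := lam ⟨ρ.1, hρ⟩
  have hmk : ∀ u : Env 𝔞, u • v = Submodule.Quotient.mk u := fun u => by
    change Submodule.Quotient.mk (u • (1 : Env 𝔞)) = _
    rw [smul_eq_mul, mul_one]
  have hpos : ∀ x : 𝔞.carrier, (∃ α ∈ P, x.1 ∈ rootSpace α) → env 𝔞 x • v = 0 := fun x hx => by
    rw [hmk, Submodule.Quotient.mk_eq_zero]
    exact Submodule.subset_span (Or.inl ⟨x, hx, rfl⟩)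
  have hcar : ∀ (x : 𝔞.carrier) (hx : x.1 ∈ cartan m r), env 𝔞 x • v = lam ⟨x.1, hx⟩ • v :=
    fun x hx => by
      rw [← sub_eq_zero, ← algebraMap_smul (Env 𝔞) (lam ⟨x.1, hx⟩) v, ← sub_smul, hmk,
        Submodule.Quotient.mk_eq_zero]
      exact Submodule.subset_span (Or.inr ⟨x, ⟨x.1, hx⟩, rfl, rfl⟩)
  let S : Set 𝔞.carrier := {y | (∃ b, y.1 ∈ glPart m r b) ∧
    ∃ k : ℕ, 0 < k ∧ superBracket ρ.1 y.1 = -(k : ℂ) • y.1}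
  let E : ℕ → Submodule ℂ (Env 𝔞 ⧸ I) := fun k =>
    Module.End.eigenspace (act _ (env 𝔞 ρ)) (c₀ - k)
  have hE : ∀ k t, t ∈ E k ↔ env 𝔞 ρ • t = (c₀ - k) • t := fun k t => by
    simp only [E]; rw [Module.End.mem_eigenspace_iff, act_apply]
  -- The drop is at least one, so even from level `0` the image avoids level `0`.
  have hSE : ∀ y ∈ S, ∀ k t, t ∈ E k → env 𝔞 y • t ∈ ⨆ j : ℕ, E (j + 1) := by
    rintro y ⟨⟨b, hb⟩, k', hk', hy⟩ k t ht
    obtain ⟨k', rfl⟩ := Nat.exists_eq_succ_of_ne_zero hk'.ne'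
    refine Submodule.mem_iSup_of_mem (k + k') ?_
    rw [hE] at ht ⊢
    have e : env 𝔞 ⟨superBracket ρ.1 y.1, 𝔞.bracket_mem ρ.1 y.1 ρ.2 y.2⟩ =
        (-((k' + 1 : ℕ) : ℂ)) • env 𝔞 y := by
      rw [← map_smul]; exact congrArg _ (Subtype.ext hy)
    rw [← mul_smul, env_mul_env ρ y (diag_mem_glPart hρ.2) hb, ksign_zero_left, one_smul, e,
      add_smul, mul_smul, ht, Env.smul_comm_complex, smul_assoc, ← add_smul]
    congr 1
    push_cast
    ring
  let D : Submodule ℂ (Env 𝔞 ⧸ I) := Submodule.span ℂ {v} ⊔ ⨆ j : ℕ, E (j + 1)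
  have hv0 : v ∈ E 0 := by
    rw [hE, hcar ρ hρ]; simp [c₀]
  have hD : genBy S (Submodule.span ℂ {v}) ≤ D := by
    refine genBy_le le_sup_left fun y hy t ht => ?_
    suffices h : D ≤ D.comap (act _ (env 𝔞 y)) from h ht
    refine sup_le ?_ (iSup_le fun j => ?_)
    · rw [Submodule.span_singleton_le_iff_mem]
      exact Submodule.mem_sup_right (hSE y hy 0 v hv0)
    · intro t ht
      exact Submodule.mem_sup_right (hSE y hy _ t ht)
  have htop : genBy S (Submodule.span ℂ {v}) = ⊤ := by
    refine genBy_eq_top (fun y hy => hy.1) ?_ ?_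
    · intro x t ht
      obtain ⟨a, rfl⟩ := Submodule.mem_span_singleton.1 ht
      rw [Env.smul_comm_complex]
      refine Submodule.smul_mem _ _ ?_
      have hx : x ∈ Submodule.span ℂ (triangularSet 𝔞 P ⟨ρ.1, hρ⟩) := by rw [hdec]; trivial
      induction hx using Submodule.span_induction with
      | mem x hx =>
        rcases hx with hx | hx | hx
        · rw [hpos x hx]; exact zero_mem _
        · rw [hcar x hx]
          exact Submodule.smul_mem _ _ (le_genBy _ _ (Submodule.mem_span_singleton_self v))
        · exact env_smul_mem_genBy hx (le_genBy _ _ (Submodule.mem_span_singleton_self v))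
      | zero => rw [map_zero, zero_smul]; exact zero_mem _
      | add x y _ _ hx hy => rw [map_add, add_smul]; exact add_mem hx hy
      | smul c x _ hx => rw [map_smul, smul_assoc]; exact Submodule.smul_mem _ _ hx
    · rw [← top_le_iff]
      rintro q -
      obtain ⟨u, rfl⟩ := Submodule.Quotient.mk_surjective _ q
      rw [← hmk]
      exact Submodule.smul_mem _ _ (Submodule.subset_span (Submodule.mem_span_singleton_self v))
  intro q
  have hq : q ∈ D := hD (by rw [htop]; trivial)
  obtain ⟨w, hw, d, hd, hwd⟩ := Submodule.mem_sup.1 hq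
  obtain ⟨a, rfl⟩ := Submodule.mem_span_singleton.1 hw
  refine ⟨a, d, ?_, hwd.symm⟩
  refine (iSup_le fun j => ?_ : (⨆ j : ℕ, E (j + 1)) ≤ _) hd
  refine le_iSup₂_of_le (c₀ - ((j + 1 : ℕ) : ℂ)) ?_ le_rfl
  intro h
  have : ((j + 1 : ℕ) : ℂ) = 0 := by linear_combination -h
  exact Nat.cast_ne_zero.2 (Nat.succ_ne_zero j) this

/-- A maximal left ideal containing the highest weight relations is the preimage of the maximal
submodule of the Verma module. -/
theorem maxIdeal_eq_of_isCoatom (ρ : 𝔞.carrier) (hρ : ρ.1 ∈ cartan m r)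
    (hdec : Submodule.span ℂ (triangularSet 𝔞 P ⟨ρ.1, hρ⟩) = ⊤)
    {I₀ : Submodule (Env 𝔞) (Env 𝔞)} (hI : vermaIdeal 𝔞 P lam ≤ I₀) (hI₀ : IsCoatom I₀) :
    maxIdeal 𝔞 P lam = I₀ := by
  refine le_antisymm (sSup_le ?_) (le_sSup ⟨hI, hI₀.1⟩)
  rintro I ⟨hVI, hItop⟩
  set c₀ := lam ⟨ρ.1, hρ⟩
  set E : Submodule ℂ (Env 𝔞 ⧸ vermaIdeal 𝔞 P lam) :=
    ⨆ c : ℂ, ⨆ (_ : c ≠ c₀), Module.End.eigenspace (act _ (env 𝔞 ρ)) c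
  have hone : ∀ J, vermaIdeal 𝔞 P lam ≤ J →
      (Submodule.Quotient.mk (1 : Env 𝔞) : Env 𝔞 ⧸ J) ∈
        Module.End.eigenspace (act (Env 𝔞 ⧸ J) (env 𝔞 ρ)) c₀ := fun J hJ => by
    rw [Module.End.mem_eigenspace_iff, act_apply, ← algebraMap_smul (Env 𝔞) c₀, ← sub_eq_zero,
      ← sub_smul, ← Submodule.Quotient.mk_smul, Submodule.Quotient.mk_eq_zero, smul_eq_mul, mul_one]
    exact hJ (Submodule.subset_span (Or.inr ⟨ρ, ⟨ρ.1, hρ⟩, rfl, rfl⟩))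
  have hzero : ∀ J : Submodule (Env 𝔞) (Env 𝔞), ∀ q : Env 𝔞 ⧸ J, q ∈ Module.End.eigenspace (act (Env 𝔞 ⧸ J) (env 𝔞 ρ)) c₀ →
      q ∈ (⨆ c : ℂ, ⨆ (_ : c ≠ c₀), Module.End.eigenspace (act (Env 𝔞 ⧸ J) (env 𝔞 ρ)) c) →
      q = 0 := fun J q h1 h2 =>
    Submodule.disjoint_def.1 (Module.End.eigenspaces_iSupIndep (act (Env 𝔞 ⧸ J) (env 𝔞 ρ)) c₀)
      q h1 h2
  -- No element of a proper `J` can involve the highest weight vector. Otherwise, modulo `J`, the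
  -- class of `1` would lie in its own eigenspace and in the sum of the others, hence vanish.
  have key : ∀ J, vermaIdeal 𝔞 P lam ≤ J → J ≠ ⊤ → ∀ u ∈ J,
      (Submodule.Quotient.mk u : Env 𝔞 ⧸ vermaIdeal 𝔞 P lam) ∈ E := by
    intro J hJ hJtop u hu
    obtain ⟨a, d, hd, hq⟩ := exists_smul_add_mem_eigenspaces (lam := lam) ρ hρ hdec
      (Submodule.Quotient.mk u)
    have ha : a = 0 := by
      by_contra ha
      apply hJtop
      let f : (Env 𝔞 ⧸ vermaIdeal 𝔞 P lam) →ₗ[Env 𝔞] Env 𝔞 ⧸ J := Submodule.factor hJ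
      have hf : f (Submodule.Quotient.mk u) = 0 := by
        change (Submodule.Quotient.mk u : Env 𝔞 ⧸ J) = 0
        rwa [Submodule.Quotient.mk_eq_zero]
      have hfd : f d ∈ (⨆ c : ℂ, ⨆ (_ : c ≠ c₀),
          Module.End.eigenspace (act (Env 𝔞 ⧸ J) (env 𝔞 ρ)) c) := by
        suffices h : E ≤ (⨆ c : ℂ, ⨆ (_ : c ≠ c₀), Module.End.eigenspace
            (act (Env 𝔞 ⧸ J) (env 𝔞 ρ)) c).comap (f.restrictScalars ℂ) from h hd
        refine iSup₂_le fun c hc => (eigenspace_map (env 𝔞 ρ) c (f.restrictScalars ℂ)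
          fun q => map_smul f _ q).trans (Submodule.comap_mono (le_iSup₂_of_le c hc le_rfl))
      have hf1 : f (a • Submodule.Quotient.mk 1) = a • Submodule.Quotient.mk 1 := by
        rw [← algebraMap_smul (Env 𝔞) a, map_smul, algebraMap_smul]; rfl
      rw [hq, map_add, hf1] at hf
      have h0 := hzero J (a • Submodule.Quotient.mk 1) (Submodule.smul_mem _ _ (hone J hJ)) (by
        rw [add_eq_zero_iff_eq_neg.1 hf]; exact neg_mem hfd)
      rw [smul_eq_zero_iff_right ha, Submodule.Quotient.mk_eq_zero] at h0
      exact (Ideal.eq_top_iff_one J).2 h0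
    rw [hq, ha, zero_smul, zero_add]
    exact hd
  by_contra hle
  -- If `I` were not inside `I₀`, then `1` would be a sum of elements of `I` and `I₀`. Both have no
  -- component in the top eigenspace, so `1` would already lie in the Verma ideal.
  have hsup : I ⊔ I₀ = ⊤ := hI₀.2 _ (by
    rw [right_lt_sup]; exact hle)
  obtain ⟨a, ha, b, hb, hab⟩ := Submodule.mem_sup.1 (hsup ▸ Submodule.mem_top : (1 : Env 𝔞) ∈ I ⊔ I₀)
  have h1 := hzero (vermaIdeal 𝔞 P lam) (Submodule.Quotient.mk 1) (hone _ le_rfl) (by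
    rw [← hab, Submodule.Quotient.mk_add]
    exact add_mem (key I hVI hItop a ha) (key I₀ hI hI₀.1 b hb))
  rw [Submodule.Quotient.mk_eq_zero] at h1
  exact hI₀.1 ((Ideal.eq_top_iff_one I₀).2 (hI h1))

end HighestWeight

/-! ### The triangular decompositions of `osp(n|2)` and of its Levi subalgebra -/

theorem superBracket_heightElement_rootVec (i j : Idx m r) :
    superBracket (heightElement m r).1 (rootVec i j) =
      ((height i - height j : ℤ) : ℂ) • rootVec i j := by
  rw [superBracket_cartan_rootVec, heightElement_apply, heightElement_apply]
  push_cast; rfl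

/-- The sign of the height difference decides between lowering, Cartan and raising vectors; equal
heights force `i = j`. -/
theorem rootVec_cases (hr : r ≤ 1) (i j : Idx m r) :
    rootVec i j = 0 ∨
      (rootVec i j ∈ rootSpace (entry i - entry j : Weight m r) ∧
        (entry i - entry j : Weight m r) ∈ evenPosRoots m r ∪ oddPosRoots m r) ∨
      rootVec i j ∈ cartan m r ∨
      ∃ k : ℕ, 0 < k ∧ superBracket (heightElement m r).1 (rootVec i j) = -(k : ℂ) • rootVec i j := by
  rcases lt_trichotomy (height i) (height j) with h | h | h
  · refine Or.inr (Or.inr (Or.inr ⟨(height j - height i).toNat, by omega, ?_⟩))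
    rw [superBracket_heightElement_rootVec]
    congr 1
    have : ((height j - height i).toNat : ℤ) = height j - height i := by omega
    have h2 : (((height j - height i).toNat : ℤ) : ℂ) = ((height j - height i : ℤ) : ℂ) := by
      rw [this]
    rw [Int.cast_natCast] at h2
    rw [h2]
    push_cast
    ring
  · obtain rfl := height_injective hr h
    exact Or.inr (Or.inr (Or.inl (rootVec_self_mem_cartan i)))
  · rcases rootVec_eq_zero_or_pos hr i j h with h | h
    · exact Or.inl h
    · exact Or.inr (Or.inl ⟨rootVec_mem_rootSpace i j, h⟩)

theorem heightElement_mem_osp : (heightElement m r).1 ∈ (osp m r).carrier := (heightElement m r).2.1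

theorem span_triangularSet_osp (hr : r ≤ 1) :
    Submodule.span ℂ (triangularSet (osp m r) (evenPosRoots m r ∪ oddPosRoots m r)
      (heightElement m r)) = ⊤ := by
  rw [← top_le_iff]
  rintro ⟨X, hX⟩ -
  have e : (⟨X, hX⟩ : (osp m r).carrier) =
      ∑ i, ∑ j, (X i j / 2) • ⟨rootVec i j, rootVec_mem_osp i j⟩ := by
    apply Subtype.ext
    push_cast
    exact osp_eq_sum_rootVec hX
  rw [e]
  refine Submodule.sum_mem _ fun i _ => Submodule.sum_mem _ fun j _ => Submodule.smul_mem _ _ ?_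
  rcases rootVec_cases hr i j with h | h | h | h
  · have : (⟨rootVec i j, rootVec_mem_osp i j⟩ : (osp m r).carrier) = 0 := Subtype.ext h
    rw [this]; exact zero_mem _
  · exact Submodule.subset_span (Or.inl ⟨_, h.2, h.1⟩)
  · exact Submodule.subset_span (Or.inr (Or.inl h))
  · exact Submodule.subset_span (Or.inr (Or.inr ⟨⟨_, rootVec_mem_glPart i j⟩, h⟩))

theorem levi_eq_sum_rootVec (X : (levi m r).carrier) :
    X = ∑ i, ∑ j, (X.1 i j / 2) •
      (if h : deltaDeg i = deltaDeg j then (⟨rootVec i j, rootVec_mem_levi h⟩ : (levi m r).carrier)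
        else 0) := by
  apply Subtype.ext
  push_cast
  refine (osp_eq_sum_rootVec X.2.1).trans ?_
  refine Finset.sum_congr rfl fun i _ => Finset.sum_congr rfl fun j _ => ?_
  split_ifs with h
  · rfl
  · rw [(mem_levi_iff.1 X.2).2 i j h]; simp

theorem span_triangularSet_levi (hr : r ≤ 1) :
    Submodule.span ℂ (triangularSet (levi m r) (evenPosRoots m r \ {(2 : ℂ) • δ})
      (heightElement m r)) = ⊤ := by
  rw [← top_le_iff]
  rintro X -
  rw [levi_eq_sum_rootVec X]
  refine Submodule.sum_mem _ fun i _ => Submodule.sum_mem _ fun j _ => Submodule.smul_mem _ _ ?_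
  split_ifs with hij
  · rcases rootVec_cases hr i j with h | h | h | h
    · have : (⟨rootVec i j, rootVec_mem_levi hij⟩ : (levi m r).carrier) = 0 := Subtype.ext h
      rw [this]; exact zero_mem _
    · refine Submodule.subset_span (Or.inl ⟨_, mem_levi_roots_of_pos h.2 ?_, h.1⟩)
      rw [LinearMap.sub_apply, entry_gradingCartan, entry_gradingCartan, hij, sub_self]
    · exact Submodule.subset_span (Or.inr (Or.inl h))
    · exact Submodule.subset_span (Or.inr (Or.inr ⟨⟨_, rootVec_mem_glPart i j⟩, h⟩))
  · exact zero_mem _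

/-! ### The trivial module -/

/-- The augmentation of the enveloping algebra. -/
def augmentation (m r : ℕ) : Env (osp m r) →ₐ[ℂ] ℂ := Env.lift 0 (by simp)

theorem augmentation_env (x : (osp m r).carrier) : augmentation m r (env _ x) = 0 := by
  simp [augmentation]

/-- The kernel of a character of the algebra is a maximal left ideal, and the augmentation kills the
defining relations of the Verma module of weight zero. -/
theorem maxIdeal_osp_zero (hr : r ≤ 1) :
    maxIdeal (osp m r) (evenPosRoots m r ∪ oddPosRoots m r) 0 = RingHom.ker (augmentation m r) := by
  refine maxIdeal_eq_of_isCoatom ⟨(heightElement m r).1, heightElement_mem_osp⟩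
    (heightElement m r).2 (span_triangularSet_osp hr) ?_ ?_
  · refine Submodule.span_le.2 ?_
    rintro _ (⟨x, -, rfl⟩ | ⟨x, H, -, rfl⟩)
    · exact augmentation_env x
    · change augmentation m r _ = 0
      simp [augmentation_env]
  · refine ⟨fun h => ?_, fun J hJ => ?_⟩
    · have : (1 : Env (osp m r)) ∈ RingHom.ker (augmentation m r) := by rw [h]; trivial
      simp [RingHom.mem_ker] at this
    · obtain ⟨u, huJ, hu⟩ := Set.exists_of_ssubset hJ
      have hu' : augmentation m r u ≠ 0 := hu
      have h1 : u - algebraMap ℂ _ (augmentation m r u) ∈ J := hJ.le (by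
        change augmentation m r _ = 0
        simp)
      have h2 : algebraMap ℂ (Env (osp m r)) (augmentation m r u) ∈ J := by
        simpa using J.sub_mem huJ h1
      rw [Ideal.eq_top_iff_one]
      have := J.smul_mem (algebraMap ℂ (Env (osp m r)) (augmentation m r u)⁻¹) h2
      rwa [smul_eq_mul, ← map_mul, inv_mul_cancel₀ hu', map_one] at this

theorem env_smul_trivial (hr : r ≤ 1) (x : (osp m r).carrier) (v : L (0 : Weight m r)) :
    env (osp m r) x • v = 0 := by
  obtain ⟨u, rfl⟩ := Submodule.Quotient.mk_surjective _ v
  rw [← Submodule.Quotient.mk_smul, Submodule.Quotient.mk_eq_zero, maxIdeal_osp_zero hr]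
  change augmentation m r _ = 0
  rw [smul_eq_mul, map_mul, augmentation_env, zero_mul]

theorem finrank_trivial (hr : r ≤ 1) : Module.finrank ℂ (L (0 : Weight m r)) = 1 := by
  refine finrank_eq_one (Submodule.Quotient.mk 1) ?_ ?_
  · rw [Ne, Submodule.Quotient.mk_eq_zero, maxIdeal_osp_zero hr]
    simp [RingHom.mem_ker]
  · intro w
    obtain ⟨u, rfl⟩ := Submodule.Quotient.mk_surjective _ w
    refine ⟨augmentation m r u, ?_⟩
    rw [← Submodule.Quotient.mk_smul, Submodule.Quotient.eq, maxIdeal_osp_zero hr]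
    change augmentation m r _ = 0
    simp [Algebra.smul_def]

theorem weightSpace_trivial_zero (hr : r ≤ 1) :
    weightSpace (L (0 : Weight m r)) (0 : Weight m r) = ⊤ := by
  rw [← top_le_iff]
  intro v _ H
  rw [env_smul_trivial hr]
  simp

theorem weightSpace_trivial_ne_zero (hr : r ≤ 1) {μ : Weight m r} (hμ : μ ≠ 0) :
    weightSpace (L (0 : Weight m r)) μ = ⊥ := by
  rw [← le_bot_iff]
  intro v hv
  obtain ⟨H, hH⟩ : ∃ H, μ H ≠ 0 := by
    by_contra! h; exact hμ (LinearMap.ext h)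
  have := hv H
  rw [env_smul_trivial hr] at this
  exact (smul_eq_zero.1 this.symm).resolve_left hH

theorem hasCharacter_trivial (hr : r ≤ 1) : HasCharacter m r (L (0 : Weight m r)) := by
  have : Module.Finite ℂ (L (0 : Weight m r)) :=
    Module.finite_of_finrank_pos (by rw [finrank_trivial hr]; exact one_pos)
  refine ⟨?_, fun μ => inferInstance⟩
  rw [← top_le_iff, ← weightSpace_trivial_zero hr]
  exact le_iSup (weightSpace (L (0 : Weight m r))) 0

open Classical in
theorem ch_trivial (hr : r ≤ 1) (μ : Weight m r) :
    ch (L (0 : Weight m r)) μ = if μ = 0 then 1 else 0 := by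
  unfold ch
  split_ifs with h
  · rw [h, weightSpace_trivial_zero hr, finrank_top, finrank_trivial hr]; rfl
  · rw [weightSpace_trivial_ne_zero hr h, finrank_bot]; rfl

end Osp

end

/-! ### The oscillator representation of `gl(n|2)` -/

noncomputable section

namespace Osp

variable {m r : ℕ}

set_option linter.unusedSectionVars false

/-! ### Quadratic expressions in creation and annihilation operators -/

section Oscillator

variable {J B : Type*} [Fintype J] [DecidableEq J] [Ring B] [Algebra ℂ B]

/-- The canonical supercommutation relations for creation operators `C` and annihilation
operators `A` of parities `π`. -/
structure CanonicalRelations (π : J → ZMod 2) (C A : J → B) : Prop where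
  annihilate_create : ∀ i j, A i * C j = (if i = j then 1 else 0) + ksign (π i) (π j) • (C j * A i)
  create_create : ∀ i j, C i * C j = ksign (π i) (π j) • (C j * C i)
  annihilate_annihilate : ∀ i j, A i * A j = ksign (π i) (π j) • (A j * A i)

theorem ksign_add_left (a b c : ZMod 2) : ksign (a + b) c = ksign a c * ksign b c := by
  rw [ksign_comm, ksign_add_right, ksign_comm c a, ksign_comm c b]

/-- Moving the creation operators to the left in both products leaves the same quartic term, with
signs that agree after multiplication by the supercommutator sign. Only the contractions survive. -/
theorem CanonicalRelations.quadratic_superBracket {π : J → ZMod 2} {C A : J → B}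
    (h : CanonicalRelations π C A) (i j k l : J) :
    (C i * A j) * (C k * A l) - ksign (π i + π j) (π k + π l) • ((C k * A l) * (C i * A j)) =
      (if j = k then C i * A l else 0) -
        ksign (π i + π j) (π k + π l) • (if l = i then C k * A j else 0) := by
  have e1 : (C i * A j) * (C k * A l) = (if j = k then C i * A l else 0) +
      ksign (π j) (π k) • (C i * C k * (A j * A l)) := by
    rw [mul_assoc, ← mul_assoc (A j), h.annihilate_create, add_mul, mul_add]
    congr 1
    · split_ifs <;> simp
    · simp only [smul_mul_assoc, mul_smul_comm, mul_assoc]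
  have e2 : (C k * A l) * (C i * A j) = (if l = i then C k * A j else 0) +
      (ksign (π l) (π i) * ksign (π k) (π i) * ksign (π l) (π j)) •
        (C i * C k * (A j * A l)) := by
    rw [mul_assoc, ← mul_assoc (A l), h.annihilate_create, add_mul, mul_add]
    congr 1
    · split_ifs <;> simp
    · rw [smul_mul_assoc, mul_smul_comm, mul_assoc (C i), h.annihilate_annihilate l j,
        mul_smul_comm, mul_smul_comm, ← mul_assoc, ← mul_assoc, h.create_create k i]
      simp only [smul_mul_assoc, smul_smul, mul_assoc]
      congr 1
      ring
  have hs : ksign (π i + π j) (π k + π l) * (ksign (π l) (π i) * ksign (π k) (π i) *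
      ksign (π l) (π j)) = ksign (π j) (π k) := by
    rw [ksign_add_left, ksign_add_right, ksign_add_right, ksign_comm (π l) (π i),
      ksign_comm (π k) (π i), ksign_comm (π l) (π j)]
    linear_combination (ksign (π j) (π k)) * (ksign (π i) (π k) * ksign (π i) (π k) *
      (ksign (π i) (π l) * ksign (π i) (π l)) * ksign_mul_self (π j) (π l) +
      ksign (π i) (π k) * ksign (π i) (π k) * ksign_mul_self (π i) (π l) +
      ksign_mul_self (π i) (π k))
  rw [e1, e2, smul_add, smul_smul, hs]
  abel

/-- The quadratic expression given by a matrix. -/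
def quadratic (C A : J → B) : Matrix J J ℂ →ₗ[ℂ] B where
  toFun X := ∑ i, ∑ j, X i j • (C i * A j)
  map_add' X Y := by simp only [Matrix.add_apply, add_smul, Finset.sum_add_distrib]
  map_smul' c X := by simp only [Matrix.smul_apply, smul_assoc, Finset.smul_sum, RingHom.id_apply]

theorem quadratic_apply (C A : J → B) (X : Matrix J J ℂ) :
    quadratic C A X = ∑ i, ∑ j, X i j • (C i * A j) := rfl

/-- By bilinearity from the case of matrix units; the two contractions assemble into the two matrix
products. -/
theorem CanonicalRelations.quadratic_mul {π : J → ZMod 2} {C A : J → B}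
    (h : CanonicalRelations π C A) {a b : ZMod 2} {X Y : Matrix J J ℂ}
    (hX : ∀ i j, X i j ≠ 0 → π i + π j = a) (hY : ∀ i j, Y i j ≠ 0 → π i + π j = b) :
    quadratic C A X * quadratic C A Y - ksign a b • (quadratic C A Y * quadratic C A X) =
      quadratic C A (X * Y - ksign a b • (Y * X)) := by
  have e1 : quadratic C A X * quadratic C A Y =
      ∑ i, ∑ j, ∑ k, ∑ l, (X i j * Y k l) • ((C i * A j) * (C k * A l)) := by
    simp only [quadratic_apply, Finset.sum_mul, Finset.mul_sum, smul_mul_smul_comm]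
    rw [Finset.sum_congr rfl fun k _ => Finset.sum_comm]
    rw [Finset.sum_comm]
    refine Finset.sum_congr rfl fun i _ => ?_
    rw [Finset.sum_congr rfl fun k _ => Finset.sum_comm]
    rw [Finset.sum_comm]
  have e2 : quadratic C A Y * quadratic C A X =
      ∑ i, ∑ j, ∑ k, ∑ l, (X i j * Y k l) • ((C k * A l) * (C i * A j)) := by
    simp only [quadratic_apply, Finset.sum_mul, Finset.mul_sum, smul_mul_smul_comm]
    refine Finset.sum_congr rfl fun i _ => Finset.sum_congr rfl fun j _ =>
      Finset.sum_congr rfl fun k _ => Finset.sum_congr rfl fun l _ => ?_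
    rw [mul_comm]
  have e3 : quadratic C A X * quadratic C A Y - ksign a b • (quadratic C A Y * quadratic C A X) =
      ∑ i, ∑ j, ∑ k, ∑ l, (X i j * Y k l) • ((if j = k then C i * A l else 0) -
        ksign a b • (if l = i then C k * A j else 0)) := by
    rw [e1, e2]
    simp only [Finset.smul_sum, ← Finset.sum_sub_distrib]
    refine Finset.sum_congr rfl fun i _ => Finset.sum_congr rfl fun j _ =>
      Finset.sum_congr rfl fun k _ => Finset.sum_congr rfl fun l _ => ?_
    by_cases hx : X i j = 0
    · simp [hx]
    by_cases hy : Y k l = 0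
    · simp [hy]
    rw [← hX i j hx, ← hY k l hy, ← h.quadratic_superBracket, smul_sub, smul_comm (X i j * Y k l)]
  rw [e3, map_sub, map_smul]
  simp only [smul_sub, Finset.sum_sub_distrib]
  congr 1
  · simp only [quadratic_apply, Matrix.mul_apply, Finset.sum_smul]
    refine Finset.sum_congr rfl fun i _ => ?_
    rw [Finset.sum_comm (γ := J) (s := Finset.univ) (t := Finset.univ) (f := fun l j => (X i j * Y j l) • (C i * A l))]
    refine Finset.sum_congr rfl fun j _ => ?_
    rw [Finset.sum_eq_single j]
    · simp
    · intro k _ hk; simp [hk.symm]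
    · simp
  · simp only [quadratic_apply, Matrix.mul_apply, Finset.sum_smul, Finset.smul_sum]
    rw [Finset.sum_congr rfl fun i _ => Finset.sum_congr rfl fun j _ =>
      Finset.sum_congr rfl fun k _ => Finset.sum_eq_single i (by intro l _ hl; simp [hl]) (by simp)]
    rw [Finset.sum_congr rfl fun i _ => Finset.sum_comm, Finset.sum_comm]
    refine Finset.sum_congr rfl fun k _ => ?_
    rw [Finset.sum_comm]
    refine Finset.sum_congr rfl fun j _ => Finset.sum_congr rfl fun i _ => ?_
    rw [if_pos rfl, smul_comm, mul_comm]

end Oscillator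

/-! ### The Fock space -/

/-- The space on which `osp(n|2)` acts by quadratic expressions in creation and annihilation
operators: functions of the set of occupied fermionic states and of the exponents of the bosonic
variables attached to the odd basis vectors, with values in the polynomials in the bosonic
variables attached to the even basis vectors. -/
abbrev Fock (m r : ℕ) : Type :=
  Finset (Idx m r) × (Fin 2 → ℤ) → MvPolynomial (EvenIdx m r) ℂ

/-- The sign `-1` if `j` precedes `i` and `1` otherwise, for a fixed order of the indices. -/
def orderSign (i j : Idx m r) : ℂ :=
  if Fintype.equivFin (Idx m r) j < Fintype.equivFin (Idx m r) i then -1 else 1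

theorem orderSign_comm {i j : Idx m r} (h : i ≠ j) : orderSign i j = - orderSign j i := by
  unfold orderSign
  have h' : Fintype.equivFin (Idx m r) i ≠ Fintype.equivFin (Idx m r) j :=
    fun e => h ((Fintype.equivFin _).injective e)
  rcases lt_or_gt_of_ne h' with h1 | h1
  · rw [if_neg h1.not_gt, if_pos h1, neg_neg]
  · rw [if_pos h1, if_neg h1.not_gt]

theorem orderSign_mul_self (i j : Idx m r) : orderSign i j * orderSign i j = 1 := by
  unfold orderSign; split_ifs <;> simp

theorem orderSign_self (i : Idx m r) : orderSign i i = 1 := by simp [orderSign]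

/-- The sign of adding the `i`-th fermion to, or removing it from, the set `S`. -/
def fermiSign (i : Idx m r) (S : Finset (Idx m r)) : ℂ := ∏ j ∈ S, orderSign i j

theorem fermiSign_mul_self (i : Idx m r) (S : Finset (Idx m r)) :
    fermiSign i S * fermiSign i S = 1 := by
  rw [fermiSign, ← Finset.prod_mul_distrib]
  exact Finset.prod_eq_one fun j _ => orderSign_mul_self i j

theorem fermiSign_ne_zero (i : Idx m r) (S : Finset (Idx m r)) : fermiSign i S ≠ 0 := fun h => by
  have := fermiSign_mul_self i S
  simp [h] at this

theorem fermiSign_insert (i : Idx m r) {j : Idx m r} {S : Finset (Idx m r)} (h : j ∉ S) :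
    fermiSign i (insert j S) = orderSign i j * fermiSign i S := Finset.prod_insert h

theorem fermiSign_erase (i : Idx m r) {j : Idx m r} {S : Finset (Idx m r)} (h : j ∈ S) :
    fermiSign i (S.erase j) = orderSign i j * fermiSign i S := by
  rw [fermiSign, fermiSign, ← Finset.mul_prod_erase S _ h, ← mul_assoc, orderSign_mul_self, one_mul]

/-- The creation operators of fermions. -/
def fermiCreate (i : Idx m r) : Module.End ℂ (Fock m r) where
  toFun f l := if i ∈ l.1 then fermiSign i l.1 • f (l.1.erase i, l.2) else 0
  map_add' f g := by ext1 l; simp only [Pi.add_apply]; split_ifs <;> simp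
  map_smul' c f := by
    ext1 l; simp only [Pi.smul_apply, RingHom.id_apply]; split_ifs <;> simp [smul_comm c]

/-- The annihilation operators of fermions. -/
def fermiAnnihilate (i : Idx m r) : Module.End ℂ (Fock m r) where
  toFun f l := if i ∈ l.1 then 0 else fermiSign i l.1 • f (insert i l.1, l.2)
  map_add' f g := by ext1 l; simp only [Pi.add_apply]; split_ifs <;> simp
  map_smul' c f := by
    ext1 l; simp only [Pi.smul_apply, RingHom.id_apply]; split_ifs <;> simp [smul_comm c]

/-- The multiplications by the bosonic variables. -/
def boseCreate : Idx m r → Module.End ℂ (Fock m r) :=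
  Sum.elim
    (fun w => LinearMap.pi fun l =>
      LinearMap.mulLeft ℂ (MvPolynomial.X w : MvPolynomial (EvenIdx m r) ℂ) ∘ₗ LinearMap.proj l)
    (fun k => LinearMap.pi fun l => LinearMap.proj (l.1, l.2 - Pi.single k 1))

/-- The derivatives with respect to the bosonic variables. -/
def boseAnnihilate : Idx m r → Module.End ℂ (Fock m r) :=
  Sum.elim
    (fun w => LinearMap.pi fun l =>
      (MvPolynomial.pderiv w : Derivation ℂ (MvPolynomial (EvenIdx m r) ℂ) _).toLinearMap ∘ₗ
        LinearMap.proj l)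
    (fun k => LinearMap.pi fun l =>
      ((l.2 k + 1 : ℤ) : ℂ) • LinearMap.proj (l.1, l.2 + Pi.single k 1))

theorem fermiCreate_apply (i : Idx m r) (f : Fock m r) (l) : fermiCreate i f l =
    if i ∈ l.1 then fermiSign i l.1 • f (l.1.erase i, l.2) else 0 := rfl

theorem fermiAnnihilate_apply (i : Idx m r) (f : Fock m r) (l) : fermiAnnihilate i f l =
    if i ∈ l.1 then 0 else fermiSign i l.1 • f (insert i l.1, l.2) := rfl

theorem boseCreate_inl_apply (w : EvenIdx m r) (f : Fock m r) (l) :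
    boseCreate (Sum.inl w) f l = MvPolynomial.X w * f l := rfl

theorem boseCreate_inr_apply (k : Fin 2) (f : Fock m r) (l) :
    boseCreate (Sum.inr k) f l = f (l.1, l.2 - Pi.single k 1) := rfl

theorem boseAnnihilate_inl_apply (w : EvenIdx m r) (f : Fock m r) (l) :
    boseAnnihilate (Sum.inl w) f l = MvPolynomial.pderiv w (f l) := rfl

theorem boseAnnihilate_inr_apply (k : Fin 2) (f : Fock m r) (l) :
    boseAnnihilate (Sum.inr k) f l = ((l.2 k + 1 : ℤ) : ℂ) • f (l.1, l.2 + Pi.single k 1) := rfl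

/-- For `i ≠ j`, changing the occupation of one state alters the sign attached to the other by
`orderSign`. Exactly one of `orderSign i j` and `orderSign j i` is `-1`, which produces the
anticommutation. -/
theorem fermiAnnihilate_mul_fermiCreate (i j : Idx m r) :
    (fermiAnnihilate i * fermiCreate j : Module.End ℂ (Fock m r)) =
      (if i = j then 1 else 0) - fermiCreate j * fermiAnnihilate i := by
  ext1 f
  ext1 ⟨S, e⟩
  rw [LinearMap.sub_apply, Pi.sub_apply, Module.End.mul_apply, Module.End.mul_apply]
  simp only [fermiCreate_apply, fermiAnnihilate_apply]
  by_cases hij : i = j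
  · subst hij
    by_cases hi : i ∈ S
    · simp [hi, smul_smul, fermiSign_erase, orderSign_self, fermiSign_mul_self]
    · simp [hi, smul_smul, fermiSign_insert, orderSign_self, fermiSign_mul_self]
  · rw [if_neg hij]
    by_cases hi : i ∈ S
    · have : i ∈ S.erase j := Finset.mem_erase.2 ⟨hij, hi⟩
      simp [hi, this]
    · have h1 : i ∉ S.erase j := fun h => hi (Finset.mem_of_mem_erase h)
      by_cases hj : j ∈ S
      · have h2 : j ∈ insert i S := Finset.mem_insert_of_mem hj
        rw [if_neg hi, if_pos h2, if_pos hj, if_neg h1, smul_smul, smul_smul,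
          fermiSign_insert _ hi, fermiSign_erase _ hj, orderSign_comm hij,
          Finset.erase_insert_of_ne hij, LinearMap.zero_apply, Pi.zero_apply, zero_sub, ← neg_smul]
        congr 1
        ring
      · have h2 : j ∉ insert i S := by simp [Ne.symm hij, hj]
        simp [hj, h2]

theorem fermiCreate_mul_fermiCreate (i j : Idx m r) :
    (fermiCreate i * fermiCreate j : Module.End ℂ (Fock m r)) = -(fermiCreate j * fermiCreate i) := by
  ext1 f
  ext1 ⟨S, e⟩
  rw [LinearMap.neg_apply, Pi.neg_apply, Module.End.mul_apply, Module.End.mul_apply]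
  simp only [fermiCreate_apply]
  by_cases hij : i = j
  · subst hij; simp
  by_cases hi : i ∈ S
  · by_cases hj : j ∈ S
    · rw [if_pos hi, if_pos hj, if_pos (Finset.mem_erase.2 ⟨Ne.symm hij, hj⟩),
        if_pos (Finset.mem_erase.2 ⟨hij, hi⟩), smul_smul, smul_smul, fermiSign_erase _ hi,
        fermiSign_erase _ hj, orderSign_comm hij, Finset.erase_right_comm, ← neg_smul]
      congr 1
      ring
    · have : j ∉ S.erase i := fun h => hj (Finset.mem_of_mem_erase h)
      simp [hj]
  · have : i ∉ S.erase j := fun h => hi (Finset.mem_of_mem_erase h)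
    simp [hi]

theorem fermiAnnihilate_mul_fermiAnnihilate (i j : Idx m r) :
    (fermiAnnihilate i * fermiAnnihilate j : Module.End ℂ (Fock m r)) =
      -(fermiAnnihilate j * fermiAnnihilate i) := by
  ext1 f
  ext1 ⟨S, e⟩
  rw [LinearMap.neg_apply, Pi.neg_apply, Module.End.mul_apply, Module.End.mul_apply]
  simp only [fermiAnnihilate_apply]
  by_cases hij : i = j
  · subst hij; simp
  by_cases hi : i ∈ S
  · simp [hi]
  by_cases hj : j ∈ S
  · simp [hj]
  rw [if_neg hi, if_neg hj, if_neg (by simp [Ne.symm hij, hj]), if_neg (by simp [hij, hi]),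
    smul_smul, smul_smul, fermiSign_insert _ hi, fermiSign_insert _ hj, orderSign_comm hij,
    Finset.insert_comm, ← neg_smul]
  congr 1
  ring

/-- The commutator of two derivations is a derivation, and this one vanishes on the variables. -/
theorem pderiv_pderiv_comm {σ : Type*} (i j : σ) (p : MvPolynomial σ ℂ) :
    MvPolynomial.pderiv i (MvPolynomial.pderiv j p) =
      MvPolynomial.pderiv j (MvPolynomial.pderiv i p) := by
  classical
  let D : Derivation ℂ (MvPolynomial σ ℂ) (MvPolynomial σ ℂ) :=
    ⁅(MvPolynomial.pderiv i : Derivation ℂ (MvPolynomial σ ℂ) (MvPolynomial σ ℂ)),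
      (MvPolynomial.pderiv j : Derivation ℂ (MvPolynomial σ ℂ) (MvPolynomial σ ℂ))⁆
  have hD : D = 0 := MvPolynomial.derivation_ext fun k => by
    simp only [D, Derivation.commutator_apply, MvPolynomial.pderiv_X, Pi.single_apply,
      Derivation.zero_apply]
    split_ifs <;> simp
  have h : D p = 0 := by rw [hD]; rfl
  rwa [Derivation.commutator_apply, sub_eq_zero] at h

theorem boseCreate_comm (i j : Idx m r) : Commute (boseCreate i) (boseCreate j) := by
  refine LinearMap.ext fun f => funext fun l => ?_
  rw [Module.End.mul_apply, Module.End.mul_apply]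
  rcases i with i | i <;> rcases j with j | j <;>
    simp only [boseCreate_inl_apply, boseCreate_inr_apply]
  · ring
  · rw [sub_right_comm]

theorem boseAnnihilate_comm (i j : Idx m r) : Commute (boseAnnihilate i) (boseAnnihilate j) := by
  refine LinearMap.ext fun f => funext fun l => ?_
  rw [Module.End.mul_apply, Module.End.mul_apply]
  rcases i with i | i <;> rcases j with j | j <;>
    simp only [boseAnnihilate_inl_apply, boseAnnihilate_inr_apply, Derivation.map_smul]
  · exact pderiv_pderiv_comm i j _
  · by_cases hij : i = j
    · subst hij; rfl
    · simp only [Pi.add_apply, Pi.single_eq_of_ne hij, Pi.single_eq_of_ne (Ne.symm hij), add_zero,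
        smul_smul]
      rw [add_right_comm, mul_comm]

theorem boseAnnihilate_mul_boseCreate (i j : Idx m r) :
    (boseAnnihilate i * boseCreate j : Module.End ℂ (Fock m r)) =
      (if i = j then 1 else 0) + boseCreate j * boseAnnihilate i := by
  refine LinearMap.ext fun f => funext fun l => ?_
  rw [LinearMap.add_apply, Pi.add_apply, Module.End.mul_apply, Module.End.mul_apply]
  rcases i with i | i <;> rcases j with j | j <;>
    simp only [boseAnnihilate_inl_apply, boseAnnihilate_inr_apply, boseCreate_inl_apply,
      boseCreate_inr_apply, Derivation.leibniz, MvPolynomial.pderiv_X, Sum.inl.injEq,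
      Sum.inr.injEq, smul_eq_mul, reduceCtorEq, if_false, LinearMap.zero_apply, Pi.zero_apply,
      zero_add, mul_smul_comm]
  · by_cases hij : i = j
    · subst hij; simp [add_comm]
    · simp [hij]
  · by_cases hij : i = j
    · subst hij
      simp only [if_true, Module.End.one_apply, Pi.sub_apply, Pi.single_eq_same, sub_add_cancel,
        add_sub_cancel_right]
      push_cast
      rw [add_smul, one_smul, add_comm]
    · simp only [if_neg hij, LinearMap.zero_apply, Pi.zero_apply, zero_add, Pi.sub_apply,
        Pi.single_eq_of_ne hij, sub_zero]
      rw [sub_add_eq_add_sub]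

theorem fermiCreate_bose_comm (i j : Idx m r) : Commute (fermiCreate i) (boseCreate j) := by
  refine LinearMap.ext fun f => funext fun l => ?_
  rw [Module.End.mul_apply, Module.End.mul_apply]
  rcases j with j | j <;>
    simp only [fermiCreate_apply, boseCreate_inl_apply, boseCreate_inr_apply]
  split_ifs <;> simp

theorem fermiAnnihilate_bose_comm (i j : Idx m r) : Commute (fermiAnnihilate i) (boseCreate j) := by
  refine LinearMap.ext fun f => funext fun l => ?_
  rw [Module.End.mul_apply, Module.End.mul_apply]
  rcases j with j | j <;>
    simp only [fermiAnnihilate_apply, boseCreate_inl_apply, boseCreate_inr_apply]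
  split_ifs <;> simp

theorem fermiCreate_boseAnnihilate_comm (i j : Idx m r) :
    Commute (fermiCreate i) (boseAnnihilate j) := by
  refine LinearMap.ext fun f => funext fun l => ?_
  rw [Module.End.mul_apply, Module.End.mul_apply]
  rcases j with j | j <;>
    simp only [fermiCreate_apply, boseAnnihilate_inl_apply, boseAnnihilate_inr_apply] <;>
    split_ifs <;> simp [smul_comm (fermiSign i l.1)]

theorem fermiAnnihilate_boseAnnihilate_comm (i j : Idx m r) :
    Commute (fermiAnnihilate i) (boseAnnihilate j) := by
  refine LinearMap.ext fun f => funext fun l => ?_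
  rw [Module.End.mul_apply, Module.End.mul_apply]
  rcases j with j | j <;>
    simp only [fermiAnnihilate_apply, boseAnnihilate_inl_apply, boseAnnihilate_inr_apply] <;>
    split_ifs <;> simp [smul_comm (fermiSign i l.1)]

/-- The creation operators of the two copies of `ℂ^{n|2}`, the second one with shifted parity. -/
def create (i : Idx m r × ZMod 2) : Module.End ℂ (Fock m r) :=
  if parity i.1 + i.2 = 0 then boseCreate i.1 else fermiCreate i.1

/-- The annihilation operators of the two copies of `ℂ^{n|2}`. -/
def annihilate (i : Idx m r × ZMod 2) : Module.End ℂ (Fock m r) :=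
  if parity i.1 + i.2 = 0 then boseAnnihilate i.1 else fermiAnnihilate i.1

/-- For each index exactly one of the two copies is bosonic and the other fermionic. Hence, within
one type, equality of pairs reduces to equality of indices. -/
theorem canonicalRelations : CanonicalRelations
    (fun i : Idx m r × ZMod 2 => parity i.1 + i.2) create annihilate := by
  have key : ∀ a : ZMod 2, a ≠ 0 → a = 1 := by decide
  have cancel : ∀ i j : Idx m r × ZMod 2, parity i.1 + i.2 = parity j.1 + j.2 →
      (i = j ↔ i.1 = j.1) := fun i j h =>
    ⟨fun e => by rw [e], fun e => Prod.ext e (by rw [e] at h; exact add_left_cancel h)⟩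
  refine ⟨fun i j => ?_, fun i j => ?_, fun i j => ?_⟩
  all_goals simp only [create, annihilate]
  all_goals by_cases hi : parity i.1 + i.2 = 0 <;> by_cases hj : parity j.1 + j.2 = 0
  all_goals simp only [hi, hj, if_true, if_false, ksign_zero_left, ksign_zero_right, one_smul]
  · rw [if_congr (cancel i j (hi.trans hj.symm)) rfl rfl]
    exact boseAnnihilate_mul_boseCreate _ _
  · rw [if_neg (by rintro rfl; exact hj hi), zero_add]
    exact (fermiCreate_boseAnnihilate_comm _ _).symm
  · rw [if_neg (by rintro rfl; exact hi hj), zero_add]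
    exact fermiAnnihilate_bose_comm _ _
  · rw [if_congr (cancel i j ((key _ hi).trans (key _ hj).symm)) rfl rfl, key _ hi, key _ hj,
      ksign_one_one, neg_smul, one_smul, ← sub_eq_add_neg]
    exact fermiAnnihilate_mul_fermiCreate _ _
  · exact boseCreate_comm _ _
  · exact (fermiCreate_bose_comm _ _).symm
  · exact fermiCreate_bose_comm _ _
  · rw [key _ hi, key _ hj, ksign_one_one, neg_smul, one_smul]
    exact fermiCreate_mul_fermiCreate _ _
  · exact boseAnnihilate_comm _ _
  · exact (fermiAnnihilate_boseAnnihilate_comm _ _).symm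
  · exact fermiAnnihilate_boseAnnihilate_comm _ _
  · rw [key _ hi, key _ hj, ksign_one_one, neg_smul, one_smul]
    exact fermiAnnihilate_mul_fermiAnnihilate _ _

/-- The action of `gl(n|2)` on the Fock space. -/
def fockAct : Gl m r →ₗ[ℂ] Module.End ℂ (Fock m r) where
  toFun X := quadratic create annihilate (Matrix.blockDiagonal fun _ : ZMod 2 => X)
  map_add' X Y := by rw [← map_add]; congr 1; exact Matrix.blockDiagonal_add _ _
  map_smul' c X := by rw [← map_smul]; congr 1; exact Matrix.blockDiagonal_smul c _

/-- The block diagonal matrix never mixes the copies, so the parity shift in the second copy cancels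
between row and column and a matrix keeps its degree. -/
theorem fockAct_superBracket {a b : ZMod 2} {X Y : Gl m r} (hX : X ∈ glPart m r a)
    (hY : Y ∈ glPart m r b) :
    fockAct X * fockAct Y - ksign a b • (fockAct Y * fockAct X) = fockAct (superBracket X Y) := by
  have key : ∀ {a : ZMod 2} {X : Gl m r}, X ∈ glPart m r a → ∀ i j : Idx m r × ZMod 2,
      Matrix.blockDiagonal (fun _ : ZMod 2 => X) i j ≠ 0 →
      parity i.1 + i.2 + (parity j.1 + j.2) = a := by
    intro a X hX i j hij
    rw [Matrix.blockDiagonal_apply] at hij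
    split_ifs at hij with h
    · have h1 : parity i.1 = a + parity j.1 := by
        by_contra h2; exact hij (hX _ _ h2)
      rw [h1, h]
      have : ∀ a b c : ZMod 2, a + b + c + (b + c) = a := by decide
      exact this _ _ _
    · exact absurd rfl hij
  rw [superBracket_of_mem hX hY]
  change quadratic create annihilate _ * quadratic create annihilate _ -
    ksign a b • (quadratic create annihilate _ * quadratic create annihilate _) =
    quadratic create annihilate _
  rw [canonicalRelations.quadratic_mul (key hX) (key hY)]
  congr 1
  rw [← Matrix.blockDiagonal_mul, ← Matrix.blockDiagonal_mul, ← Matrix.blockDiagonal_smul,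
    ← Matrix.blockDiagonal_sub]
  rfl

/-- The representation of the enveloping algebra of `osp(n|2)` on the Fock space. -/
def fockRep (m r : ℕ) : Env (osp m r) →ₐ[ℂ] Module.End ℂ (Fock m r) :=
  Env.lift (fockAct ∘ₗ (osp m r).carrier.subtype) fun _ _ _ _ hx hy => fockAct_superBracket hx hy

theorem fockRep_env (x : (osp m r).carrier) : fockRep m r (env _ x) = fockAct x.1 :=
  Env.lift_env _ _ _

instance : Module (Env (osp m r)) (Fock m r) := Module.compHom _ (fockRep m r).toRingHom

theorem env_osp_smul_fock (u : Env (osp m r)) (f : Fock m r) : u • f = fockRep m r u f := rfl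

theorem env_smul_fock (x : (osp m r).carrier) (f : Fock m r) : env _ x • f = fockAct x.1 f := by
  rw [env_osp_smul_fock, fockRep_env]

instance : IsScalarTower ℂ (Env (osp m r)) (Fock m r) :=
  ⟨fun c u f => by rw [env_osp_smul_fock, env_osp_smul_fock, map_smul, LinearMap.smul_apply]⟩

theorem fockAct_apply (X : Gl m r) (f : Fock m r) : fockAct X f =
    ∑ i, ∑ j, X i j • (create (i, 0) (annihilate (j, 0) f) + create (i, 1) (annihilate (j, 1) f)) := by
  change quadratic create annihilate _ f = _
  simp only [quadratic_apply, Fintype.sum_prod_type, LinearMap.sum_apply]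
  refine Finset.sum_congr rfl fun i _ => ?_
  rw [Finset.sum_comm]
  refine Finset.sum_congr rfl fun j _ => ?_
  have h : ∀ g : ZMod 2 → Fock m r, ∑ k, g k = g 0 + g 1 := fun g => Fin.sum_univ_two g
  simp only [h, Matrix.blockDiagonal_apply]
  simp

theorem fockAct_single (i j : Idx m r) (f : Fock m r) : fockAct (Matrix.single i j 1) f =
    create (i, 0) (annihilate (j, 0) f) + create (i, 1) (annihilate (j, 1) f) := by
  rw [fockAct_apply, Finset.sum_eq_single i, Finset.sum_eq_single j]
  · simp
  · intro k _ hk; rw [Matrix.single_apply, if_neg (fun h => hk h.2.symm), zero_smul]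
  · simp
  · intro k _ hk
    exact Finset.sum_eq_zero fun l _ => by
      rw [Matrix.single_apply, if_neg (fun h => hk h.1.symm), zero_smul]
  · simp

@[simp] theorem create_inl_zero (w : EvenIdx m r) :
    create ((Sum.inl w : Idx m r), 0) = boseCreate (Sum.inl w) := by simp [create]

@[simp] theorem create_inl_one (w : EvenIdx m r) :
    create ((Sum.inl w : Idx m r), 1) = fermiCreate (Sum.inl w) := by simp [create]

@[simp] theorem create_inr_zero (k : Fin 2) :
    create ((Sum.inr k : Idx m r), 0) = fermiCreate (Sum.inr k) := by simp [create]

@[simp] theorem create_inr_one (k : Fin 2) :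
    create ((Sum.inr k : Idx m r), 1) = boseCreate (Sum.inr k) := by
  simp [create, zmod_two_one_add_one]

@[simp] theorem annihilate_inl_zero (w : EvenIdx m r) :
    annihilate ((Sum.inl w : Idx m r), 0) = boseAnnihilate (Sum.inl w) := by simp [annihilate]

@[simp] theorem annihilate_inl_one (w : EvenIdx m r) :
    annihilate ((Sum.inl w : Idx m r), 1) = fermiAnnihilate (Sum.inl w) := by simp [annihilate]

@[simp] theorem annihilate_inr_zero (k : Fin 2) :
    annihilate ((Sum.inr k : Idx m r), 0) = fermiAnnihilate (Sum.inr k) := by simp [annihilate]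

@[simp] theorem annihilate_inr_one (k : Fin 2) :
    annihilate ((Sum.inr k : Idx m r), 1) = boseAnnihilate (Sum.inr k) := by
  simp [annihilate, zmod_two_one_add_one]

end Osp

end

noncomputable section

namespace Osp

/-! ### Harmonic polynomials -/

section Harmonic

set_option linter.unusedSectionVars false

open MvPolynomial

variable {σ : Type*} [Fintype σ] [DecidableEq σ] (τ : σ → σ)

/-- The infinitesimal rotations with respect to the form pairing the variables `w` and `τ w`. -/
def rot (i j : σ) : MvPolynomial σ ℂ →ₗ[ℂ] MvPolynomial σ ℂ :=
  LinearMap.mulLeft ℂ (X i) ∘ₗ (pderiv j : Derivation ℂ (MvPolynomial σ ℂ) _).toLinearMap -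
    LinearMap.mulLeft ℂ (X (τ j)) ∘ₗ (pderiv (τ i) : Derivation ℂ (MvPolynomial σ ℂ) _).toLinearMap

theorem rot_apply (i j : σ) (p : MvPolynomial σ ℂ) :
    rot τ i j p = X i * pderiv j p - X (τ j) * pderiv (τ i) p := rfl

/-- The Laplacian. -/
def laplacian : MvPolynomial σ ℂ →ₗ[ℂ] MvPolynomial σ ℂ :=
  ∑ w, (pderiv w : Derivation ℂ (MvPolynomial σ ℂ) _).toLinearMap ∘ₗ
    (pderiv (τ w) : Derivation ℂ (MvPolynomial σ ℂ) _).toLinearMap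

theorem laplacian_apply (p : MvPolynomial σ ℂ) :
    laplacian τ p = ∑ w, pderiv w (pderiv (τ w) p) := by
  simp [laplacian]

theorem pderiv_X_mul (i j : σ) (p : MvPolynomial σ ℂ) :
    pderiv i (X j * p) = (if j = i then p else 0) + X j * pderiv i p := by
  rw [Derivation.leibniz, pderiv_X, smul_eq_mul, smul_eq_mul, Pi.single_apply, add_comm]
  congr 1
  split_ifs <;> simp

theorem laplacian_pderiv (i : σ) (p : MvPolynomial σ ℂ) :
    laplacian τ (pderiv i p) = pderiv i (laplacian τ p) := by
  simp only [laplacian_apply, map_sum]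
  refine Finset.sum_congr rfl fun w _ => ?_
  rw [pderiv_pderiv_comm (τ w) i, pderiv_pderiv_comm w i]

variable {τ}

theorem laplacian_X_mul (hτ : Function.Involutive τ) (i : σ) (p : MvPolynomial σ ℂ) :
    laplacian τ (X i * p) = X i * laplacian τ p + 2 * pderiv (τ i) p := by
  have h : ∀ w, pderiv w (pderiv (τ w) (X i * p)) = X i * pderiv w (pderiv (τ w) p) +
      ((if i = τ w then pderiv w p else 0) + (if i = w then pderiv (τ w) p else 0)) := fun w => by
    rw [pderiv_X_mul, map_add, pderiv_X_mul, apply_ite (pderiv w), map_zero]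
    abel
  have h2 : ∀ w, (i = τ w) ↔ (τ i = w) := fun w => by
    constructor
    · rintro rfl; exact hτ w
    · rintro rfl; exact (hτ i).symm
  simp only [laplacian_apply, h, h2, Finset.sum_add_distrib, Finset.mul_sum]
  simp only [Finset.sum_ite_eq, Finset.mem_univ, if_true]
  ring

/-- The two correction terms from `laplacian_X_mul` are the same second derivative, with opposite
signs. -/
theorem laplacian_rot (hτ : Function.Involutive τ) (i j : σ) (p : MvPolynomial σ ℂ) :
    laplacian τ (rot τ i j p) = rot τ i j (laplacian τ p) := by
  rw [rot_apply, rot_apply, map_sub, laplacian_X_mul hτ, laplacian_X_mul hτ, laplacian_pderiv,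
    laplacian_pderiv, hτ j, pderiv_pderiv_comm (τ i) j]
  ring

variable (τ) in
/-- Homogeneous harmonic polynomials of degree `i`. -/
def harmonic (i : ℕ) : Submodule ℂ (MvPolynomial σ ℂ) :=
  homogeneousSubmodule σ ℂ i ⊓ LinearMap.ker (laplacian τ)

theorem mem_harmonic {i : ℕ} {p : MvPolynomial σ ℂ} :
    p ∈ harmonic τ i ↔ p.IsHomogeneous i ∧ laplacian τ p = 0 := Iff.rfl

theorem isHomogeneous_X_mul_pderiv {i : ℕ} {p : MvPolynomial σ ℂ} (hp : p.IsHomogeneous i)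
    (a b : σ) : (X a * pderiv b p).IsHomogeneous i := by
  rcases Nat.eq_zero_or_pos i with rfl | hi
  · obtain ⟨c, rfl⟩ : ∃ c, p = C c := ⟨_, totalDegree_eq_zero_iff_eq_C.1
      (Nat.le_zero.1 hp.totalDegree_le)⟩
    rw [pderiv_C, mul_zero]
    exact isHomogeneous_zero _ _ _
  · have := (isHomogeneous_X ℂ a).mul (hp.pderiv (i := b))
    rwa [add_comm, Nat.sub_add_cancel hi] at this

theorem rot_mem_harmonic (hτ : Function.Involutive τ) {i : ℕ} {p : MvPolynomial σ ℂ}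
    (hp : p ∈ harmonic τ i) (a b : σ) : rot τ a b p ∈ harmonic τ i := by
  refine mem_harmonic.2 ⟨?_, ?_⟩
  · exact (isHomogeneous_X_mul_pderiv hp.1 _ _).sub (isHomogeneous_X_mul_pderiv hp.1 _ _)
  · rw [laplacian_rot hτ, (mem_harmonic.1 hp).2, map_zero]

instance (i : ℕ) : FiniteDimensional ℂ (homogeneousSubmodule σ ℂ i) :=
  Module.Finite.iff_fg.2 (homogeneousSubmodule_fg σ ℂ i)

instance (i : ℕ) : FiniteDimensional ℂ (harmonic τ i) :=
  Submodule.finiteDimensional_of_le inf_le_left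

/-! ### Highest weight vectors among harmonic polynomials -/

theorem coeff_eq_zero_of_pderiv_eq_zero {k : σ} {p : MvPolynomial σ ℂ} (h : pderiv k p = 0)
    {d : σ →₀ ℕ} (hd : d k ≠ 0) : coeff d p = 0 := by
  have h1 := coeff_pderiv p (d - Finsupp.single k 1) (i := k)
  have h2 : d - Finsupp.single k 1 + Finsupp.single k 1 = d := by
    ext l
    by_cases hl : l = k
    · subst hl; simp; omega
    · simp [Finsupp.single_eq_of_ne hl]
  rw [h, coeff_zero, h2] at h1
  rcases mul_eq_zero.1 h1.symm with h3 | h3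
  · exact h3
  · exact absurd h3 (Nat.cast_add_one_ne_zero _)

theorem eq_C_mul_X_pow_of_pderiv_eq_zero {a : σ} {i : ℕ} {p : MvPolynomial σ ℂ}
    (hp : p.IsHomogeneous i) (h : ∀ k, k ≠ a → pderiv k p = 0) : ∃ c, p = C c * X a ^ i := by
  refine ⟨coeff (Finsupp.single a i) p, ?_⟩
  rw [X_pow_eq_monomial, C_mul_monomial, mul_one]
  ext d
  rw [coeff_monomial]
  split_ifs with hd
  · rw [hd]
  · by_contra hne
    apply hd
    have hk : ∀ k, k ≠ a → d k = 0 := fun k hk => by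
      by_contra hdk
      exact hne (coeff_eq_zero_of_pderiv_eq_zero (h k hk) hdk)
    have hdeg : d.degree = i := by
      by_contra hdeg; exact hne (hp.coeff_eq_zero hdeg)
    have hs : d = Finsupp.single a (d a) := by
      ext l
      by_cases hl : l = a
      · subst hl; simp
      · rw [hk l hl, Finsupp.single_eq_of_ne hl]
    rw [hs, Finsupp.degree_single] at hdeg
    rw [hs, hdeg]

/-- A harmonic polynomial annihilated by the raising rotations is a multiple of a power of
the highest variable. -/
theorem exists_eq_C_mul_X_pow_of_rot_eq_zero (hτ : Function.Involutive τ) {a b : σ} (ha : τ a ≠ a)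
    (hba : b ≠ a) (hbτ : b ≠ τ a) {i : ℕ} {p : MvPolynomial σ ℂ} (hp : p ∈ harmonic τ i)
    (h : ∀ k, k ≠ a → k ≠ τ a → rot τ a k p = 0) : ∃ c, p = C c * X a ^ i := by
  induction i generalizing p with
  | zero =>
    refine ⟨coeff 0 p, ?_⟩
    rw [pow_zero, mul_one]
    exact totalDegree_eq_zero_iff_eq_C.1 (Nat.le_zero.1 (mem_harmonic.1 hp).1.totalDegree_le)
  | succ i ih =>
    obtain ⟨hp1, hp2⟩ := mem_harmonic.1 hp
    have hrot : ∀ k, k ≠ a → k ≠ τ a → X a * pderiv k p = X (τ k) * pderiv (τ a) p :=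
      fun k h1 h2 => sub_eq_zero.1 (h k h1 h2)
    -- The derivative along `τ a` commutes with the raising rotations, so it is a highest weight
    -- vector of smaller degree and the induction hypothesis applies. It remains to show `c = 0`.
    obtain ⟨c, hc⟩ : ∃ c, pderiv (τ a) p = C c * X a ^ i := by
      refine ih (mem_harmonic.2 ⟨hp1.pderiv, ?_⟩) fun k h1 h2 => ?_
      · rw [laplacian_pderiv, hp2, map_zero]
      · have h3 : τ k ≠ τ a := fun e => h1 (hτ.injective e)
        have := congrArg (pderiv (τ a)) (hrot k h1 h2)
        rw [pderiv_X_mul, pderiv_X_mul, if_neg ha.symm, if_neg h3, zero_add, zero_add] at this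
        rw [rot_apply, pderiv_pderiv_comm, this, sub_self]
    have hc0 : c = 0 := by
      cases i with
      | zero =>
        -- In degree one the Laplacian gives nothing. The third index `b`, available because `n ≥
        -- 3`, gives `X a * ∂_b p = c X (τ b)`, which is evaluated where only `X a` vanishes.
        have := hrot b hba hbτ
        rw [hc, pow_zero, mul_one] at this
        have hb : τ b ≠ a := fun e => hbτ (by rw [← e, hτ b])
        have := congrArg (eval fun w => if w = a then (0 : ℂ) else 1) this
        simpa [hb] using this.symm
      | succ i =>
        have hk : ∀ k, k ≠ a → k ≠ τ a → pderiv k p = C c * (X (τ k) * X a ^ i) := by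
          intro k h1 h2
          have := hrot k h1 h2
          rw [hc] at this
          refine mul_left_cancel₀ (X_ne_zero a) (this.trans ?_)
          ring
        have hX : pderiv a (X a ^ (i + 1) : MvPolynomial σ ℂ) = C ((i : ℂ) + 1) * X a ^ i := by
          rw [pderiv_pow, pderiv_X_self, mul_one, Nat.add_sub_cancel, map_add, map_natCast, map_one]
          push_cast; rfl
        -- In degree at least two every second derivative in the Laplacian is a positive integer
        -- multiple of `c X_a^i`, so nothing cancels and harmonicity forces `c = 0`.
        have hsum : laplacian τ p = C (c * ∑ w : σ, if w = a ∨ w = τ a then ((i : ℂ) + 1) else 1) *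
            X a ^ i := by
          rw [laplacian_apply, Finset.mul_sum, map_sum, Finset.sum_mul]
          refine Finset.sum_congr rfl fun w _ => ?_
          by_cases h1 : w = a
          · subst h1
            rw [if_pos (Or.inl rfl), hc, pderiv_C_mul, hX, ← mul_assoc, ← C_mul]
          by_cases h2 : w = τ a
          · subst h2
            rw [if_pos (Or.inr rfl), hτ a, pderiv_pderiv_comm, hc, pderiv_C_mul, hX,
              ← mul_assoc, ← C_mul]
          · rw [if_neg (by tauto), pderiv_pderiv_comm, hk w h1 h2, pderiv_C_mul, pderiv_X_mul,
              if_pos rfl, pderiv_pow, pderiv_X_of_ne (fun e => h2 (by rw [e, hτ w])), mul_zero,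
              mul_zero, add_zero, mul_one]
        rw [hp2] at hsum
        have hne : (∑ w : σ, if w = a ∨ w = τ a then ((i : ℂ) + 1) else 1) ≠ 0 := by
          have : (∑ w : σ, if w = a ∨ w = τ a then ((i : ℂ) + 1) else 1) =
              ((∑ w : σ, if w = a ∨ w = τ a then (i + 1) else 1 : ℕ) : ℂ) := by push_cast; rfl
          rw [this, Nat.cast_ne_zero]
          refine (Finset.sum_pos (fun w _ => ?_) ⟨a, Finset.mem_univ a⟩).ne'
          split_ifs <;> omega
        have h0 := (mul_eq_zero.1 hsum.symm).resolve_right (pow_ne_zero _ (X_ne_zero a))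
        rw [C_eq_zero] at h0
        exact (mul_eq_zero.1 h0).resolve_right hne
    rw [hc0, map_zero, zero_mul] at hc
    refine eq_C_mul_X_pow_of_pderiv_eq_zero hp1 fun k h1 => ?_
    by_cases h2 : k = τ a
    · rw [h2, hc]
    · have := hrot k h1 h2
      rw [hc, mul_zero] at this
      exact (mul_eq_zero.1 this).resolve_left (X_ne_zero a)

/-- The operator `rot τ a a` counts the exponent of `X a` minus that of `X (τ a)`, and `rot τ a k`
raises this count by one. -/
theorem rot_self_rot (hτ : Function.Involutive τ) {a k : σ} (ha : τ a ≠ a) (hka : k ≠ a)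
    (hkτ : k ≠ τ a) (p : MvPolynomial σ ℂ) :
    rot τ a a (rot τ a k p) = rot τ a k (rot τ a a p) + rot τ a k p := by
  have h1 : τ k ≠ a := fun e => hkτ (by rw [← e, hτ k])
  have h2 : τ k ≠ τ a := fun e => hka (hτ.injective e)
  simp only [rot_apply, map_sub, pderiv_X_mul, if_neg ha.symm, if_neg h1, if_neg h2,
    if_neg hka.symm, if_neg hkτ.symm, if_true]
  rw [pderiv_pderiv_comm k a, pderiv_pderiv_comm (τ a) a, pderiv_pderiv_comm k (τ a)]
  ring

/-- A nonzero space of harmonic polynomials stable under rotations contains the highest weight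
vector. -/
theorem X_pow_mem_of_rot_mem (hτ : Function.Involutive τ) {a b : σ} (ha : τ a ≠ a)
    (hba : b ≠ a) (hbτ : b ≠ τ a) {i : ℕ} {U : Submodule ℂ (MvPolynomial σ ℂ)}
    (hU : U ≤ harmonic τ i) (hrot : ∀ k l, ∀ p ∈ U, rot τ k l p ∈ U) (hne : U ≠ ⊥) :
    X a ^ i ∈ U := by
  have : FiniteDimensional ℂ U := Submodule.finiteDimensional_of_le hU
  have : Nontrivial U := Submodule.nontrivial_iff_ne_bot.2 hne
  let h : Module.End ℂ U := (rot τ a a).restrict (hrot a a)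
  have hfin := Module.End.finite_hasEigenvalue h
  obtain ⟨μ₀, hμ₀⟩ := Module.End.exists_eigenvalue h
  -- A finite-dimensional space cannot carry the infinite string `μ₀, μ₀ + 1, …`. At the top of the
  -- string all raising rotations vanish.
  obtain ⟨μ, hμ, hμ1⟩ : ∃ μ, h.HasEigenvalue μ ∧ ¬ h.HasEigenvalue (μ + 1) := by
    by_contra! hcon
    have hall : ∀ n : ℕ, h.HasEigenvalue (μ₀ + n) := fun n => by
      induction n with
      | zero => simpa using hμ₀
      | succ n ih => have := hcon _ ih; rwa [add_assoc, ← Nat.cast_succ] at this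
    refine Set.infinite_of_injective_forall_mem (f := fun n : ℕ => μ₀ + (n : ℂ)) ?_ hall hfin
    intro x y hxy
    exact Nat.cast_injective (add_left_cancel hxy)
  obtain ⟨v, hv⟩ := hμ.exists_hasEigenvector
  have hv1 : rot τ a a v.1 = μ • v.1 := congrArg Subtype.val hv.apply_eq_smul
  obtain ⟨c, hc⟩ := exists_eq_C_mul_X_pow_of_rot_eq_zero hτ ha hba hbτ (hU v.2) fun k h1 h2 => by
    by_contra hne
    refine hμ1 (Module.End.hasEigenvalue_of_hasEigenvector
      (x := ⟨rot τ a k v.1, hrot a k _ v.2⟩) ⟨?_, fun e => hne (congrArg Subtype.val e)⟩)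
    rw [Module.End.mem_eigenspace_iff]
    apply Subtype.ext
    change rot τ a a (rot τ a k v.1) = (μ + 1) • rot τ a k v.1
    rw [rot_self_rot hτ ha h1 h2, hv1, map_smul, add_smul, one_smul]
  have hc0 : c ≠ 0 := by
    rintro rfl
    rw [map_zero, zero_mul] at hc
    exact hv.2 (Subtype.ext hc)
  have := U.smul_mem c⁻¹ v.2
  rwa [hc, smul_eq_C_mul, ← mul_assoc, ← C_mul, inv_mul_cancel₀ hc0, C_1, one_mul] at this

/-! ### The contravariant form -/

/-- The product of the factorials of the exponents. -/
def expFactorial (d : σ →₀ ℕ) : ℂ := ∏ w, ((d w).factorial : ℂ)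

theorem expFactorial_ne_zero (d : σ →₀ ℕ) : expFactorial d ≠ 0 :=
  Finset.prod_ne_zero_iff.2 fun _ _ => Nat.cast_ne_zero.2 (Nat.factorial_ne_zero _)

theorem expFactorial_add_single (d : σ →₀ ℕ) (w : σ) :
    expFactorial (d + Finsupp.single w 1) = (d w + 1) * expFactorial d := by
  unfold expFactorial
  rw [← Finset.mul_prod_erase _ _ (Finset.mem_univ w), ← Finset.mul_prod_erase _ _ (Finset.mem_univ w),
    ← mul_assoc]
  congr 1
  · simp [Nat.factorial_succ]
  · refine Finset.prod_congr rfl fun k hk => ?_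
    rw [Finsupp.add_apply, Finsupp.single_eq_of_ne (Finset.ne_of_mem_erase hk), add_zero]

variable (σ) in
/-- The symmetric form for which the multiplication by a variable is adjoint to the derivative. -/
def fischer : MvPolynomial σ ℂ →ₗ[ℂ] MvPolynomial σ ℂ →ₗ[ℂ] ℂ :=
  (basisMonomials σ ℂ).constr ℂ fun d => expFactorial d • lcoeff ℂ d

theorem fischer_monomial_left (d : σ →₀ ℕ) (p : MvPolynomial σ ℂ) :
    fischer σ (monomial d 1) p = expFactorial d * coeff d p := by
  have := (basisMonomials σ ℂ).constr_basis ℂ (fun d => expFactorial d • lcoeff ℂ d) d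
  rw [coe_basisMonomials] at this
  rw [fischer, this]
  rfl

theorem fischer_comm (p q : MvPolynomial σ ℂ) : fischer σ p q = fischer σ q p := by
  have : fischer σ = (fischer σ).flip := by
    refine (basisMonomials σ ℂ).ext fun d => (basisMonomials σ ℂ).ext fun e => ?_
    rw [coe_basisMonomials, LinearMap.flip_apply, fischer_monomial_left, fischer_monomial_left,
      coeff_monomial, coeff_monomial]
    by_cases h : d = e
    · subst h; simp
    · simp [h, Ne.symm h]
  conv_lhs => rw [this]
  rfl

theorem fischer_X_mul (w : σ) (p q : MvPolynomial σ ℂ) :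
    fischer σ (X w * p) q = fischer σ p (pderiv w q) := by
  have : (fischer σ).flip q ∘ₗ LinearMap.mulLeft ℂ (X w) = (fischer σ).flip (pderiv w q) := by
    refine (basisMonomials σ ℂ).ext fun d => ?_
    rw [coe_basisMonomials, LinearMap.comp_apply, LinearMap.mulLeft_apply, LinearMap.flip_apply,
      LinearMap.flip_apply, X, monomial_mul, mul_one, add_comm, fischer_monomial_left,
      fischer_monomial_left, expFactorial_add_single, coeff_pderiv]
    ring
  exact LinearMap.congr_fun this p

theorem fischer_X_mul_right (w : σ) (p q : MvPolynomial σ ℂ) :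
    fischer σ p (X w * q) = fischer σ (pderiv w p) q := by
  rw [fischer_comm, fischer_X_mul, fischer_comm]

/-- Multiplication by a variable and differentiation are adjoint, so orthogonal complements of
rotation-stable spaces are rotation-stable. -/
theorem fischer_rot (i j : σ) (p q : MvPolynomial σ ℂ) :
    fischer σ (rot τ i j p) q = fischer σ p (rot τ j i q) := by
  simp only [rot_apply, map_sub, LinearMap.sub_apply, fischer_X_mul, fischer_X_mul_right]

theorem fischer_X_pow (a : σ) (i : ℕ) : fischer σ (X a ^ i) (X a ^ i) ≠ 0 := by
  rw [X_pow_eq_monomial, fischer_monomial_left, coeff_monomial, if_pos rfl, mul_one]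
  exact expFactorial_ne_zero _

/-- The harmonic polynomials are irreducible under rotations. -/
theorem eq_harmonic_of_rot_mem (hτ : Function.Involutive τ) {a b : σ} (ha : τ a ≠ a)
    (hba : b ≠ a) (hbτ : b ≠ τ a) {i : ℕ} {U : Submodule ℂ (MvPolynomial σ ℂ)}
    (hU : U ≤ harmonic τ i) (hrot : ∀ k l, ∀ p ∈ U, rot τ k l p ∈ U) (hne : U ≠ ⊥) :
    U = harmonic τ i := by
  have hfin : FiniteDimensional ℂ U := Submodule.finiteDimensional_of_le hU
  have hX := X_pow_mem_of_rot_mem hτ ha hba hbτ hU hrot hne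
  let f : MvPolynomial σ ℂ →ₗ[ℂ] Module.Dual ℂ U := (Submodule.subtype U).dualMap ∘ₗ fischer σ
  have hf : ∀ p, f p = 0 ↔ ∀ u ∈ U, fischer σ p u = 0 := fun p =>
    ⟨fun h u hu => LinearMap.congr_fun h ⟨u, hu⟩, fun h => LinearMap.ext fun u => h u.1 u.2⟩
  -- The form is bilinear over `ℂ`, so positivity is not available. Instead, if the orthogonal
  -- complement of `U` were nonzero, it would contain `X a ^ i`, as does `U`, although this vector
  -- is not isotropic.
  have hker : harmonic τ i ⊓ LinearMap.ker f = ⊥ := by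
    by_contra hK
    have := X_pow_mem_of_rot_mem hτ ha hba hbτ inf_le_left (fun k l p hp => ?_) hK
    · exact fischer_X_pow a i ((hf _).1 this.2 _ hX)
    · refine ⟨rot_mem_harmonic hτ hp.1 k l, (hf _).2 fun u hu => ?_⟩
      rw [fischer_rot]
      exact (hf p).1 hp.2 _ (hrot l k u hu)
  have hinj : Function.Injective (f.domRestrict (harmonic τ i)) := by
    rw [← LinearMap.ker_eq_bot, LinearMap.ker_eq_bot']
    rintro ⟨p, hp⟩ h
    have : p ∈ harmonic τ i ⊓ LinearMap.ker f := ⟨hp, h⟩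
    rw [hker] at this
    exact Subtype.ext this
  -- All harmonics of degree `i` now embed into the dual of `U`, which bounds their dimension by
  -- that of `U`.
  refine Submodule.eq_of_le_of_finrank_le hU ?_
  rw [← Subspace.dual_finrank_eq (K := ℂ) (V := U)]
  exact LinearMap.finrank_le_finrank_of_injective hinj

/-! ### Weights of harmonic polynomials -/

variable {A : Type*} [AddCommGroup A] (χ : σ → A)

/-- The exponents of degree `i` and weight `μ`. -/
def weightExps (i : ℕ) (μ : A) : Set (σ →₀ ℕ) := {d | d.degree = i ∧ ∑ w, d w • χ w = μ}

theorem weightExps_finite (i : ℕ) (μ : A) : (weightExps χ i μ).Finite := by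
  refine Set.Finite.subset (Finset.finite_toSet (Finset.univ.finsuppAntidiag i)) fun d hd => ?_
  rw [Finset.mem_coe, Finset.mem_finsuppAntidiag]
  refine ⟨?_, Finset.subset_univ _⟩
  rw [← hd.1, Finsupp.degree_eq_sum]

instance (i : ℕ) (μ : A) : Finite (weightExps χ i μ) := weightExps_finite χ i μ

instance (i : ℕ) (μ : A) : FiniteDimensional ℂ (restrictSupport ℂ (weightExps χ i μ)) :=
  Module.Finite.of_basis (basisRestrictSupport ℂ (weightExps χ i μ))

theorem finrank_restrictSupport (s : Set (σ →₀ ℕ)) :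
    Module.finrank ℂ (restrictSupport ℂ s) = s.ncard := by
  rw [Module.finrank_eq_nat_card_basis (basisRestrictSupport ℂ s), Nat.card_coe_set_eq]

theorem mem_restrictSupport_weightExps {i : ℕ} {μ : A} {p : MvPolynomial σ ℂ} :
    p ∈ restrictSupport ℂ (weightExps χ i μ) ↔
      ∀ d, coeff d p ≠ 0 → d.degree = i ∧ ∑ w, d w • χ w = μ := by
  rw [mem_restrictSupport_iff]
  exact ⟨fun h d hd => h (mem_support_iff.2 hd), fun h d hd => h d (mem_support_iff.1 hd)⟩

theorem sum_add_single_smul (d : σ →₀ ℕ) (k : σ) :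
    ∑ w, (d + Finsupp.single k 1 : σ →₀ ℕ) w • χ w = ∑ w, d w • χ w + χ k := by
  simp only [Finsupp.add_apply, add_smul, Finset.sum_add_distrib]
  congr 1
  rw [Finset.sum_eq_single k]
  · simp
  · intro b _ hb; rw [Finsupp.single_eq_of_ne hb, zero_smul]
  · simp

variable {χ}

theorem pderiv_mem_restrictSupport {i : ℕ} {μ : A} {p : MvPolynomial σ ℂ}
    (hp : p ∈ restrictSupport ℂ (weightExps χ (i + 1) μ)) (k : σ) :
    pderiv k p ∈ restrictSupport ℂ (weightExps χ i (μ - χ k)) := by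
  rw [mem_restrictSupport_weightExps] at hp ⊢
  intro d hd
  rw [coeff_pderiv] at hd
  obtain ⟨h1, h2⟩ := hp _ (left_ne_zero_of_mul hd)
  rw [map_add, Finsupp.degree_single] at h1
  rw [sum_add_single_smul] at h2
  exact ⟨by omega, by rw [← h2, add_sub_cancel_right]⟩

theorem X_mul_mem_restrictSupport {i : ℕ} {μ : A} {p : MvPolynomial σ ℂ}
    (hp : p ∈ restrictSupport ℂ (weightExps χ i μ)) (k : σ) :
    X k * p ∈ restrictSupport ℂ (weightExps χ (i + 1) (μ + χ k)) := by
  rw [mem_restrictSupport_weightExps] at hp ⊢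
  intro d hd
  rw [mul_comm, coeff_mul_X'] at hd
  split_ifs at hd with hk
  · obtain ⟨h1, h2⟩ := hp _ hd
    have h3 : d - Finsupp.single k 1 + Finsupp.single k 1 = d := by
      ext l
      by_cases hl : l = k
      · subst hl; simp; have := Finsupp.mem_support_iff.1 hk; omega
      · simp [Finsupp.single_eq_of_ne hl]
    rw [← h3, sum_add_single_smul, map_add, Finsupp.degree_single, h1, h2]
    exact ⟨rfl, rfl⟩
  · exact absurd rfl hd

theorem laplacian_mem_restrictSupport (hχ : ∀ w, χ (τ w) = - χ w) {i : ℕ} {μ : A}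
    {p : MvPolynomial σ ℂ} (hp : p ∈ restrictSupport ℂ (weightExps χ (i + 2) μ)) :
    laplacian τ p ∈ restrictSupport ℂ (weightExps χ i μ) := by
  rw [laplacian_apply]
  refine Submodule.sum_mem _ fun w _ => ?_
  have := pderiv_mem_restrictSupport (pderiv_mem_restrictSupport hp (τ w)) w
  rwa [hχ, sub_neg_eq_add, add_sub_cancel_right] at this

/-! ### Surjectivity of the Laplacian on weight spaces of polynomials -/

variable (τ) in
/-- The quadratic form as a polynomial. -/
def quadForm : MvPolynomial σ ℂ := ∑ w, X w * X (τ w)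

theorem quadForm_mul_mem_restrictSupport (hχ : ∀ w, χ (τ w) = - χ w) {i : ℕ} {μ : A}
    {p : MvPolynomial σ ℂ} (hp : p ∈ restrictSupport ℂ (weightExps χ i μ)) :
    quadForm τ * p ∈ restrictSupport ℂ (weightExps χ (i + 2) μ) := by
  rw [quadForm, Finset.sum_mul]
  refine Submodule.sum_mem _ fun w _ => ?_
  have := X_mul_mem_restrictSupport (X_mul_mem_restrictSupport hp (τ w)) w
  rwa [hχ, neg_add_cancel_right, ← mul_assoc] at this

theorem fischer_quadForm_mul (p q : MvPolynomial σ ℂ) :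
    fischer σ (quadForm τ * p) q = fischer σ p (laplacian τ q) := by
  simp only [quadForm, Finset.sum_mul, map_sum, LinearMap.sum_apply, laplacian_apply, mul_assoc,
    fischer_X_mul]
  refine Finset.sum_congr rfl fun w _ => ?_
  rw [pderiv_pderiv_comm]

theorem quadForm_ne_zero [Nonempty σ] : quadForm τ ≠ 0 := fun h => by
  have := congrArg (eval fun _ => (1 : ℂ)) h
  simp [quadForm] at this

/-- The Laplacian is adjoint to multiplication by the quadratic form. That form is a nonzero
polynomial of weight zero, so multiplication by it is injective and preserves weights; dually the
Laplacian is surjective. -/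
theorem range_laplacian [Nonempty σ] (hχ : ∀ w, χ (τ w) = - χ w) (i : ℕ) (μ : A) :
    (restrictSupport ℂ (weightExps χ (i + 2) μ)).map (laplacian τ) =
      restrictSupport ℂ (weightExps χ i μ) := by
  set R := (restrictSupport ℂ (weightExps χ (i + 2) μ)).map (laplacian τ) with hR
  have hle : R ≤ restrictSupport ℂ (weightExps χ i μ) := by
    rintro _ ⟨p, hp, rfl⟩
    exact laplacian_mem_restrictSupport hχ hp
  have hfin : FiniteDimensional ℂ R := Submodule.finiteDimensional_of_le hle
  refine Submodule.eq_of_le_of_finrank_le hle ?_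
  -- Pairing with the image embeds the target into the dual of the image: a kernel element,
  -- multiplied by the quadratic form, has all coefficients zero.
  let f : MvPolynomial σ ℂ →ₗ[ℂ] Module.Dual ℂ R := (Submodule.subtype R).dualMap ∘ₗ fischer σ
  have hinj : Function.Injective (f.domRestrict (restrictSupport ℂ (weightExps χ i μ))) := by
    rw [← LinearMap.ker_eq_bot, LinearMap.ker_eq_bot']
    rintro ⟨p, hp⟩ h
    have h1 : ∀ d ∈ weightExps χ (i + 2) μ, coeff d (quadForm τ * p) = 0 := by
      intro d hd
      have h2 : fischer σ p (laplacian τ (monomial d 1)) = 0 :=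
        LinearMap.congr_fun h ⟨laplacian τ (monomial d 1), Submodule.mem_map_of_mem
          ((monomial_mem_restrictSupport ℂ).2 (Or.inl hd))⟩
      rw [← fischer_quadForm_mul, fischer_comm, fischer_monomial_left] at h2
      exact (mul_eq_zero.1 h2).resolve_left (expFactorial_ne_zero d)
    have h2 : quadForm τ * p = 0 := by
      ext d
      rw [coeff_zero]
      by_contra hd
      exact hd (h1 d ((mem_restrictSupport_weightExps χ).1
        (quadForm_mul_mem_restrictSupport hχ hp) d hd))
    exact Subtype.ext ((mul_eq_zero.1 h2).resolve_left quadForm_ne_zero)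
  rw [← Subspace.dual_finrank_eq (K := ℂ) (V := R)]
  exact LinearMap.finrank_le_finrank_of_injective hinj

/-- Rank–nullity for the surjective Laplacian. This is `H_{i+2} = S^{i+2} - S^i`, weight by weight.
-/
theorem finrank_harmonic_weight_add [Nonempty σ] (hχ : ∀ w, χ (τ w) = - χ w) (i : ℕ) (μ : A) :
    Module.finrank ℂ (restrictSupport ℂ (weightExps χ (i + 2) μ) ⊓ LinearMap.ker (laplacian τ) :
      Submodule ℂ (MvPolynomial σ ℂ)) + (weightExps χ i μ).ncard =
      (weightExps χ (i + 2) μ).ncard := by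
  rw [← finrank_restrictSupport, ← finrank_restrictSupport, ← range_laplacian (τ := τ) hχ i μ]
  have h := LinearMap.finrank_range_add_finrank_ker
    ((laplacian τ).domRestrict (restrictSupport ℂ (weightExps χ (i + 2) μ)))
  rw [LinearMap.range_domRestrict, LinearMap.ker_domRestrict] at h
  rw [← h, add_comm]
  congr 1
  have e := (Submodule.equivSubtypeMap (restrictSupport ℂ (weightExps χ (i + 2) μ))
    ((LinearMap.ker (laplacian τ)).submoduleOf (restrictSupport ℂ (weightExps χ (i + 2) μ)))).finrank_eq
  rw [Submodule.submoduleOf, Submodule.map_comap_subtype] at e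
  exact e.symm

theorem laplacian_eq_zero_of_degree_le_one {i : ℕ} (hi : i ≤ 1) {p : MvPolynomial σ ℂ}
    (hp : p.IsHomogeneous i) : laplacian τ p = 0 := by
  rw [laplacian_apply]
  refine Finset.sum_eq_zero fun w _ => ?_
  have h1 : (pderiv (τ w) p).IsHomogeneous 0 := by
    have := hp.pderiv (i := τ w)
    rwa [Nat.sub_eq_zero_of_le hi] at this
  rw [totalDegree_eq_zero_iff_eq_C.1 (Nat.le_zero.1 h1.totalDegree_le), pderiv_C]

end Harmonic

end Osp

end

noncomputable section

namespace Osp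

variable {m r : ℕ}

/-! ### Harmonic polynomials in the Fock space -/

theorem evenDual_involutive : Function.Involutive (evenDual : EvenIdx m r → EvenIdx m r) :=
  evenDual_evenDual

/-- The polynomials as the functions supported at the label with one occupied state. -/
def embed (s : ℤ) : MvPolynomial (EvenIdx m r) ℂ →ₗ[ℂ] Fock m r :=
  LinearMap.single ℂ (fun _ => MvPolynomial (EvenIdx m r) ℂ) ({Sum.inr 0}, Pi.single 0 s)

theorem embed_apply (s : ℤ) (p : MvPolynomial (EvenIdx m r) ℂ) (l) :
    embed s p l = if l = ({Sum.inr 0}, Pi.single 0 s) then p else 0 := by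
  rw [embed, LinearMap.coe_single, Pi.single_apply]

theorem embed_injective (s : ℤ) : Function.Injective (embed (m := m) (r := r) s) :=
  Pi.single_injective (M := fun _ => MvPolynomial (EvenIdx m r) ℂ) _

theorem annihilate_inl_zero_embed (s : ℤ) (w : EvenIdx m r) (p) :
    annihilate (Sum.inl w, 0) (embed s p) = embed s (MvPolynomial.pderiv w p) := by
  ext1 l
  rw [annihilate_inl_zero, boseAnnihilate_inl_apply, embed_apply, embed_apply]
  split_ifs <;> simp

theorem annihilate_inl_one_embed (s : ℤ) (w : EvenIdx m r) (p) :
    annihilate (Sum.inl w, 1) (embed s p) = 0 := by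
  ext1 l
  rw [annihilate_inl_one, fermiAnnihilate_apply, embed_apply]
  split_ifs with h1 h
  · rfl
  · exfalso
    have : (Sum.inl w : Idx m r) ∈ ({Sum.inr 0} : Finset (Idx m r)) := by
      rw [← (Prod.mk.inj h).1]; simp
    simp at this
  · simp

theorem annihilate_inr_one_embed (s : ℤ) (k : ZMod 2) (p) :
    annihilate ((Sum.inr 1 : Idx m r), k) (embed s p) = 0 := by
  rcases zmod_two_cases k with rfl | rfl
  · ext1 l
    rw [annihilate_inr_zero, fermiAnnihilate_apply, embed_apply]
    split_ifs with h1 h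
    · rfl
    · exfalso
      have : (Sum.inr 1 : Idx m r) ∈ ({Sum.inr 0} : Finset (Idx m r)) := by
        rw [← (Prod.mk.inj h).1]; simp
      simp at this
    · simp
  · ext1 l
    rw [annihilate_inr_one, boseAnnihilate_inr_apply, embed_apply]
    split_ifs with h
    · have := congrFun (congrArg Prod.snd h) 1
      simp only [Pi.add_apply, Pi.single_eq_same, Pi.single_eq_of_ne (one_ne_zero : (1 : Fin 2) ≠ 0)]
        at this
      rw [this]; simp
    · simp

theorem create_inl_zero_embed (s : ℤ) (w : EvenIdx m r) (p) :
    create (Sum.inl w, 0) (embed s p) = embed s (MvPolynomial.X w * p) := by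
  ext1 l
  rw [create_inl_zero, boseCreate_inl_apply, embed_apply, embed_apply]
  split_ifs <;> simp

theorem create_inr_zero_embed (s : ℤ) (p) :
    create ((Sum.inr 0 : Idx m r), 0) (embed s p) = 0 := by
  ext1 l
  rw [create_inr_zero, fermiCreate_apply, embed_apply]
  split_ifs with h1 h
  · exfalso
    have : (Sum.inr 0 : Idx m r) ∉ l.1.erase (Sum.inr 0) := Finset.notMem_erase _ _
    rw [(Prod.mk.inj h).1] at this
    simp at this
  · simp
  · rfl

theorem fockAct_single_inl_inl_embed (s : ℤ) (w w' : EvenIdx m r) (p) :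
    fockAct (Matrix.single (Sum.inl w) (Sum.inl w') 1) (embed s p) =
      embed s (MvPolynomial.X w * MvPolynomial.pderiv w' p) := by
  rw [fockAct_single, annihilate_inl_zero_embed, annihilate_inl_one_embed, create_inl_zero_embed,
    map_zero, add_zero]

theorem fockAct_single_inr_one_embed (s : ℤ) (i : Idx m r) (p) :
    fockAct (Matrix.single i (Sum.inr 1) 1) (embed s p) = 0 := by
  rw [fockAct_single, annihilate_inr_one_embed, annihilate_inr_one_embed, map_zero, map_zero,
    add_zero]

theorem fockAct_single_inr_zero_inl_embed (s : ℤ) (w : EvenIdx m r) (p) :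
    fockAct (Matrix.single (Sum.inr 0) (Sum.inl w) 1) (embed s p) = 0 := by
  rw [fockAct_single, annihilate_inl_zero_embed, annihilate_inl_one_embed, create_inr_zero_embed,
    map_zero, add_zero]

theorem fockAct_single_inr_zero_inr_zero_embed (s : ℤ) (p : MvPolynomial (EvenIdx m r) ℂ) :
    fockAct (Matrix.single (Sum.inr 0) (Sum.inr 0) 1) (embed s p) =
      (1 + (s : ℂ)) • embed (m := m) (r := r) s p := by
  rw [fockAct_single, add_smul, one_smul]
  congr 1
  · ext1 l
    rw [create_inr_zero, annihilate_inr_zero, fermiCreate_apply]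
    split_ifs with h
    · rw [fermiAnnihilate_apply, if_neg (Finset.notMem_erase _ _), smul_smul, fermiSign_erase _ h,
        orderSign_self, one_mul, fermiSign_mul_self, one_smul, Finset.insert_erase h]
    · rw [embed_apply, if_neg]
      rintro rfl
      simp at h
  · ext1 l
    rw [create_inr_one, annihilate_inr_one, boseCreate_inr_apply, boseAnnihilate_inr_apply,
      Pi.smul_apply, sub_add_cancel]
    change ((((l.2 - Pi.single 0 1 : Fin 2 → ℤ) 0) + 1 : ℤ) : ℂ) • embed s p l = _
    rw [Pi.sub_apply, Pi.single_eq_same, sub_add_cancel, embed_apply]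
    split_ifs with h
    · rw [h]; simp
    · simp

theorem fockAct_eq_sum_single (X : Gl m r) (f : Fock m r) :
    fockAct X f = ∑ i, ∑ j, X i j • fockAct (Matrix.single i j 1) f := by
  rw [fockAct_apply]
  simp only [fockAct_single]

/-- An element of positive degree has entries only in the row of the first odd vector or in the
column of the second. The column entries annihilate an empty fermionic state or differentiate a
variable of exponent zero. The remaining row entries would either fill the occupied state again or
empty an unoccupied one. -/
theorem fockAct_nilradical_embed {X : Gl m r} (hX : X ∈ nilradical m r) (s : ℤ) (p) :
    fockAct X (embed s p) = 0 := by
  have key : ∀ k : ℤ, 0 < k → ∀ X ∈ gradedPiece m r k, fockAct X (embed s p) = 0 := by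
    intro k hk X hX
    rw [fockAct_eq_sum_single]
    refine Finset.sum_eq_zero fun i _ => Finset.sum_eq_zero fun j _ => ?_
    by_cases hij : deltaDeg i - deltaDeg j = k
    · rcases j with j | j
      · rcases i with i | i
        · simp at hij; omega
        · fin_cases i
          · simp [fockAct_single_inr_zero_inl_embed]
          · simp at hij; omega
      · fin_cases j
        · rcases i with i | i
          · simp at hij; omega
          · fin_cases i <;> simp at hij <;> omega
        · simp [fockAct_single_inr_one_embed]
    · rw [(mem_gradedPiece_iff.1 hX).2 i j hij, zero_smul]
  obtain ⟨y, hy, z, hz, rfl⟩ := Submodule.mem_sup.1 hX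
  rw [map_add, LinearMap.add_apply, key 1 one_pos y hy, key 2 two_pos z hz, add_zero]

theorem fockAct_rootVec_inl_embed (s : ℤ) (w w' : EvenIdx m r) (p) :
    fockAct (rootVec (Sum.inl w) (Sum.inl w')) (embed s p) = embed s (rot evenDual w w' p) := by
  rw [rootVec, adjSign_inl_inl, one_smul, map_sub, LinearMap.sub_apply, dual_inl, dual_inl,
    fockAct_single_inl_inl_embed, fockAct_single_inl_inl_embed, ← map_sub, rot_apply]

theorem fockAct_cartan_embed (H : cartan m r) (s : ℤ) (p : MvPolynomial (EvenIdx m r) ℂ) :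
    fockAct H.1 (embed s p) = embed (m := m) (r := r) s
      (∑ w, (entry (Sum.inl w) H) • (MvPolynomial.X w * MvPolynomial.pderiv w p) +
        ((1 + (s : ℂ)) * δ H) • p) := by
  rw [fockAct_eq_sum_single, Finset.sum_congr rfl fun i _ => Finset.sum_eq_single i
    (fun j _ hj => by rw [H.2.2 hj.symm, zero_smul]) (by simp), Fintype.sum_sum_type, map_add,
    map_sum, Fin.sum_univ_two]
  congr 1
  · refine Finset.sum_congr rfl fun w _ => ?_
    rw [fockAct_single_inl_inl_embed, map_smul]; rfl
  · rw [fockAct_single_inr_one_embed, fockAct_single_inr_zero_inr_zero_embed, smul_zero, add_zero,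
      smul_smul, map_smul, mul_comm]; rfl

theorem coeff_X_mul_pderiv {σ : Type*} (w : σ) (p : MvPolynomial σ ℂ) (d : σ →₀ ℕ) :
    MvPolynomial.coeff d (MvPolynomial.X w * MvPolynomial.pderiv w p) =
      d w * MvPolynomial.coeff d p := by
  classical
  rw [mul_comm, MvPolynomial.coeff_mul_X']
  split_ifs with h
  · rw [MvPolynomial.coeff_pderiv]
    have h1 : d - Finsupp.single w 1 + Finsupp.single w 1 = d := by
      ext l
      by_cases hl : l = w
      · subst hl; simp; have := Finsupp.mem_support_iff.1 h; omega
      · simp [Finsupp.single_eq_of_ne hl]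
    have h2 : (((d - Finsupp.single w 1 : σ →₀ ℕ) w : ℕ) : ℂ) + 1 = d w := by
      have := Finsupp.mem_support_iff.1 h
      rw [Finsupp.tsub_apply, Finsupp.single_eq_same, Nat.cast_sub (by omega)]
      simp
    rw [h1, h2, mul_comm]
  · rw [Finsupp.notMem_support_iff.1 h, Nat.cast_zero, zero_mul]

/-- The vectors of given weight among the embedded polynomials. -/
theorem forall_fockAct_cartan_embed_iff {i : ℕ} {s : ℤ} (hs : 1 + s = -i) (μ : Weight m r)
    {p : MvPolynomial (EvenIdx m r) ℂ} (hp : p.IsHomogeneous i) :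
    (∀ H : cartan m r, fockAct H.1 (embed s p) = μ H • embed (m := m) (r := r) s p) ↔
      p ∈ MvPolynomial.restrictSupport ℂ
        (weightExps (fun w => (entry (Sum.inl w) : Weight m r)) i (μ + (i : ℂ) • δ)) := by
  rw [mem_restrictSupport_weightExps]
  -- The `δ`-coefficient has two sources: `1` from the occupied fermionic state and `s` from the
  -- bosonic exponent.
  have hs' : (1 + (s : ℂ)) = -(i : ℂ) := by exact_mod_cast congrArg (Int.cast (R := ℂ)) hs
  have key : ∀ (H : cartan m r) (d : EvenIdx m r →₀ ℕ),
      MvPolynomial.coeff d (∑ w, (entry (Sum.inl w) H) •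
        (MvPolynomial.X w * MvPolynomial.pderiv w p) + ((1 + (s : ℂ)) * δ H) • p) =
      ((∑ w, d w • (entry (Sum.inl w) : Weight m r)) H - i * δ H) * MvPolynomial.coeff d p := by
    intro H d
    rw [MvPolynomial.coeff_add, MvPolynomial.coeff_sum, MvPolynomial.coeff_smul, hs', sub_mul,
      LinearMap.sum_apply, Finset.sum_mul, sub_eq_add_neg, smul_eq_mul]
    congr 1
    · refine Finset.sum_congr rfl fun w _ => ?_
      rw [MvPolynomial.coeff_smul, coeff_X_mul_pderiv, LinearMap.smul_apply, nsmul_eq_mul,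
        smul_eq_mul]
      ring
    · ring
  constructor
  · intro h d hd
    refine ⟨by_contra fun hdeg => hd (hp.coeff_eq_zero hdeg), LinearMap.ext fun H => ?_⟩
    have h1 := h H
    rw [fockAct_cartan_embed, ← map_smul] at h1
    have h2 := congrArg (MvPolynomial.coeff d) (embed_injective s h1)
    rw [key, MvPolynomial.coeff_smul, smul_eq_mul] at h2
    have h3 := mul_right_cancel₀ hd h2
    rw [LinearMap.add_apply, LinearMap.smul_apply, smul_eq_mul]
    linear_combination h3
  · intro h H
    rw [fockAct_cartan_embed, ← map_smul]
    congr 1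
    ext d
    rw [key, MvPolynomial.coeff_smul, smul_eq_mul]
    by_cases hd : MvPolynomial.coeff d p = 0
    · simp [hd]
    · rw [(h d hd).2, LinearMap.add_apply, LinearMap.smul_apply, smul_eq_mul]
      ring

/-- Subspaces of polynomials stable under rotations are stable under the Levi subalgebra. -/
theorem fockAct_levi_mem_map_embed {T : Submodule ℂ (MvPolynomial (EvenIdx m r) ℂ)}
    (hT : ∀ k l, ∀ p ∈ T, rot evenDual k l p ∈ T) (s : ℤ) (x : (levi m r).carrier) {p}
    (hp : p ∈ T) : fockAct x.1 (embed s p) ∈ T.map (embed s) := by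
  have h00 : fockAct (rootVec (Sum.inr 0) (Sum.inr 0)) (embed s p) ∈ T.map (embed s) := by
    rw [rootVec, map_sub, LinearMap.sub_apply, map_smul, LinearMap.smul_apply, dual_inr_zero,
      fockAct_single_inr_one_embed, smul_zero, sub_zero, fockAct_single_inr_zero_inr_zero_embed]
    exact Submodule.smul_mem _ _ (Submodule.mem_map_of_mem hp)
  have h11 : fockAct (rootVec (Sum.inr 1) (Sum.inr 1)) (embed s p) ∈ T.map (embed s) := by
    rw [rootVec, map_sub, LinearMap.sub_apply, map_smul, LinearMap.smul_apply, dual_inr_one,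
      fockAct_single_inr_one_embed, zero_sub, fockAct_single_inr_zero_inr_zero_embed]
    exact neg_mem (Submodule.smul_mem _ _ (Submodule.smul_mem _ _ (Submodule.mem_map_of_mem hp)))
  rw [osp_eq_sum_rootVec x.2.1]
  simp only [map_sum, LinearMap.sum_apply, map_smul, LinearMap.smul_apply]
  refine Submodule.sum_mem _ fun i _ => Submodule.sum_mem _ fun j _ => ?_
  by_cases hij : deltaDeg i = deltaDeg j
  · refine Submodule.smul_mem _ _ ?_
    rcases i with i | i <;> rcases j with j | j
    · rw [fockAct_rootVec_inl_embed]
      exact Submodule.mem_map_of_mem (hT i j p hp)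
    · fin_cases j <;> simp at hij
    · fin_cases i <;> simp at hij
    · fin_cases i <;> fin_cases j <;> simp at hij
      · exact h00
      · exact h11
  · rw [(mem_levi_iff.1 x.2).2 i j hij, zero_div, zero_smul]
    exact zero_mem _

/-! ### The irreducible modules of the Levi subalgebra -/

/-- The inclusion of the Levi subalgebra. -/
def leviInclusion (m r : ℕ) : (levi m r).carrier →ₗ[ℂ] (osp m r).carrier :=
  Submodule.inclusion levi_le_osp

/-- The map of enveloping algebras induced by the inclusion of the Levi subalgebra. -/
def leviEnv (m r : ℕ) : Env (levi m r) →ₐ[ℂ] Env (osp m r) :=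
  Env.lift (env (osp m r) ∘ₗ leviInclusion m r) fun a b x y hx hy => by
    rw [sub_eq_iff_eq_add']
    exact env_mul_env (leviInclusion m r x) (leviInclusion m r y) hx hy

theorem leviEnv_env (x : (levi m r).carrier) :
    leviEnv m r (env _ x) = env _ (leviInclusion m r x) := Env.lift_env _ _ _

instance : Module (Env (levi m r)) (Fock m r) := Module.compHom _ (leviEnv m r).toRingHom

theorem levi_smul_fock (u : Env (levi m r)) (f : Fock m r) : u • f = leviEnv m r u • f := rfl

theorem env_levi_smul_fock (x : (levi m r).carrier) (f : Fock m r) :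
    env _ x • f = fockAct x.1 f := by
  rw [levi_smul_fock, leviEnv_env, env_smul_fock]; rfl

instance : IsScalarTower ℂ (Env (levi m r)) (Fock m r) :=
  ⟨fun c u f => by rw [levi_smul_fock, levi_smul_fock, map_smul, smul_assoc]⟩

theorem mem_rootSpace_apply {α : Weight m r} {X : Gl m r} (hX : X ∈ rootSpace α) {i j : Idx m r}
    (hij : X i j ≠ 0) : α = entry i - entry j := by
  ext H
  have := congrFun (congrFun (hX.2 H) i) j
  rw [superBracket_diag_apply H.2.2, Matrix.smul_apply, smul_eq_mul] at this
  exact (mul_right_cancel₀ hij this).symm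

theorem evenPosRoots_heightElement {α : Weight m r} (h : α ∈ evenPosRoots m r) :
    ∃ k : ℤ, 0 < k ∧ α (heightElement m r) = k := by
  have he : ∀ i : Fin m, (ε i : Weight m r) (heightElement m r) = ((m : ℤ) - i : ℤ) := fun i =>
    heightElement_apply _
  have hd : (δ : Weight m r) (heightElement m r) = ((m : ℤ) + 1 : ℤ) := heightElement_apply _
  rcases h with (⟨j, k, hjk, rfl | rfl⟩ | rfl) | ⟨-, i, rfl⟩
  · refine ⟨(m - j) + (m - k), by omega, ?_⟩
    rw [LinearMap.add_apply, he, he]; push_cast; ring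
  · refine ⟨(m - j) - (m - k), by omega, ?_⟩
    rw [LinearMap.sub_apply, he, he]; push_cast; ring
  · refine ⟨2 * (m + 1), by omega, ?_⟩
    rw [LinearMap.smul_apply, hd]; push_cast; rfl
  · exact ⟨m - i, by omega, he i⟩

/-! ### The Levi module of highest weight `iε₁ - iδ` as the harmonic polynomials of degree `i` -/

section LeviModule

variable (hm : 0 < m)

/-- The index of the first basis vector. -/
def firstIdx : EvenIdx m r := Sum.inl (Sum.inl ⟨0, hm⟩)

theorem evenDual_firstIdx_ne : evenDual (firstIdx hm : EvenIdx m r) ≠ firstIdx hm := by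
  simp [firstIdx, evenDual]

theorem exists_ne_firstIdx (hn : 3 ≤ 2 * m + r) : ∃ b : EvenIdx m r,
    b ≠ firstIdx hm ∧ b ≠ evenDual (firstIdx hm) := by
  by_cases hm2 : 2 ≤ m
  · exact ⟨Sum.inl (Sum.inl ⟨1, hm2⟩), by simp [firstIdx], by simp [firstIdx, evenDual]⟩
  · exact ⟨Sum.inr ⟨0, by omega⟩, by simp [firstIdx], by simp [firstIdx, evenDual]⟩

theorem height_le_firstIdx (w : EvenIdx m r) :
    height (Sum.inl w : Idx m r) ≤ height (Sum.inl (firstIdx hm) : Idx m r) := by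
  rcases w with (w | w) | w <;> simp [height, firstIdx]
  have := w.2
  omega

/-- The weight `i ε_1 - i δ`. -/
def nuWeight (i : ℕ) : Weight m r := (i : ℂ) • ε ⟨0, hm⟩ - (i : ℂ) • δ

/-- The highest weight vector of weight `i ε_1 - i δ`. -/
def highestVec (i : ℕ) : Fock m r := embed (-i - 1) (MvPolynomial.X (firstIdx hm) ^ i)

theorem X_pow_mem_harmonic (i : ℕ) : (MvPolynomial.X (firstIdx hm) ^ i :
    MvPolynomial (EvenIdx m r) ℂ) ∈ harmonic evenDual i := by
  refine mem_harmonic.2 ⟨MvPolynomial.isHomogeneous_X_pow _ _, ?_⟩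
  rw [laplacian_apply]
  refine Finset.sum_eq_zero fun w _ => ?_
  by_cases h : firstIdx hm = evenDual w
  · rw [pderiv_pderiv_comm, MvPolynomial.pderiv_pow (i := w), MvPolynomial.pderiv_X_of_ne, mul_zero,
      map_zero]
    rintro rfl
    exact evenDual_firstIdx_ne hm h.symm
  · rw [MvPolynomial.pderiv_pow, MvPolynomial.pderiv_X_of_ne h, mul_zero, map_zero]

/-- The first index has the largest height and its dual the smallest. Hence a raising rotation
differentiates in neither of its terms with respect to the first variable. -/
theorem rot_X_pow_eq_zero (i : ℕ) {w w' : EvenIdx m r}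
    (h : height (Sum.inl w' : Idx m r) < height (Sum.inl w : Idx m r)) :
    rot evenDual w w' (MvPolynomial.X (firstIdx hm) ^ i) = 0 := by
  have h1 : firstIdx hm ≠ w' := by
    rintro rfl
    exact absurd (height_le_firstIdx hm w) h.not_ge
  have h2 : firstIdx hm ≠ evenDual w := by
    intro e
    have e1 : height (Sum.inl w : Idx m r) = - height (Sum.inl (firstIdx hm) : Idx m r) := by
      rw [e, ← dual_inl, height_dual, neg_neg]
    have e2 := height_le_firstIdx hm (evenDual w')
    rw [← dual_inl, height_dual] at e2
    omega
  rw [rot_apply, MvPolynomial.pderiv_pow, MvPolynomial.pderiv_pow, MvPolynomial.pderiv_X_of_ne h1,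
    MvPolynomial.pderiv_X_of_ne h2]
  simp

theorem fockAct_rootSpace_highestVec {α : Weight m r} (hα : α ∈ evenPosRoots m r) (i : ℕ)
    (x : (levi m r).carrier) (hx : x.1 ∈ rootSpace α) : fockAct x.1 (highestVec hm i) = 0 := by
  obtain ⟨k, hk, hαk⟩ := evenPosRoots_heightElement hα
  rw [osp_eq_sum_rootVec x.2.1]
  simp only [map_sum, LinearMap.sum_apply, map_smul, LinearMap.smul_apply]
  refine Finset.sum_eq_zero fun a _ => Finset.sum_eq_zero fun b _ => ?_
  by_cases hab : x.1 a b = 0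
  · rw [hab, zero_div, zero_smul]
  have hdeg : deltaDeg a = deltaDeg b := by
    by_contra h; exact hab ((mem_levi_iff.1 x.2).2 a b h)
  have hht : height b < height a := by
    have h1 := mem_rootSpace_apply hx hab
    rw [h1, LinearMap.sub_apply] at hαk
    change (heightElement m r).1 a a - (heightElement m r).1 b b = _ at hαk
    rw [heightElement_apply, heightElement_apply, ← Int.cast_sub, Int.cast_inj] at hαk
    omega
  rcases a with a | a <;> rcases b with b | b
  · rw [highestVec, fockAct_rootVec_inl_embed, rot_X_pow_eq_zero hm i hht, map_zero, smul_zero]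
  · fin_cases b <;> simp at hdeg
  · fin_cases a <;> simp at hdeg
  · fin_cases a <;> fin_cases b <;> simp at hdeg hht

theorem fockAct_cartan_highestVec (i : ℕ) (H : cartan m r) :
    fockAct H.1 (highestVec hm i) = nuWeight hm i H • highestVec hm i := by
  refine (forall_fockAct_cartan_embed_iff (s := -i - 1) (by ring) (nuWeight hm i)
    (MvPolynomial.isHomogeneous_X_pow (R := ℂ) (firstIdx hm) i)).2 ?_ H
  rw [MvPolynomial.X_pow_eq_monomial, MvPolynomial.monomial_mem_restrictSupport]
  refine Or.inl ⟨Finsupp.degree_single _ _, ?_⟩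
  rw [Finset.sum_eq_single (firstIdx hm)]
  · rw [Finsupp.single_eq_same, nuWeight, sub_add_cancel, Nat.cast_smul_eq_nsmul]; rfl
  · intro b _ hb; rw [Finsupp.single_eq_of_ne hb, zero_smul]
  · simp

/-- The orbit map of the highest weight vector. -/
def orbitMap (i : ℕ) : Env (levi m r) →ₗ[Env (levi m r)] Fock m r :=
  LinearMap.toSpanSingleton _ _ (highestVec hm i)

theorem orbitMap_apply (i : ℕ) (u : Env (levi m r)) :
    orbitMap hm i u = u • highestVec (r := r) hm i := rfl

theorem orbitMap_mem (i : ℕ) (u : Env (levi m r)) :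
    orbitMap hm i u ∈ (harmonic evenDual i).map (embed (m := m) (r := r) (-i - 1)) := by
  refine smul_mem_of_env_smul_mem ?_ u _ (Submodule.mem_map_of_mem (X_pow_mem_harmonic hm i))
  rintro x _ ⟨p, hp, rfl⟩
  rw [env_levi_smul_fock]
  exact fockAct_levi_mem_map_embed (fun k l p hp => rot_mem_harmonic evenDual_involutive hp k l)
    _ x hp

variable (hn : 3 ≤ 2 * m + r)
include hn

/-- Those harmonic polynomials whose embeddings lie in the image of `J` form a nonzero
rotation-stable subspace, so irreducibility of the harmonics makes it everything. -/
theorem map_orbitMap_eq (i : ℕ) {J : Submodule (Env (levi m r)) (Env (levi m r))}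
    (hJ : ¬ J ≤ LinearMap.ker (orbitMap hm i)) {p : MvPolynomial (EvenIdx m r) ℂ}
    (hp : p ∈ harmonic evenDual i) : ∃ u ∈ J, orbitMap hm i u = embed (-i - 1) p := by
  let R : Submodule ℂ (Fock m r) := (J.map (orbitMap hm i)).restrictScalars ℂ
  let U : Submodule ℂ (MvPolynomial (EvenIdx m r) ℂ) :=
    harmonic evenDual i ⊓ R.comap (embed (-i - 1))
  obtain ⟨b, hb1, hb2⟩ := exists_ne_firstIdx (r := r) hm hn
  have hU : U = harmonic evenDual i := by
    refine eq_harmonic_of_rot_mem evenDual_involutive (evenDual_firstIdx_ne hm) hb1 hb2 inf_le_left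
      ?_ ?_
    · rintro k l p ⟨hp, hp'⟩
      refine ⟨rot_mem_harmonic evenDual_involutive hp k l, ?_⟩
      rw [SetLike.mem_coe, Submodule.mem_comap, ← fockAct_rootVec_inl_embed,
        ← env_levi_smul_fock ⟨rootVec (Sum.inl k) (Sum.inl l), rootVec_mem_levi (by simp)⟩]
      exact (J.map (orbitMap hm i)).smul_mem _ hp'
    · obtain ⟨u, huJ, hu⟩ := SetLike.not_le_iff_exists.1 hJ
      obtain ⟨q, hq, hqu⟩ := orbitMap_mem hm i u
      intro hbot
      have hqU : q ∈ U := ⟨hq, by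
        rw [SetLike.mem_coe, Submodule.mem_comap, hqu]
        exact Submodule.mem_map_of_mem huJ⟩
      rw [hbot, Submodule.mem_bot] at hqU
      rw [hqU, map_zero] at hqu
      exact hu hqu.symm
  have hpU : p ∈ U := by rw [hU]; exact hp
  exact hpU.2

theorem isCoatom_ker_orbitMap (i : ℕ) : IsCoatom (LinearMap.ker (orbitMap (r := r) hm i)) := by
  refine ⟨fun h => ?_, fun J hJ => ?_⟩
  · have h1 : (1 : Env (levi m r)) ∈ LinearMap.ker (orbitMap (r := r) hm i) := by rw [h]; trivial
    rw [LinearMap.mem_ker, orbitMap_apply, one_smul, highestVec,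
      map_eq_zero_iff _ (embed_injective _)] at h1
    exact pow_ne_zero _ (MvPolynomial.X_ne_zero _) h1
  · obtain ⟨u, hu, hu'⟩ := map_orbitMap_eq hm hn i hJ.not_ge (X_pow_mem_harmonic hm i)
    rw [Ideal.eq_top_iff_one]
    -- Some `u ∈ J` fixes the highest weight vector, so `1 - u` is in its annihilator, which `J`
    -- contains.
    have h1 : (1 - u : Env (levi m r)) ∈ J := hJ.le (by
      rw [LinearMap.mem_ker, map_sub, hu', orbitMap_apply, one_smul]
      exact sub_self _)
    simpa using J.add_mem h1 hu

variable (hr : r ≤ 1)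
include hr

/-- The annihilator of the highest weight vector in the Fock space is a maximal left ideal
containing the Verma relations. Hence the abstract irreducible module is the concrete orbit. -/
theorem maxIdeal_levi (i : ℕ) :
    maxIdeal (levi m r) (evenPosRoots m r \ {(2 : ℂ) • δ}) (nuWeight hm i) =
      LinearMap.ker (orbitMap hm i) := by
  refine maxIdeal_eq_of_isCoatom ⟨(heightElement m r).1, cartan_mem_levi _⟩
    (heightElement m r).2 (span_triangularSet_levi hr) ?_ (isCoatom_ker_orbitMap hm hn i)
  refine Submodule.span_le.2 ?_
  rintro _ (⟨x, ⟨α, hα, hx⟩, rfl⟩ | ⟨x, H, hx, rfl⟩)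
  · change orbitMap hm i _ = 0
    rw [orbitMap_apply, env_levi_smul_fock, fockAct_rootSpace_highestVec hm hα.1 i x hx]
  · change orbitMap hm i _ = 0
    rw [orbitMap_apply, sub_smul, env_levi_smul_fock, hx, fockAct_cartan_highestVec,
      algebraMap_smul, sub_self]

theorem isSimpleModule_leviL (i : ℕ) :
    IsSimpleModule (Env (levi m r)) (LeviL (nuWeight (r := r) hm i)) := by
  rw [isSimpleModule_iff_isCoatom, maxIdeal_levi hm hn hr]
  exact isCoatom_ker_orbitMap hm hn i

/-- The embedding of the irreducible module of the Levi subalgebra into the Fock space. -/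
def leviFock (i : ℕ) : LeviL (nuWeight (r := r) hm i) →ₗ[Env (levi m r)] Fock m r :=
  Submodule.liftQ _ (orbitMap hm i) (maxIdeal_levi hm hn hr i).le

theorem leviFock_mk (i : ℕ) (u : Env (levi m r)) :
    leviFock hm hn hr i (Submodule.Quotient.mk u) = u • highestVec hm i := rfl

theorem leviFock_injective (i : ℕ) : Function.Injective (leviFock (r := r) hm hn hr i) := by
  rw [← LinearMap.ker_eq_bot]
  exact Submodule.ker_liftQ_eq_bot _ _ _ (maxIdeal_levi hm hn hr i).ge

theorem exists_leviFock_eq (i : ℕ) (v : LeviL (nuWeight (r := r) hm i)) :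
    ∃ p ∈ harmonic evenDual i, leviFock hm hn hr i v = embed (-i - 1) p := by
  obtain ⟨u, rfl⟩ := Submodule.Quotient.mk_surjective _ v
  obtain ⟨p, hp, h⟩ := orbitMap_mem (r := r) hm i u
  exact ⟨p, hp, h.symm⟩

theorem exists_eq_leviFock (i : ℕ) {p : MvPolynomial (EvenIdx m r) ℂ}
    (hp : p ∈ harmonic evenDual i) : ∃ v, leviFock hm hn hr i v = embed (-i - 1) p := by
  obtain ⟨u, -, hu⟩ := map_orbitMap_eq hm hn i (J := ⊤)
    (fun h => (isCoatom_ker_orbitMap hm hn i).1 (top_le_iff.1 h)) hp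
  exact ⟨Submodule.Quotient.mk u, hu⟩

/-- The irreducible module of the Levi subalgebra consists of harmonic polynomials. -/
def leviPoly (i : ℕ) : LeviL (nuWeight (r := r) hm i) →ₗ[ℂ] MvPolynomial (EvenIdx m r) ℂ :=
  LinearMap.proj ({Sum.inr 0}, Pi.single 0 (-(i : ℤ) - 1)) ∘ₗ (leviFock hm hn hr i).restrictScalars ℂ

theorem embed_leviPoly (i : ℕ) (v : LeviL (nuWeight (r := r) hm i)) :
    embed (-i - 1) (leviPoly hm hn hr i v) = leviFock hm hn hr i v := by
  obtain ⟨p, hp, h⟩ := exists_leviFock_eq hm hn hr i v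
  have : leviPoly hm hn hr i v = p := by
    change leviFock hm hn hr i v _ = p
    rw [h, embed_apply, if_pos rfl]
  rw [this, h]

theorem leviPoly_mem (i : ℕ) (v : LeviL (nuWeight (r := r) hm i)) :
    leviPoly hm hn hr i v ∈ harmonic evenDual i := by
  obtain ⟨p, hp, h⟩ := exists_leviFock_eq hm hn hr i v
  rw [← embed_leviPoly] at h
  rwa [embed_injective _ h]

theorem leviPoly_injective (i : ℕ) : Function.Injective (leviPoly (r := r) hm hn hr i) := by
  intro v w h
  apply leviFock_injective hm hn hr i
  rw [← embed_leviPoly, ← embed_leviPoly, h]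

theorem range_leviPoly (i : ℕ) :
    LinearMap.range (leviPoly (r := r) hm hn hr i) = harmonic evenDual i := by
  refine le_antisymm ?_ fun p hp => ?_
  · rintro _ ⟨v, rfl⟩
    exact leviPoly_mem hm hn hr i v
  · obtain ⟨v, hv⟩ := exists_eq_leviFock hm hn hr i hp
    rw [← embed_leviPoly] at hv
    exact ⟨v, embed_injective _ hv⟩

theorem finiteDimensional_leviL (i : ℕ) : FiniteDimensional ℂ (LeviL (nuWeight (r := r) hm i)) := by
  have h : Function.Injective ((leviPoly (r := r) hm hn hr i).codRestrict _
      (leviPoly_mem hm hn hr i)) := fun v w e =>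
    leviPoly_injective hm hn hr i (congrArg Subtype.val e)
  exact FiniteDimensional.of_injective _ h

/-- The weight spaces of a module over the Levi subalgebra. -/
def leviWeightSpace (V : Type*) [AddCommGroup V] [Module ℂ V] [Module (Env (levi m r)) V]
    [IsScalarTower ℂ (Env (levi m r)) V] (μ : Weight m r) : Submodule ℂ V :=
  ⨅ H : cartan m r, Module.End.eigenspace (act V (env (levi m r) ⟨H.1, cartan_mem_levi H⟩)) (μ H)

omit hn hr in
theorem mem_leviWeightSpace {V : Type*} [AddCommGroup V] [Module ℂ V] [Module (Env (levi m r)) V]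
    [IsScalarTower ℂ (Env (levi m r)) V] {μ : Weight m r} {v : V} :
    v ∈ leviWeightSpace V μ ↔
      ∀ H : cartan m r, env (levi m r) ⟨H.1, cartan_mem_levi H⟩ • v = μ H • v := by
  simp only [leviWeightSpace, Submodule.mem_iInf, Module.End.mem_eigenspace_iff, act_apply]

theorem mem_leviWeightSpace_leviL {i : ℕ} {μ : Weight m r} {v : LeviL (nuWeight (r := r) hm i)} :
    v ∈ leviWeightSpace (LeviL (nuWeight (r := r) hm i)) μ ↔
      leviPoly hm hn hr i v ∈ MvPolynomial.restrictSupport ℂ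
        (weightExps (fun w => (entry (Sum.inl w) : Weight m r)) i (μ + (i : ℂ) • δ)) := by
  rw [← forall_fockAct_cartan_embed_iff (s := -i - 1) (by ring) μ (leviPoly_mem hm hn hr i v).1,
    mem_leviWeightSpace]
  refine forall_congr' fun H => ?_
  rw [embed_leviPoly, ← (leviFock_injective hm hn hr i).eq_iff, map_smul, env_levi_smul_fock,
    LinearMap.map_smul_of_tower]

theorem finrank_leviWeightSpace (i : ℕ) (μ : Weight m r) :
    Module.finrank ℂ (leviWeightSpace (LeviL (nuWeight (r := r) hm i)) μ) =
      Module.finrank ℂ (MvPolynomial.restrictSupport ℂ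
        (weightExps (fun w => (entry (Sum.inl w) : Weight m r)) i (μ + (i : ℂ) • δ)) ⊓
          LinearMap.ker (laplacian evenDual) : Submodule ℂ (MvPolynomial (EvenIdx m r) ℂ)) := by
  have hmap : (leviWeightSpace (LeviL (nuWeight (r := r) hm i)) μ).map (leviPoly hm hn hr i) =
      MvPolynomial.restrictSupport ℂ
        (weightExps (fun w => (entry (Sum.inl w) : Weight m r)) i (μ + (i : ℂ) • δ)) ⊓
          LinearMap.ker (laplacian evenDual) := by
    ext p
    constructor
    · rintro ⟨v, hv, rfl⟩
      exact ⟨(mem_leviWeightSpace_leviL hm hn hr).1 hv, (leviPoly_mem hm hn hr i v).2⟩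
    · rintro ⟨hp1, hp2⟩
      have hp : p ∈ harmonic evenDual i := by
        refine mem_harmonic.2 ⟨fun d hd => ?_, hp2⟩
        rw [← ((mem_restrictSupport_weightExps _).1 hp1 d hd).1]
        rw [Finsupp.degree_eq_weight_one]; rfl
      rw [← range_leviPoly hm hn hr] at hp
      obtain ⟨v, rfl⟩ := hp
      exact ⟨v, (mem_leviWeightSpace_leviL hm hn hr).2 hp1, rfl⟩
  rw [← hmap]
  exact (Submodule.equivMapOfInjective _ (leviPoly_injective hm hn hr i) _).finrank_eq

end LeviModule

end Osp

end

noncomputable section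

namespace Osp

variable {m r : ℕ}

/-! ### The opposite nilradical -/

/-- The root vector of the root `entry w - δ`. -/
def lowerOdd (w : EvenIdx m r) : Env (osp m r) :=
  env _ ⟨rootVec (Sum.inl w) (Sum.inr 0), rootVec_mem_osp _ _⟩

/-- The root vector of the root `-2δ`. -/
def lowerEven (m r : ℕ) : Env (osp m r) :=
  env _ ⟨rootVec (Sum.inr 1) (Sum.inr 0), rootVec_mem_osp _ _⟩

@[simp] theorem adjSign_inl_inr_zero (w : EvenIdx m r) :
    adjSign (Sum.inl w : Idx m r) (Sum.inr 0) = -1 := by simp [adjSign]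

@[simp] theorem adjSign_inr_one_inr_zero :
    adjSign (Sum.inr 1 : Idx m r) (Sum.inr 0) = -1 := by simp [adjSign, zmod_two_one_add_one]

theorem rootVec_inl_inr_zero (w : EvenIdx m r) : rootVec (Sum.inl w : Idx m r) (Sum.inr 0) =
    Matrix.single (Sum.inl w) (Sum.inr 0) 1 +
      Matrix.single (Sum.inr 1) (Sum.inl (evenDual w)) 1 := by
  rw [rootVec, adjSign_inl_inr_zero, dual_inr_zero, dual_inl, neg_one_smul, sub_neg_eq_add]

theorem rootVec_inr_one_inr_zero : rootVec (Sum.inr 1 : Idx m r) (Sum.inr 0) =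
    (2 : ℂ) • Matrix.single (Sum.inr 1) (Sum.inr 0) 1 := by
  rw [rootVec, adjSign_inr_one_inr_zero, dual_inr_zero, dual_inr_one, neg_one_smul, sub_neg_eq_add,
    two_smul]

theorem rootVec_dual_dual (i j : Idx m r) :
    rootVec (dual j) (dual i) = -adjSign i j • rootVec i j := by
  rw [rootVec, rootVec, adjSign_dual, dual_dual, dual_dual, smul_sub, smul_smul, neg_mul,
    adjSign_mul_self]
  module

/-- Both vectors are odd, so their superbracket is an anticommutator; it lies in the one-dimensional
root space of `-2δ` and records the pairing of `w` and `w'`. The odd part thus generates a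
Clifford-like algebra over the central `lowerEven`. -/
theorem lowerOdd_mul_lowerOdd (w w' : EvenIdx m r) :
    lowerOdd w * lowerOdd w' =
      -(lowerOdd w' * lowerOdd w) + (if w' = evenDual w then lowerEven m r else 0) := by
  rw [lowerOdd, lowerOdd, env_mul_env _ _ (rootVec_mem_glPart _ _) (rootVec_mem_glPart _ _)]
  simp only [parity_inl, parity_inr, zero_add, ksign_one_one, neg_one_smul]
  congr 1
  have h : superBracket (rootVec (Sum.inl w : Idx m r) (Sum.inr 0))
      (rootVec (Sum.inl w') (Sum.inr 0)) =
        if w' = evenDual w then rootVec (Sum.inr 1) (Sum.inr 0) else 0 := by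
    rw [superBracket_of_mem (rootVec_mem_glPart _ _) (rootVec_mem_glPart _ _)]
    simp only [parity_inl, parity_inr, zero_add, ksign_one_one, neg_one_smul, sub_neg_eq_add]
    rw [rootVec_inl_inr_zero, rootVec_inl_inr_zero, rootVec_inr_one_inr_zero]
    by_cases hw : w' = evenDual w
    · subst hw
      rw [if_pos rfl]
      simp [mul_add, add_mul, two_smul, Matrix.single_mul_single_of_ne]
    · have hw' : evenDual w' ≠ w := fun h => hw (evenDual_eq_comm.1 h)
      rw [if_neg hw]
      simp [mul_add, add_mul, Matrix.single_mul_single_of_ne, Ne.symm hw, hw']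
  split_ifs with hw
  · exact congrArg _ (Subtype.ext (h.trans (if_pos hw)))
  · rw [← map_zero (env (osp m r))]
    exact congrArg _ (Subtype.ext (h.trans (if_neg hw)))

/-- The square is nonzero only at a self-dual index, that is, for the root `-δ` when `n` is odd. -/
theorem lowerOdd_mul_self (w : EvenIdx m r) :
    lowerOdd w * lowerOdd w = (1 / 2 : ℂ) • (if w = evenDual w then lowerEven m r else 0) := by
  rw [← eq_neg_add_iff_add_eq.1 (lowerOdd_mul_lowerOdd w w), smul_add, ← add_smul]
  norm_num

theorem lowerEven_commute_lowerOdd (w : EvenIdx m r) : Commute (lowerEven m r) (lowerOdd w) := by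
  have h : superBracket (rootVec (Sum.inr 1 : Idx m r) (Sum.inr 0))
      (rootVec (Sum.inl w) (Sum.inr 0)) = 0 := by
    rw [superBracket_of_mem (rootVec_mem_glPart _ _) (rootVec_mem_glPart _ _), parity_inr, parity_inr,
      zmod_two_one_add_one, ksign_zero_left, one_smul, rootVec_inr_one_inr_zero,
      rootVec_inl_inr_zero]
    simp [mul_add, add_mul, Matrix.single_mul_single_of_ne]
  change lowerEven m r * lowerOdd w = lowerOdd w * lowerEven m r
  rw [lowerEven, lowerOdd, env_mul_env _ _ (rootVec_mem_glPart _ _) (rootVec_mem_glPart _ _),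
    parity_inr, parity_inr, zmod_two_one_add_one, ksign_zero_left, one_smul, add_eq_left,
    ← map_zero (env (osp m r))]
  exact congrArg _ (Subtype.ext h)

theorem env_cartan_mul_env_rootVec (H : cartan m r) (i j : Idx m r) :
    env (osp m r) ⟨H.1, H.2.1⟩ * env _ ⟨rootVec i j, rootVec_mem_osp i j⟩ =
      env _ ⟨rootVec i j, rootVec_mem_osp i j⟩ * env _ ⟨H.1, H.2.1⟩ +
        ((entry i - entry j : Weight m r) H) • env _ ⟨rootVec i j, rootVec_mem_osp i j⟩ := by
  rw [env_mul_env _ _ (diag_mem_glPart H.2.2) (rootVec_mem_glPart _ _), ksign_zero_left, one_smul,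
    ← map_smul]
  congr 2
  exact Subtype.ext (superBracket_cartan_rootVec H i j)

/-- The ordered product of the odd root vectors `lowerOdd w` for the members `w` of the list `l`
that are in `S`. -/
def oddMonomial (S : Finset (EvenIdx m r)) : List (EvenIdx m r) → Env (osp m r)
  | [] => 1
  | b :: l => if b ∈ S then lowerOdd b * oddMonomial S l else oddMonomial S l

theorem oddMonomial_congr {S T : Finset (EvenIdx m r)} {l : List (EvenIdx m r)}
    (h : ∀ b ∈ l, b ∈ S ↔ b ∈ T) : oddMonomial S l = oddMonomial T l := by
  induction l with
  | nil => rfl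
  | cons b l ih =>
    rw [oddMonomial, oddMonomial, ih fun c hc => h c (List.mem_cons_of_mem _ hc)]
    simp only [h b List.mem_cons_self]

/-! ### Straightening: ordered monomials span -/

section LowerSpan

variable {Q : Type*} [AddCommGroup Q] [Module ℂ Q] [Module (Env (osp m r)) Q]
  [IsScalarTower ℂ (Env (osp m r)) Q]

/-- The span of the ordered monomials in the opposite nilradical applied to `V₀`. -/
def lowerSpan (V₀ : Submodule ℂ Q) (l : List (EvenIdx m r)) : Submodule ℂ Q :=
  ⨆ (S : Finset (EvenIdx m r)) (k : ℕ), V₀.map (act Q (oddMonomial S l * lowerEven m r ^ k))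

theorem mem_lowerSpan {V₀ : Submodule ℂ Q} (l : List (EvenIdx m r)) (S : Finset (EvenIdx m r))
    (k : ℕ) {v : Q} (hv : v ∈ V₀) :
    (oddMonomial S l * lowerEven m r ^ k) • v ∈ lowerSpan V₀ l :=
  Submodule.mem_iSup_of_mem S (Submodule.mem_iSup_of_mem k ⟨v, hv, rfl⟩)

theorem lowerSpan_le {V₀ T : Submodule ℂ Q} {l : List (EvenIdx m r)}
    (h : ∀ S k, ∀ v ∈ V₀, (oddMonomial S l * lowerEven m r ^ k) • v ∈ T) : lowerSpan V₀ l ≤ T :=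
  iSup_le fun S => iSup_le fun k => by
    rintro _ ⟨v, hv, rfl⟩
    exact h S k v hv

theorem lowerEven_commute_oddMonomial (S : Finset (EvenIdx m r)) (l : List (EvenIdx m r)) :
    Commute (lowerEven m r) (oddMonomial S l) := by
  induction l with
  | nil => exact Commute.one_right _
  | cons b l ih =>
    rw [oddMonomial]
    split_ifs
    · exact (lowerEven_commute_lowerOdd b).mul_right ih
    · exact ih

theorem lowerEven_smul_mem_lowerSpan {V₀ : Submodule ℂ Q} {l : List (EvenIdx m r)} {t : Q}
    (ht : t ∈ lowerSpan V₀ l) : lowerEven m r • t ∈ lowerSpan V₀ l := by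
  suffices h : lowerSpan V₀ l ≤ (lowerSpan V₀ l).comap (act Q (lowerEven m r)) from h ht
  refine lowerSpan_le fun S k v hv => ?_
  rw [Submodule.mem_comap, act_apply, ← mul_smul, ← mul_assoc,
    (lowerEven_commute_oddMonomial S l).eq, mul_assoc, ← pow_succ']
  exact mem_lowerSpan l S (k + 1) hv

theorem lowerSpan_cons {V₀ : Submodule ℂ Q} {b : EvenIdx m r} {l : List (EvenIdx m r)}
    (hb : b ∉ l) :
    lowerSpan V₀ (b :: l) = lowerSpan V₀ l ⊔ (lowerSpan V₀ l).map (act Q (lowerOdd b)) := by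
  refine le_antisymm (lowerSpan_le fun S k v hv => ?_) (sup_le ?_ ?_)
  · rw [oddMonomial]
    split_ifs
    · rw [mul_assoc, mul_smul]
      exact Submodule.mem_sup_right (Submodule.mem_map_of_mem (mem_lowerSpan l S k hv))
    · exact Submodule.mem_sup_left (mem_lowerSpan l S k hv)
  · refine lowerSpan_le fun S k v hv => ?_
    have h := mem_lowerSpan (b :: l) (S.erase b) k hv
    rwa [oddMonomial, if_neg (Finset.notMem_erase _ _), oddMonomial_congr (T := S)] at h
    intro c hc
    have : c ≠ b := fun e => hb (e ▸ hc)
    simp [this]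
  · rw [Submodule.map_le_iff_le_comap]
    refine lowerSpan_le fun S k v hv => ?_
    have h := mem_lowerSpan (b :: l) (insert b S) k hv
    rwa [oddMonomial, if_pos (Finset.mem_insert_self _ _), oddMonomial_congr (T := S), mul_assoc,
      mul_smul] at h
    intro c hc
    have : c ≠ b := fun e => hb (e ▸ hc)
    simp [this]

/-- Induction on the list: the new factor is moved past the head by anticommutation, and each
correction is a multiple of the central `lowerEven`, absorbed by raising `k`. When the factor equals
the head, its square is such a multiple too. -/
theorem lowerOdd_smul_mem_lowerSpan {V₀ : Submodule ℂ Q} {l : List (EvenIdx m r)}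
    (hl : l.Nodup) {a : EvenIdx m r} (ha : a ∈ l) {t : Q} (ht : t ∈ lowerSpan V₀ l) :
    lowerOdd a • t ∈ lowerSpan V₀ l := by
  induction l generalizing a t with
  | nil => simp at ha
  | cons b l ih =>
    obtain ⟨hb, hl⟩ := List.nodup_cons.1 hl
    rw [lowerSpan_cons hb] at ht ⊢
    obtain ⟨t₁, h₁, _, ⟨t₂, h₂, rfl⟩, rfl⟩ := Submodule.mem_sup.1 ht
    have hz : ∀ (p : Prop) [Decidable p], (if p then lowerEven m r else 0) • t₂ ∈ lowerSpan V₀ l := by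
      intro p _
      split_ifs
      · exact lowerEven_smul_mem_lowerSpan h₂
      · rw [zero_smul]; exact zero_mem _
    rw [smul_add, act_apply]
    rcases List.mem_cons.1 ha with rfl | ha
    · refine add_mem (Submodule.mem_sup_right (Submodule.mem_map_of_mem h₁))
        (Submodule.mem_sup_left ?_)
      rw [← mul_smul, lowerOdd_mul_self, smul_assoc]
      exact Submodule.smul_mem _ _ (hz _)
    · refine add_mem (Submodule.mem_sup_left (ih hl ha h₁)) ?_
      rw [← mul_smul, lowerOdd_mul_lowerOdd, add_smul, neg_smul, mul_smul]
      exact add_mem (neg_mem (Submodule.mem_sup_right (Submodule.mem_map_of_mem (ih hl ha h₂))))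
        (Submodule.mem_sup_left (hz _))

theorem le_lowerSpan (V₀ : Submodule ℂ Q) (l : List (EvenIdx m r)) : V₀ ≤ lowerSpan V₀ l := by
  intro v hv
  have h := mem_lowerSpan l ∅ 0 hv
  have h1 : oddMonomial ∅ l = (1 : Env (osp m r)) := by
    induction l with
    | nil => rfl
    | cons b l ih => rw [oddMonomial, if_neg (Finset.notMem_empty b)]; exact ih (mem_lowerSpan l ∅ 0 hv)
  rwa [h1, pow_zero, one_mul, one_smul] at h

/-- A module is spanned by the ordered monomials in the opposite nilradical applied to a generating
subspace which is stable under the parabolic subalgebra. -/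
theorem lowerSpan_eq_top [Nonempty (EvenIdx m r)] {V₀ : Submodule ℂ Q}
    (hV : ∀ i j : Idx m r, deltaDeg j ≤ deltaDeg i → ∀ v ∈ V₀,
      env _ ⟨rootVec i j, rootVec_mem_osp i j⟩ • v ∈ V₀)
    (hgen : Submodule.span (Env (osp m r)) (V₀ : Set Q) = ⊤) :
    lowerSpan V₀ (Finset.univ : Finset (EvenIdx m r)).toList = ⊤ := by
  -- The odd vectors alone suffice as generators, because the vector of root `-2δ` is an
  -- anticommutator of two of them.
  let S : Set (osp m r).carrier := Set.range fun w : EvenIdx m r =>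
    (⟨rootVec (Sum.inl w) (Sum.inr 0), rootVec_mem_osp _ _⟩ : (osp m r).carrier)
  have hS : ∀ (w : EvenIdx m r), ∀ t ∈ genBy S V₀, lowerOdd w • t ∈ genBy S V₀ := fun w t ht =>
    env_smul_mem_genBy (S := S) (Set.mem_range_self w) ht
  have h : genBy S V₀ = ⊤ := by
    refine genBy_eq_top ?_ ?_ hgen
    · rintro _ ⟨w, rfl⟩
      exact ⟨_, rootVec_mem_glPart _ _⟩
    · intro x v hv
      have hx : x = ∑ i, ∑ j, (x.1 i j / 2) •
          (⟨rootVec i j, rootVec_mem_osp i j⟩ : (osp m r).carrier) := by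
        apply Subtype.ext
        push_cast
        exact osp_eq_sum_rootVec x.2
      rw [hx]
      simp only [map_sum, map_smul, Finset.sum_smul, smul_assoc]
      refine Submodule.sum_mem _ fun i _ => Submodule.sum_mem _ fun j _ =>
        Submodule.smul_mem _ _ ?_
      have hv' := le_genBy S V₀ hv
      by_cases hij : deltaDeg j ≤ deltaDeg i
      · exact le_genBy S V₀ (hV i j hij v hv)
      rcases i with w | i <;> rcases j with w' | j
      · simp at hij
      · fin_cases j
        · exact hS w v hv'
        · simp at hij
      · fin_cases i
        · simp at hij
        -- The same root vector seen from its other matrix entry, up to a sign.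
        · have e : (⟨rootVec (Sum.inr 1) (Sum.inl w'), rootVec_mem_osp _ _⟩ : (osp m r).carrier) =
              (-adjSign (Sum.inl (evenDual w') : Idx m r) (Sum.inr 0)) •
                ⟨rootVec (Sum.inl (evenDual w')) (Sum.inr 0), rootVec_mem_osp _ _⟩ := by
            apply Subtype.ext
            have := rootVec_dual_dual (Sum.inl (evenDual w') : Idx m r) (Sum.inr 0)
            rwa [dual_inl, evenDual_evenDual, dual_inr_zero] at this
          change env _ (⟨rootVec (Sum.inr 1) (Sum.inl w'), _⟩ : (osp m r).carrier) • v ∈ _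
          rw [e, map_smul, smul_assoc]
          exact Submodule.smul_mem _ _ (hS _ v hv')
      · fin_cases i <;> fin_cases j <;> simp at hij
        obtain ⟨w⟩ := ‹Nonempty (EvenIdx m r)›
        have e := lowerOdd_mul_lowerOdd w (evenDual w)
        rw [if_pos rfl, eq_neg_add_iff_add_eq] at e
        change lowerEven m r • v ∈ _
        rw [← e, add_smul, mul_smul, mul_smul]
        exact add_mem (hS _ _ (hS _ _ hv')) (hS _ _ (hS _ _ hv'))
  rw [← top_le_iff, ← h]
  refine genBy_le (le_lowerSpan _ _) ?_
  rintro _ ⟨w, rfl⟩ t ht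
  exact lowerOdd_smul_mem_lowerSpan (Finset.nodup_toList _) (by simp) ht

end LowerSpan

end Osp

end

noncomputable section

namespace Osp

variable {m r : ℕ}

/-! ### Leading terms in the Fock space -/

/-- The label with occupied states `A` and the first odd basis vector, and exponents `a`, `b`. -/
def oddLabel (A : Finset (EvenIdx m r)) (a b : ℤ) : Finset (Idx m r) × (Fin 2 → ℤ) :=
  (A.disjSum {0}, ![a, b])

theorem oddLabel_inj {A A' : Finset (EvenIdx m r)} {a a' b b' : ℤ} :
    oddLabel A a b = oddLabel A' a' b' ↔ A = A' ∧ a = a' ∧ b = b' := by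
  constructor
  · intro h
    obtain ⟨h1, h2⟩ := Prod.mk.inj h
    refine ⟨?_, congrFun h2 0, congrFun h2 1⟩
    ext w
    rw [← Finset.inl_mem_disjSum (t := {(0 : Fin 2)}), h1, Finset.inl_mem_disjSum]
  · rintro ⟨rfl, rfl, rfl⟩; rfl

theorem disjSum_erase (A : Finset (EvenIdx m r)) (w : EvenIdx m r) :
    (A.disjSum {(0 : Fin 2)}).erase (Sum.inl w) = (A.erase w).disjSum {0} := by
  ext (x | x) <;> simp

theorem insert_disjSum (A : Finset (EvenIdx m r)) (w : EvenIdx m r) :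
    insert (Sum.inl w) (A.disjSum {(0 : Fin 2)}) = (insert w A).disjSum {0} := by
  ext (x | x) <;> simp

theorem lowerOdd_smul_fock (w : EvenIdx m r) (f : Fock m r) :
    lowerOdd w • f = fockAct (rootVec (Sum.inl w) (Sum.inr 0)) f := env_smul_fock _ _

theorem lowerEven_smul_fock (f : Fock m r) :
    lowerEven m r • f = fockAct (rootVec (Sum.inr 1) (Sum.inr 0)) f := env_smul_fock _ _

/-- At labels where the first odd state is filled and the second empty, the first copy contributes
nothing. In the second copy one term creates the fermion `w` and differentiates the first bosonic
variable; the other removes the fermion `evenDual w` and multiplies by the second variable. -/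
theorem lowerOdd_smul_fock_oddLabel (w : EvenIdx m r) (f : Fock m r) (A : Finset (EvenIdx m r))
    (a b : ℤ) :
    (lowerOdd w • f : Fock m r) (oddLabel A a b) =
      (if w ∈ A then (fermiSign (Sum.inl w) (A.disjSum {0}) * (a + 1)) •
        f (oddLabel (A.erase w) (a + 1) b) else 0) +
      (if evenDual w ∈ A then 0 else fermiSign (Sum.inl (evenDual w)) (A.disjSum {0}) •
        f (oddLabel (insert (evenDual w) A) a (b - 1))) := by
  rw [lowerOdd_smul_fock, rootVec_inl_inr_zero, map_add, LinearMap.add_apply, fockAct_single,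
    fockAct_single, Pi.add_apply, Pi.add_apply, Pi.add_apply]
  have h1 : create ((Sum.inl w : Idx m r), 0) (annihilate (Sum.inr 0, 0) f) (oddLabel A a b) = 0 := by
    rw [create_inl_zero, annihilate_inr_zero, boseCreate_inl_apply, fermiAnnihilate_apply, if_pos,
      mul_zero]
    simp [oddLabel]
  have h2 : create ((Sum.inr 1 : Idx m r), 0) (annihilate (Sum.inl (evenDual w), 0) f)
      (oddLabel A a b) = 0 := by
    rw [create_inr_zero, fermiCreate_apply, if_neg]
    simp [oddLabel]
  rw [h1, h2, zero_add, zero_add, create_inl_one, annihilate_inr_one, fermiCreate_apply,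
    create_inr_one, annihilate_inl_one, boseCreate_inr_apply, fermiAnnihilate_apply]
  congr 1
  · refine if_congr (by simp [oddLabel]) ?_ rfl
    rw [boseAnnihilate_inr_apply, smul_smul]
    simp [oddLabel, disjSum_erase, Matrix.vecHead, Matrix.vecTail]
  · refine if_congr (by simp [oddLabel]) rfl ?_
    simp [oddLabel, insert_disjSum, Matrix.vecHead, Matrix.vecTail]

theorem lowerEven_smul_fock_oddLabel (f : Fock m r) (A : Finset (EvenIdx m r)) (a b : ℤ) :
    (lowerEven m r • f : Fock m r) (oddLabel A a b) =
      (2 * ((a : ℂ) + 1)) • f (oddLabel A (a + 1) (b - 1)) := by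
  rw [lowerEven_smul_fock, rootVec_inr_one_inr_zero, map_smul, LinearMap.smul_apply,
    fockAct_single, Pi.smul_apply, Pi.add_apply]
  have h2 : create ((Sum.inr 1 : Idx m r), 0) (annihilate (Sum.inr 0, 0) f)
      (oddLabel A a b) = 0 := by
    rw [create_inr_zero, fermiCreate_apply, if_neg]
    simp [oddLabel]
  rw [h2, zero_add, create_inr_one, annihilate_inr_one, boseCreate_inr_apply,
    boseAnnihilate_inr_apply, smul_smul]
  simp [oddLabel, Matrix.vecHead, Matrix.vecTail]

theorem embed_oddLabel (s : ℤ) (p : MvPolynomial (EvenIdx m r) ℂ) (A : Finset (EvenIdx m r))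
    (a b : ℤ) : embed s p (oddLabel A a b) = if A = ∅ ∧ a = s ∧ b = 0 then p else 0 := by
  have h : (({Sum.inr 0}, Pi.single 0 s) : Finset (Idx m r) × (Fin 2 → ℤ)) = oddLabel ∅ s 0 := by
    refine Prod.ext ?_ ?_
    · simp [oddLabel]
    · funext i; fin_cases i <;> simp [oddLabel]
  rw [embed_apply, h, if_congr oddLabel_inj rfl rfl]

theorem lowerEven_pow_smul_embed {s : ℤ} (hs : s < 0) (k : ℕ) :
    ∃ c : ℂ, c ≠ 0 ∧ ∀ (p : MvPolynomial (EvenIdx m r) ℂ) (A : Finset (EvenIdx m r)) (a b : ℤ),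
      (lowerEven m r ^ k • embed s p : Fock m r) (oddLabel A a b) =
        if A = ∅ ∧ a = s - k ∧ b = k then c • p else 0 := by
  induction k with
  | zero => exact ⟨1, one_ne_zero, fun p A a b => by simp [embed_oddLabel]⟩
  | succ k ih =>
    obtain ⟨c, hc, h⟩ := ih
    -- The exponent starts negative and only decreases, so differentiation never produces the factor
    -- zero.
    have hsk : ((s - k : ℤ) : ℂ) ≠ 0 := Int.cast_ne_zero.2 (by omega)
    refine ⟨2 * ((s - k : ℤ) : ℂ) * c, mul_ne_zero (mul_ne_zero two_ne_zero hsk) hc, ?_⟩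
    intro p A a b
    rw [pow_succ', mul_smul, lowerEven_smul_fock_oddLabel, h]
    by_cases hA : A = ∅ ∧ a = s - (k + 1 : ℕ) ∧ b = (k + 1 : ℕ)
    · obtain ⟨rfl, rfl, rfl⟩ := hA
      rw [if_pos ⟨rfl, by push_cast; ring, by push_cast; ring⟩, if_pos ⟨rfl, rfl, rfl⟩, smul_smul]
      congr 2
      push_cast
      ring
    · rw [if_neg hA, if_neg, smul_zero]
      rintro ⟨h1, h2, h3⟩
      exact hA ⟨h1, by push_cast; linarith, by push_cast; linarith⟩

/-- The leading part, with respect to the number of fermions, is one term: every odd factor creates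
its fermion. Labels with fewer fermions are left unspecified; there the annihilating terms
interfere. -/
theorem oddMonomial_smul_embed {s : ℤ} (hs : s < 0) (k : ℕ) (S : Finset (EvenIdx m r))
    {l : List (EvenIdx m r)} (hl : l.Nodup) :
    ∃ c : ℂ, c ≠ 0 ∧ ∀ (p : MvPolynomial (EvenIdx m r) ℂ) (A : Finset (EvenIdx m r)) (a b : ℤ),
      (S ∩ l.toFinset).card ≤ A.card →
      ((oddMonomial S l * lowerEven m r ^ k) • embed s p : Fock m r) (oddLabel A a b) =
        if A = S ∩ l.toFinset ∧ a = s - k - A.card ∧ b = k then c • p else 0 := by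
  induction l with
  | nil =>
    obtain ⟨c, hc, h⟩ := lowerEven_pow_smul_embed (m := m) (r := r) hs k
    refine ⟨c, hc, fun p A a b _ => ?_⟩
    rw [oddMonomial, one_mul, h]
    refine if_congr ?_ rfl rfl
    simp only [List.toFinset_nil, Finset.inter_empty]
    refine and_congr_right ?_
    rintro rfl
    simp
  | cons w l ih =>
    obtain ⟨hw, hl⟩ := List.nodup_cons.1 hl
    obtain ⟨c, hc, h⟩ := ih hl
    rw [oddMonomial, List.toFinset_cons]
    split_ifs with hwS
    · rw [Finset.inter_insert_of_mem hwS]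
      have hwl : w ∉ S ∩ l.toFinset := by simp [hw]
      rw [Finset.card_insert_of_notMem hwl]
      set A₀ := S ∩ l.toFinset
      have hsk : ((s - k - A₀.card : ℤ) : ℂ) ≠ 0 := Int.cast_ne_zero.2 (by omega)
      refine ⟨fermiSign (Sum.inl w) ((insert w A₀).disjSum {(0 : Fin 2)}) *
        ((s - k - A₀.card : ℤ) : ℂ) * c, mul_ne_zero (mul_ne_zero (fermiSign_ne_zero _ _) hsk) hc,
        ?_⟩
      intro p A a b hA
      rw [mul_assoc, mul_smul, lowerOdd_smul_fock_oddLabel]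
      -- The annihilating term would need a contribution from a label with one fermion more than
      -- `A`, beyond the leading number for the shorter product.
      have h2 : (if evenDual w ∈ A then 0 else
          fermiSign (Sum.inl (evenDual w)) (A.disjSum {(0 : Fin 2)}) •
            ((oddMonomial S l * lowerEven m r ^ k) • embed s p : Fock m r)
              (oddLabel (insert (evenDual w) A) a (b - 1))) = 0 := by
        split_ifs with hd
        · rfl
        · have hcard := Finset.card_insert_of_notMem hd
          rw [h _ _ _ _ (by omega), if_neg, smul_zero]
          rintro ⟨e, -, -⟩
          rw [e] at hcard
          omega
      rw [h2, add_zero]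
      by_cases hwA : w ∈ A
      · have hcard := Finset.card_erase_of_mem hwA
        have hpos : 0 < A.card := Finset.card_pos.2 ⟨w, hwA⟩
        rw [if_pos hwA, h _ _ _ _ (by omega)]
        have hiff : (A.erase w = A₀ ∧ a + 1 = s - k - (A.erase w).card ∧ b = k) ↔
            (A = insert w A₀ ∧ a = s - k - A.card ∧ b = k) := by
          have e : A.erase w = A₀ ↔ A = insert w A₀ := by
            constructor
            · intro e; rw [← e, Finset.insert_erase hwA]
            · intro e; rw [e, Finset.erase_insert hwl]
          rw [e, hcard]
          refine and_congr_right fun _ => and_congr_left fun _ => ?_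
          omega
        rw [if_congr hiff rfl rfl]
        split_ifs with hh
        · obtain ⟨rfl, rfl, rfl⟩ := hh
          rw [smul_smul]
          congr 2
          rw [Finset.card_insert_of_notMem hwl]
          push_cast
          ring
        · rw [smul_zero]
      · rw [if_neg hwA, if_neg]
        rintro ⟨rfl, -, -⟩
        exact hwA (Finset.mem_insert_self _ _)
    · rw [Finset.inter_insert_of_notMem hwS]
      exact ⟨c, hc, h⟩

/-- The monomials in the opposite nilradical. -/
def lowerMonomial (x : Finset (EvenIdx m r) × ℕ) : Env (osp m r) :=
  oddMonomial x.1 (Finset.univ : Finset (EvenIdx m r)).toList * lowerEven m r ^ x.2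

/-- The monomials in the opposite nilradical act independently on the embedded polynomials. -/
theorem eq_zero_of_sum_lowerMonomial_smul_embed {s : ℤ} (hs : s < 0)
    (f : Finset (EvenIdx m r) × ℕ →₀ MvPolynomial (EvenIdx m r) ℂ)
    (hf : f.sum (fun x p => (lowerMonomial x • embed s p : Fock m r)) = 0) : f = 0 := by
  by_contra hne
  -- With `A` of largest cardinality in the support, every monomial is in its leading range at the
  -- label of `(A, k)`. There `A` and the second exponent `k` single out one monomial.
  obtain ⟨⟨A, k⟩, hx, hmax⟩ := Finset.exists_max_image f.support (fun x => x.1.card)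
    (Finsupp.support_nonempty_iff.2 hne)
  have hlead : ∀ y : Finset (EvenIdx m r) × ℕ, ∃ c : ℂ, c ≠ 0 ∧
      ∀ (p : MvPolynomial (EvenIdx m r) ℂ) (B : Finset (EvenIdx m r)) (a b : ℤ),
      y.1.card ≤ B.card → (lowerMonomial y • embed s p : Fock m r) (oddLabel B a b) =
        if B = y.1 ∧ a = s - y.2 - B.card ∧ b = y.2 then c • p else 0 := fun y => by
    simpa [lowerMonomial] using oddMonomial_smul_embed (m := m) (r := r) hs y.2 y.1
      (Finset.nodup_toList Finset.univ)
  have h := congrFun hf (oddLabel A (s - k - A.card) k)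
  rw [Finsupp.sum, Finset.sum_apply, Finset.sum_eq_single (A, k)] at h
  · obtain ⟨c, hc, hl⟩ := hlead (A, k)
    rw [hl _ _ _ _ le_rfl, if_pos ⟨rfl, rfl, rfl⟩] at h
    exact Finsupp.mem_support_iff.1 hx ((smul_eq_zero.1 h).resolve_left hc)
  · intro y hy hyx
    obtain ⟨c, hc, hl⟩ := hlead y
    rw [hl _ _ _ _ (hmax y hy), if_neg]
    rintro ⟨h1, -, h3⟩
    exact hyx (Prod.ext h1.symm (by exact_mod_cast h3.symm))
  · intro hx'; exact absurd hx hx'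

/-! ### Induced modules -/

section Induced

variable (V : Type) [AddCommGroup V] [Module ℂ V] [Module (Env (levi m r)) V]

/-- The inclusion of the inducing module. -/
def indInclusion : V →ₗ[ℂ] Ind (m := m) (r := r) V :=
  ((indRel V).mkQ.restrictScalars ℂ) ∘ₗ TensorProduct.mk ℂ (Env (osp m r)) V 1

theorem smul_indInclusion (u : Env (osp m r)) (v : V) :
    u • indInclusion V v = Submodule.Quotient.mk (u ⊗ₜ[ℂ] v) := by
  change u • (Submodule.Quotient.mk (1 ⊗ₜ[ℂ] v) : Ind V) = _
  rw [← Submodule.Quotient.mk_smul, TensorProduct.smul_tmul', smul_eq_mul, mul_one]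

theorem env_levi_smul_indInclusion (x : (levi m r).carrier) (y : (osp m r).carrier)
    (h : y.1 = x.1) (v : V) :
    env _ y • indInclusion (m := m) (r := r) V v = indInclusion V (env _ x • v) := by
  rw [smul_indInclusion, ← one_smul (Env (osp m r)) (indInclusion V (env _ x • v)),
    smul_indInclusion, Submodule.Quotient.eq]
  exact Submodule.subset_span (Or.inl ⟨x, y, v, h, rfl⟩)

theorem env_nilradical_smul_indInclusion (y : (osp m r).carrier) (h : y.1 ∈ nilradical m r) (v : V) :
    env _ y • indInclusion (m := m) (r := r) V v = 0 := by
  rw [smul_indInclusion, Submodule.Quotient.mk_eq_zero]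
  exact Submodule.subset_span (Or.inr ⟨y, v, h, rfl⟩)

theorem span_range_indInclusion :
    Submodule.span (Env (osp m r)) (LinearMap.range (indInclusion (m := m) (r := r) V) :
      Set (Ind (m := m) (r := r) V)) = ⊤ := by
  rw [← top_le_iff]
  rintro q -
  obtain ⟨t, rfl⟩ := Submodule.Quotient.mk_surjective _ q
  induction t using TensorProduct.induction_on with
  | zero => exact zero_mem _
  | tmul u v =>
    rw [← smul_indInclusion]
    exact Submodule.smul_mem _ _ (Submodule.subset_span ⟨v, rfl⟩)
  | add s t hs ht => exact add_mem hs ht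

/-- Degree zero acts through the Levi subalgebra. The only positive degrees are one and two, which
belong to the nilradical and act by zero. -/
theorem env_rootVec_smul_indInclusion_mem {i j : Idx m r} (hij : deltaDeg j ≤ deltaDeg i) (v : V) :
    env _ ⟨rootVec i j, rootVec_mem_osp i j⟩ • indInclusion (m := m) (r := r) V v ∈
      LinearMap.range (indInclusion (m := m) (r := r) V) := by
  rcases hij.eq_or_lt with h | h
  · rw [env_levi_smul_indInclusion V ⟨rootVec i j, rootVec_mem_levi h.symm⟩ _ rfl]
    exact ⟨_, rfl⟩
  · rw [env_nilradical_smul_indInclusion]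
    · exact zero_mem _
    · have hmem := rootVec_mem_gradedPiece i j
      have hle : ∀ i : Idx m r, -1 ≤ deltaDeg i ∧ deltaDeg i ≤ 1 := by
        rintro (i | i)
        · simp
        · fin_cases i <;> simp
      have h12 : deltaDeg i - deltaDeg j = 1 ∨ deltaDeg i - deltaDeg j = 2 := by
        have := hle i; have := hle j; omega
      rcases h12 with e | e <;> rw [e] at hmem
      · exact Submodule.mem_sup_left hmem
      · exact Submodule.mem_sup_right hmem

/-- The monomials in the opposite nilradical applied to the inducing module. -/
def indSum : (Finset (EvenIdx m r) × ℕ →₀ V) →ₗ[ℂ] Ind (m := m) (r := r) V :=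
  Finsupp.lsum ℂ fun x => act _ (lowerMonomial x) ∘ₗ indInclusion V

theorem indSum_single (x : Finset (EvenIdx m r) × ℕ) (v : V) :
    indSum V (Finsupp.single x v) = lowerMonomial x • indInclusion V v := by
  rw [indSum, Finsupp.lsum_single]; rfl

theorem indSum_surjective [Nonempty (EvenIdx m r)] :
    Function.Surjective (indSum (m := m) (r := r) V) := by
  rw [← LinearMap.range_eq_top, ← top_le_iff,
    ← lowerSpan_eq_top (V₀ := LinearMap.range (indInclusion (m := m) (r := r) V)) ?_
      (span_range_indInclusion V)]
  · refine lowerSpan_le ?_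
    rintro S k _ ⟨v, rfl⟩
    exact ⟨Finsupp.single (S, k) v, indSum_single V _ v⟩
  · rintro i j hij _ ⟨v, rfl⟩
    exact env_rootVec_smul_indInclusion_mem V hij v

variable {V}

/-- Frobenius reciprocity for the Fock space. -/
def indFock (φ : V →ₗ[Env (levi m r)] Fock m r) (φ' : V →ₗ[ℂ] Fock m r) (hφ : ∀ v, φ' v = φ v)
    (h : ∀ X ∈ nilradical m r, ∀ v, fockAct X (φ v) = 0) :
    Ind (m := m) (r := r) V →ₗ[Env (osp m r)] Fock m r :=
  have : SMulCommClass ℂ (Env (osp m r)) (Fock m r) := IsScalarTower.to_smulCommClass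
  Submodule.liftQ _ (TensorProduct.AlgebraTensorModule.lift
    (LinearMap.toSpanSingleton (Env (osp m r)) (V →ₗ[ℂ] Fock m r) φ')) (by
      refine Submodule.span_le.2 ?_
      rintro _ (⟨x, y, v, hxy, rfl⟩ | ⟨y, v, hy, rfl⟩)
      · change TensorProduct.AlgebraTensorModule.lift _ _ = 0
        rw [map_sub, TensorProduct.AlgebraTensorModule.lift_tmul,
          TensorProduct.AlgebraTensorModule.lift_tmul]
        change env _ y • φ' v - (1 : Env (osp m r)) • φ' (env _ x • v) = 0
        rw [hφ, hφ, map_smul, one_smul, env_levi_smul_fock, env_smul_fock, hxy, sub_self]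
      · change TensorProduct.AlgebraTensorModule.lift _ _ = 0
        rw [TensorProduct.AlgebraTensorModule.lift_tmul]
        change env _ y • φ' v = 0
        rw [hφ, env_smul_fock, h _ hy])

theorem indFock_smul_indInclusion (φ : V →ₗ[Env (levi m r)] Fock m r) (φ' : V →ₗ[ℂ] Fock m r)
    (hφ : ∀ v, φ' v = φ v) (h : ∀ X ∈ nilradical m r, ∀ v, fockAct X (φ v) = 0)
    (u : Env (osp m r)) (v : V) : indFock φ φ' hφ h (u • indInclusion V v) = u • φ v := by
  rw [smul_indInclusion, ← hφ]
  rfl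

end Induced

end Osp

end

noncomputable section

namespace Osp

variable {m r : ℕ}

/-! ### Weight spaces of induced modules -/

/-- Elements of the enveloping algebra of a given weight for the adjoint action. -/
def HasWeight (u : Env (osp m r)) (χ : Weight m r) : Prop :=
  ∀ H : cartan m r, env _ ⟨H.1, H.2.1⟩ * u = u * env _ ⟨H.1, H.2.1⟩ + χ H • u

theorem HasWeight.one : HasWeight (1 : Env (osp m r)) 0 := fun H => by simp

theorem HasWeight.mul {u v : Env (osp m r)} {χ ψ : Weight m r} (hu : HasWeight u χ)
    (hv : HasWeight v ψ) : HasWeight (u * v) (χ + ψ) := fun H => by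
  rw [← mul_assoc, hu, add_mul, mul_assoc, hv, mul_add, smul_mul_assoc, mul_smul_comm,
    LinearMap.add_apply, add_smul, mul_assoc, add_assoc, add_comm (ψ H • _)]

theorem HasWeight.pow {u : Env (osp m r)} {χ : Weight m r} (hu : HasWeight u χ) (k : ℕ) :
    HasWeight (u ^ k) (k • χ) := by
  induction k with
  | zero => simpa using HasWeight.one
  | succ k ih => rw [pow_succ, succ_nsmul]; exact ih.mul hu

theorem hasWeight_rootVec (i j : Idx m r) :
    HasWeight (env _ ⟨rootVec i j, rootVec_mem_osp i j⟩) (entry i - entry j) := fun H =>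
  env_cartan_mul_env_rootVec H i j

theorem HasWeight.smul_mem_weightSpace {Q : Type} [AddCommGroup Q] [Module ℂ Q]
    [Module (Env (osp m r)) Q] [IsScalarTower ℂ (Env (osp m r)) Q] {u : Env (osp m r)}
    {χ μ : Weight m r} (hu : HasWeight u χ) {q : Q} (hq : q ∈ weightSpace Q μ) :
    u • q ∈ weightSpace Q (χ + μ) := fun H => by
  rw [← mul_smul, hu, add_smul, mul_smul, hq H, Env.smul_comm_complex, smul_assoc, ← add_smul,
    LinearMap.add_apply, add_comm]

theorem hasWeight_oddMonomial (S : Finset (EvenIdx m r)) {l : List (EvenIdx m r)} (hl : l.Nodup) :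
    HasWeight (oddMonomial S l) (∑ w ∈ S ∩ l.toFinset, (entry (Sum.inl w) - δ)) := by
  induction l with
  | nil => simpa [oddMonomial] using HasWeight.one
  | cons b l ih =>
    obtain ⟨hb, hl⟩ := List.nodup_cons.1 hl
    rw [oddMonomial, List.toFinset_cons]
    split_ifs with hbS
    · rw [Finset.inter_insert_of_mem hbS, Finset.sum_insert (by simp [hb])]
      exact (hasWeight_rootVec (Sum.inl b) (Sum.inr 0)).mul (ih hl)
    · rw [Finset.inter_insert_of_notMem hbS]
      exact ih hl

/-- The weight of a monomial in the opposite nilradical. -/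
def lowerWeight (x : Finset (EvenIdx m r) × ℕ) : Weight m r :=
  ∑ w ∈ x.1, entry (Sum.inl w) - ((x.1.card + 2 * x.2 : ℕ) : ℂ) • δ

theorem hasWeight_lowerMonomial (x : Finset (EvenIdx m r) × ℕ) :
    HasWeight (lowerMonomial x) (lowerWeight x) := by
  have h := (hasWeight_oddMonomial x.1 (Finset.nodup_toList Finset.univ)).mul
    ((hasWeight_rootVec (m := m) (r := r) (Sum.inr 1) (Sum.inr 0)).pow x.2)
  rw [Finset.toList_toFinset, Finset.inter_univ, entry_neg_delta, entry_delta,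
    Finset.sum_sub_distrib, Finset.sum_const] at h
  have e : lowerWeight x = ∑ w ∈ x.1, entry (Sum.inl w) - x.1.card • δ + x.2 • (-δ - δ) := by
    rw [lowerWeight]
    push_cast
    module
  rw [e]
  exact h

section Induced

variable {V : Type} [AddCommGroup V] [Module ℂ V] [Module (Env (levi m r)) V]
  [IsScalarTower ℂ (Env (levi m r)) V]

/-- The action of an element of the Cartan subalgebra in terms of the monomials in the opposite
nilradical. -/
def cartanSum (H : cartan m r) :
    (Finset (EvenIdx m r) × ℕ →₀ V) →ₗ[ℂ] (Finset (EvenIdx m r) × ℕ →₀ V) :=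
  Finsupp.lsum ℂ fun x => Finsupp.lsingle x ∘ₗ
    (act V (env (levi m r) ⟨H.1, cartan_mem_levi H⟩) + lowerWeight x H • LinearMap.id)

theorem cartanSum_single (H : cartan m r) (x : Finset (EvenIdx m r) × ℕ) (v : V) :
    cartanSum H (Finsupp.single x v) = Finsupp.single x
      (env (levi m r) ⟨H.1, cartan_mem_levi H⟩ • v + lowerWeight x H • v) := by
  rw [cartanSum, Finsupp.lsum_single]; rfl

theorem cartanSum_apply (H : cartan m r) (f : Finset (EvenIdx m r) × ℕ →₀ V) (x) :
    cartanSum H f x = env (levi m r) ⟨H.1, cartan_mem_levi H⟩ • f x + lowerWeight x H • f x := by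
  induction f using Finsupp.induction_linear with
  | zero => simp
  | add f g hf hg =>
    rw [map_add, Finsupp.add_apply, Finsupp.add_apply, hf, hg, smul_add, smul_add]
    abel
  | single y v =>
    rw [cartanSum_single]
    by_cases h : y = x
    · subst h; simp
    · simp [Finsupp.single_eq_of_ne (Ne.symm h)]

theorem env_cartan_smul_indSum (H : cartan m r) (f : Finset (EvenIdx m r) × ℕ →₀ V) :
    env (osp m r) ⟨H.1, H.2.1⟩ • indSum V f = indSum V (cartanSum H f) := by
  induction f using Finsupp.induction_linear with
  | zero => simp
  | add f g hf hg => rw [map_add, map_add, map_add, smul_add, hf, hg]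
  | single x v =>
    rw [cartanSum_single, indSum_single, indSum_single, ← mul_smul, hasWeight_lowerMonomial,
      add_smul, mul_smul, env_levi_smul_indInclusion V ⟨H.1, cartan_mem_levi H⟩ _ rfl, map_add,
      smul_add, LinearMap.map_smul, smul_assoc,
      Env.smul_comm_complex (Q := Ind (m := m) (r := r) V)]

/-- Each monomial is a weight vector for the adjoint action, so in these coordinates the Cartan
subalgebra acts one monomial at a time and the weight condition decouples. -/
theorem indSum_mem_weightSpace_iff (hinj : Function.Injective (indSum (m := m) (r := r) V))
    {μ : Weight m r} {f : Finset (EvenIdx m r) × ℕ →₀ V} :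
    indSum V f ∈ weightSpace (Ind (m := m) (r := r) V) μ ↔
      ∀ x, f x ∈ leviWeightSpace V (μ - lowerWeight x) := by
  have h : indSum V f ∈ weightSpace (Ind (m := m) (r := r) V) μ ↔
      ∀ H : cartan m r, ∀ x, cartanSum H f x = μ H • f x := by
    refine forall_congr' fun H => ?_
    rw [env_cartan_smul_indSum, ← map_smul, hinj.eq_iff, Finsupp.ext_iff]
    rfl
  simp only [h, mem_leviWeightSpace, cartanSum_apply, LinearMap.sub_apply, sub_smul,
    eq_sub_iff_add_eq]
  exact forall_comm

/-- The finitely supported functions with values in given subspaces, finitely many of which are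
nonzero. -/
theorem finrank_finsupp_submodule {B V : Type*} [AddCommGroup V] [Module ℂ V]
    (E : B → Submodule ℂ V) [∀ b, FiniteDimensional ℂ (E b)] (F : Finset B)
    (hF : ∀ b ∉ F, E b = ⊥) :
    FiniteDimensional ℂ (Finsupp.submodule E) ∧
      Module.finrank ℂ (Finsupp.submodule E) = ∑ b ∈ F, Module.finrank ℂ (E b) := by
  classical
  let φ : Finsupp.submodule E →ₗ[ℂ] ((b : F) → E b) := LinearMap.pi fun b =>
    LinearMap.codRestrict (E b) ((Finsupp.lapply b.1) ∘ₗ (Finsupp.submodule E).subtype)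
      fun f => f.2 b.1
  have hφ : Function.Bijective φ := by
    constructor
    · rw [← LinearMap.ker_eq_bot, LinearMap.ker_eq_bot']
      intro f hf
      apply Subtype.ext
      ext b
      by_cases hb : b ∈ F
      · exact congrArg Subtype.val (congrFun hf ⟨b, hb⟩)
      · have := f.2 b
        rw [hF b hb] at this
        exact this
    · intro y
      refine ⟨⟨Finsupp.onFinset F (fun b => if h : b ∈ F then (y ⟨b, h⟩ : V) else 0) ?_, ?_⟩, ?_⟩
      · intro b hb
        by_contra h
        simp [h] at hb
      · intro b
        rw [Finsupp.onFinset_apply]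
        split_ifs with h
        · exact (y ⟨b, h⟩).2
        · exact zero_mem _
      · funext b
        exact Subtype.ext (dif_pos b.2)
  let e := LinearEquiv.ofBijective φ hφ
  exact ⟨e.symm.finiteDimensional, by
    rw [e.finrank_eq, Module.finrank_pi_fintype, Finset.sum_coe_sort F fun b =>
      Module.finrank ℂ (E b)]⟩

theorem finrank_weightSpace_ind [FiniteDimensional ℂ V]
    (hbij : Function.Bijective (indSum (m := m) (r := r) V)) {μ : Weight m r}
    (F : Finset (Finset (EvenIdx m r) × ℕ))
    (hF : ∀ x ∉ F, leviWeightSpace V (μ - lowerWeight x) = ⊥) :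
    FiniteDimensional ℂ (weightSpace (Ind (m := m) (r := r) V) μ) ∧
      Module.finrank ℂ (weightSpace (Ind (m := m) (r := r) V) μ) =
        ∑ x ∈ F, Module.finrank ℂ (leviWeightSpace V (μ - lowerWeight x)) := by
  have h := finrank_finsupp_submodule (fun x => leviWeightSpace V (μ - lowerWeight x)) F hF
  have hmap : (Finsupp.submodule fun x => leviWeightSpace V (μ - lowerWeight x)).map
      (indSum (m := m) (r := r) V) = weightSpace (Ind (m := m) (r := r) V) μ := by
    ext q
    constructor
    · rintro ⟨f, hf, rfl⟩
      exact (indSum_mem_weightSpace_iff hbij.1).2 hf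
    · intro hq
      obtain ⟨f, rfl⟩ := hbij.2 q
      exact ⟨f, (indSum_mem_weightSpace_iff hbij.1).1 hq, rfl⟩
  rw [← hmap]
  have e := Submodule.equivMapOfInjective _ hbij.1
    (Finsupp.submodule fun x => leviWeightSpace V (μ - lowerWeight x))
  have := h.1
  exact ⟨e.finiteDimensional, e.symm.finrank_eq.trans h.2⟩

/-- Root vectors shift weight spaces, so the sum of the weight spaces is a submodule, and it
contains the generator. -/
theorem iSup_weightSpace_eq_top {Q : Type} [AddCommGroup Q] [Module ℂ Q]
    [Module (Env (osp m r)) Q] [IsScalarTower ℂ (Env (osp m r)) Q] {q : Q} {μ : Weight m r}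
    (hq : q ∈ weightSpace Q μ) (hgen : Submodule.span (Env (osp m r)) {q} = ⊤) :
    ⨆ μ : Weight m r, weightSpace Q μ = ⊤ := by
  have hstab : ∀ x : (osp m r).carrier, ∀ t ∈ ⨆ μ : Weight m r, weightSpace Q μ,
      env _ x • t ∈ ⨆ μ : Weight m r, weightSpace Q μ := by
    intro x t ht
    have hx : x = ∑ i, ∑ j, (x.1 i j / 2) •
        (⟨rootVec i j, rootVec_mem_osp i j⟩ : (osp m r).carrier) := by
      apply Subtype.ext
      push_cast
      exact osp_eq_sum_rootVec x.2
    rw [hx]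
    simp only [map_sum, map_smul, Finset.sum_smul, smul_assoc]
    refine Submodule.sum_mem _ fun i _ => Submodule.sum_mem _ fun j _ =>
      Submodule.smul_mem _ _ ?_
    suffices h : (⨆ μ : Weight m r, weightSpace Q μ) ≤ (⨆ μ : Weight m r, weightSpace Q μ).comap
        (act Q (env _ ⟨rootVec i j, rootVec_mem_osp i j⟩)) from h ht
    exact iSup_le fun μ t ht =>
      Submodule.mem_iSup_of_mem _ ((hasWeight_rootVec i j).smul_mem_weightSpace ht)
  rw [← top_le_iff]
  rintro t -
  obtain ⟨u, rfl⟩ := Submodule.mem_span_singleton.1 (hgen ▸ Submodule.mem_top : t ∈ _)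
  exact smul_mem_of_env_smul_mem hstab u _ (Submodule.mem_iSup_of_mem μ hq)

end Induced

end Osp

end

noncomputable section

namespace Osp

/-! ### Alternating sums -/

section Alternating

variable {σ : Type*} [Fintype σ] [DecidableEq σ] {A : Type*} [AddCommGroup A] (χ : σ → A)

/-- Adding the indicator of `S` to the exponents is a bijection onto those exponents whose support
contains `S`. -/
theorem ncard_weightExps_sub (S : Finset σ) (i : ℕ) (ψ : A) :
    (weightExps χ i (ψ - ∑ w ∈ S, χ w)).ncard =
      {e | e ∈ weightExps χ (i + S.card) ψ ∧ S ⊆ e.support}.ncard := by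
  let u : σ →₀ ℕ := Finsupp.indicator S fun _ _ => 1
  have hu : ∀ w, u w = if w ∈ S then 1 else 0 := fun w => by
    simp [u, Finsupp.indicator_apply]
  have hdeg : u.degree = S.card := by
    rw [Finsupp.degree_eq_sum, Finset.card_eq_sum_ones, Finset.sum_congr rfl fun w _ => hu w]
    simp
  have hsum : ∀ d : σ →₀ ℕ, ∑ w, (d + u) w • χ w = ∑ w, d w • χ w + ∑ w ∈ S, χ w := fun d => by
    simp only [Finsupp.add_apply, add_smul, Finset.sum_add_distrib, hu, ite_smul, one_smul,
      zero_smul, Finset.sum_ite_mem, Finset.univ_inter]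
  have himage : (fun d => d + u) '' weightExps χ i (ψ - ∑ w ∈ S, χ w) =
      {e | e ∈ weightExps χ (i + S.card) ψ ∧ S ⊆ e.support} := by
    ext e
    constructor
    · rintro ⟨d, ⟨h1, h2⟩, rfl⟩
      refine ⟨⟨?_, ?_⟩, fun w hw => ?_⟩
      · rw [map_add, h1, hdeg]
      · change ∑ w, (d + u) w • χ w = ψ
        rw [hsum, h2, sub_add_cancel]
      · rw [Finsupp.mem_support_iff]
        change (d + u) w ≠ 0
        rw [Finsupp.add_apply, hu, if_pos hw]
        omega
    · rintro ⟨⟨h1, h2⟩, h3⟩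
      have hle : e - u + u = e := by
        ext w
        rw [Finsupp.add_apply, Finsupp.tsub_apply, hu]
        split_ifs with hw
        · have := Finsupp.mem_support_iff.1 (h3 hw)
          omega
        · simp
      refine ⟨e - u, ⟨?_, ?_⟩, hle⟩
      · rw [← hle, map_add, hdeg] at h1
        exact Nat.add_right_cancel h1
      · rw [← hle, hsum] at h2
        exact eq_sub_iff_add_eq.2 h2
  rw [← himage, Set.ncard_image_of_injective _ (add_left_injective u)]

/-- The product of the generating functions of the exterior and of the symmetric powers. -/
theorem sum_neg_one_pow_card_mul_ncard_weightExps (N : ℕ) (ψ : A) [Decidable (N = 0 ∧ ψ = 0)] :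
    ∑ S : Finset σ, (-1 : ℤ) ^ S.card * (if S.card ≤ N then
      ((weightExps χ (N - S.card) (ψ - ∑ w ∈ S, χ w)).ncard : ℤ) else 0) =
        if N = 0 ∧ ψ = 0 then 1 else 0 := by
  let E : Finset (σ →₀ ℕ) := (weightExps_finite χ N ψ).toFinset
  have hE : ∀ e, e ∈ E ↔ e ∈ weightExps χ N ψ := fun e => Set.Finite.mem_toFinset _
  -- Each term counts exponents `e` of degree `N` whose support contains `S`. If `S` has more than
  -- `N` elements there are none, which matches the value `0`.
  have h1 : ∀ S : Finset σ, (if S.card ≤ N then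
      ((weightExps χ (N - S.card) (ψ - ∑ w ∈ S, χ w)).ncard : ℤ) else 0) =
        ∑ e ∈ E, if S ⊆ e.support then 1 else 0 := by
    intro S
    rw [Finset.sum_boole]
    split_ifs with h
    · rw [ncard_weightExps_sub, Nat.sub_add_cancel h, ← Set.ncard_coe_finset]
      congr 3
      ext e
      simp [hE]
    · rw [eq_comm, Nat.cast_eq_zero, Finset.card_eq_zero, Finset.filter_eq_empty_iff]
      intro e he hS
      have h2 : e.support.card ≤ e.degree := by
        rw [Finset.card_eq_sum_ones, Finsupp.degree_apply]
        exact Finset.sum_le_sum fun w hw => Nat.one_le_iff_ne_zero.2 (Finsupp.mem_support_iff.1 hw)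
      rw [((hE e).1 he).1] at h2
      exact h ((Finset.card_le_card hS).trans h2)
  simp only [h1, Finset.mul_sum, mul_ite, mul_one, mul_zero]
  rw [Finset.sum_comm]
  -- After exchanging the sums, the alternating sum over subsets of the support vanishes unless the
  -- support is empty.
  have h2 : ∀ e : σ →₀ ℕ, (∑ S : Finset σ, if S ⊆ e.support then (-1 : ℤ) ^ S.card else 0) =
      if e = 0 then 1 else 0 := by
    intro e
    rw [← Finset.sum_filter, Finset.filter_subset_univ, Finset.sum_powerset_neg_one_pow_card]
    simp
  rw [Finset.sum_congr rfl fun e _ => h2 e, Finset.sum_ite_eq' E 0 fun _ => (1 : ℤ)]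
  refine if_congr ?_ rfl rfl
  rw [hE]
  change _ ∧ _ ↔ _
  rw [map_zero]
  simp [eq_comm]

end Alternating

/-- The telescoping sum behind the character formula. -/
theorem sum_neg_one_pow_mul_of_telescoping {a : ℕ → ℤ} {T : ℕ → ℕ → ℤ} {N : ℕ}
    (hT : ∀ i j, N < j → T i j = 0)
    (h0 : a 0 = ∑ k ∈ Finset.range (N + 1), T 0 (2 * k))
    (h1 : a 1 = ∑ k ∈ Finset.range (N + 1), T 1 (1 + 2 * k))
    (h2 : ∀ i, a (i + 2) = ∑ k ∈ Finset.range (N + 1), (T (i + 2) (i + 2 + 2 * k) -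
      T i (i + 2 + 2 * k))) :
    ∑ i ∈ Finset.range (N + 3), (-1) ^ i * a i = ∑ i ∈ Finset.range (N + 1), (-1) ^ i * T i i := by
  -- The geometric series of the even lowering vector. In these terms `a (i + 2) = c (i + 2) - c i +
  -- T i i`, so the sum of `c`'s telescopes.
  let c : ℕ → ℤ := fun i => ∑ k ∈ Finset.range (N + 1), T i (i + 2 * k)
  have hc : ∀ i, N < i → c i = 0 := fun i hi =>
    Finset.sum_eq_zero fun k _ => hT _ _ (by omega)
  have hc2 : ∀ i, ∑ k ∈ Finset.range (N + 1), T i (i + 2 + 2 * k) = c i - T i i := by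
    intro i
    have e1 : c i = ∑ k ∈ Finset.range (N + 2), T i (i + 2 * k) := by
      rw [Finset.sum_range_succ _ (N + 1), hT i (i + 2 * (N + 1)) (by omega), add_zero]
    rw [e1, Finset.sum_range_succ' _ (N + 1), mul_zero, add_zero, add_sub_cancel_right]
    refine Finset.sum_congr rfl fun k _ => ?_
    congr 1
    ring
  -- Taking `n = N + 1` kills both boundary terms, since `c` vanishes beyond `N`; this is where the
  -- range `N + 3` comes from.
  have key : ∀ n, ∑ i ∈ Finset.range (n + 2), (-1) ^ i * a i =
      (-1) ^ n * (c n - c (n + 1)) + ∑ i ∈ Finset.range n, (-1) ^ i * T i i := by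
    intro n
    induction n with
    | zero =>
      have e0 : a 0 = c 0 := by rw [h0]; simp [c]
      have e1 : a 1 = c 1 := h1
      simp [Finset.sum_range_succ, e0, e1, sub_eq_add_neg]
    | succ n ih =>
      rw [Finset.sum_range_succ, ih, Finset.sum_range_succ _ n, h2, Finset.sum_sub_distrib, hc2]
      change _ + (-1) ^ (n + 2) * (c (n + 2) - _) = _
      ring
  rw [key (N + 1), hc _ (by omega), hc _ (by omega)]
  ring

end Osp

end

noncomputable section

namespace Osp

variable {m r : ℕ}

/-! ### Characters of the generalized Verma modules -/

/-- The weights of the even basis vectors. -/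
def evenWeight (w : EvenIdx m r) : Weight m r := entry (Sum.inl w)

theorem evenWeight_evenDual (w : EvenIdx m r) : evenWeight (evenDual w) = -evenWeight w :=
  entry_dual (Sum.inl w)

theorem evenWeight_gradingCartan (w : EvenIdx m r) : evenWeight w (gradingCartan m r) = 0 := by
  rw [evenWeight, entry_gradingCartan]; simp

/-- The multiplicity of `e^μ` in the character of the tensor product of the `i`-th symmetric power
of `ℂ^n`, the exterior algebra of `ℂ^n ⊗ e^{-δ}` and the one-dimensional module of weight
`-j δ`. -/
def symExtMult (μ : Weight m r) (i j : ℕ) : ℤ :=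
  ∑ S : Finset (EvenIdx m r),
    ((weightExps evenWeight i (μ + ((S.card + j : ℕ) : ℂ) • δ - ∑ w ∈ S, evenWeight w)).ncard : ℤ)

theorem apply_gradingCartan_of_mem_weightExps {i j : ℕ} {μ : Weight m r}
    {S : Finset (EvenIdx m r)} {d} (hd : d ∈ weightExps evenWeight i
      (μ + ((S.card + j : ℕ) : ℂ) • δ - ∑ w ∈ S, evenWeight w)) :
    μ (gradingCartan m r) = -((S.card + j : ℕ) : ℂ) := by
  have h := LinearMap.congr_fun hd.2 (gradingCartan m r)
  rw [LinearMap.sum_apply, LinearMap.sub_apply, LinearMap.add_apply, LinearMap.sum_apply,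
    Finset.sum_eq_zero fun w _ => by
      rw [LinearMap.smul_apply, evenWeight_gradingCartan, smul_zero],
    Finset.sum_eq_zero fun w _ => evenWeight_gradingCartan w, LinearMap.smul_apply,
    δ_gradingCartan, smul_eq_mul, mul_one, sub_zero] at h
  exact (neg_eq_of_add_eq_zero_left h.symm).symm

/-- The even weights have no `δ`-coefficient, so the total `δ`-degree must match that of `μ`. This
is the source of all finiteness statements below. -/
theorem weightExps_eq_empty {i j N : ℕ} {μ : Weight m r} {S : Finset (EvenIdx m r)}
    (hN : ∀ n : ℕ, μ (gradingCartan m r) = -(n : ℂ) → n = N) (h : S.card + j ≠ N) :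
    weightExps evenWeight i (μ + ((S.card + j : ℕ) : ℂ) • δ - ∑ w ∈ S, evenWeight w) = ∅ :=
  Set.eq_empty_of_forall_notMem fun _ hd => h (hN _ (apply_gradingCartan_of_mem_weightExps hd))

theorem exists_eq_of_apply_gradingCartan (μ : Weight m r) :
    ∃ N : ℕ, ∀ n : ℕ, μ (gradingCartan m r) = -(n : ℂ) → n = N := by
  by_cases h : ∃ N : ℕ, μ (gradingCartan m r) = -(N : ℂ)
  · obtain ⟨N, hN⟩ := h
    exact ⟨N, fun n hn => by rw [hN] at hn; exact_mod_cast (neg_injective hn).symm⟩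
  · exact ⟨0, fun n hn => absurd ⟨n, hn⟩ h⟩

-- The condition on `N` says that `-N` is the `δ`-coefficient of `μ` if that is minus a natural
-- number. For other `μ` it holds vacuously, and the value `0` chosen above works as well as any.
theorem symExtMult_eq_zero {i j N : ℕ} {μ : Weight m r}
    (hN : ∀ n : ℕ, μ (gradingCartan m r) = -(n : ℂ) → n = N) (h : N < j) :
    symExtMult μ i j = 0 :=
  Finset.sum_eq_zero fun S _ => by
    rw [weightExps_eq_empty hN (by omega), Set.ncard_empty, Nat.cast_zero]

-- For each `S` the `δ`-degree leaves only `i = N - S.card`, and `(-1)^i = (-1)^N (-1)^(S.card)`.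
-- What remains is the Koszul identity in degree `N`.
open Classical in
theorem sum_neg_one_pow_mul_symExtMult {μ : Weight m r} {N : ℕ}
    (hN : ∀ n : ℕ, μ (gradingCartan m r) = -(n : ℂ) → n = N) :
    ∑ i ∈ Finset.range (N + 1), (-1) ^ i * symExtMult μ i i = if μ = 0 then 1 else 0 := by
  have h0 : μ = 0 → N = 0 := fun h => (hN 0 (by simp [h])).symm
  have h1 : ∀ S : Finset (EvenIdx m r), ∑ i ∈ Finset.range (N + 1), (-1) ^ i *
      ((weightExps evenWeight i
        (μ + ((S.card + i : ℕ) : ℂ) • δ - ∑ w ∈ S, evenWeight w)).ncard : ℤ) =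
      (-1) ^ N * ((-1 : ℤ) ^ S.card * (if S.card ≤ N then ((weightExps evenWeight (N - S.card)
        (μ + (N : ℂ) • δ - ∑ w ∈ S, evenWeight w)).ncard : ℤ) else 0)) := by
    intro S
    split_ifs with hS
    · rw [Finset.sum_eq_single (N - S.card)]
      · rw [Nat.add_sub_cancel' hS, ← mul_assoc, ← pow_add]
        congr 1
        rw [show N + S.card = N - S.card + 2 * S.card by omega, pow_add, pow_mul]
        simp
      · intro i _ hi
        rw [weightExps_eq_empty hN (by omega), Set.ncard_empty, Nat.cast_zero, mul_zero]
      · intro h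
        exact absurd (Finset.mem_range.2 (by omega)) h
    · rw [mul_zero, mul_zero]
      refine Finset.sum_eq_zero fun i _ => ?_
      rw [weightExps_eq_empty hN (by omega), Set.ncard_empty, Nat.cast_zero, mul_zero]
  simp only [symExtMult, Finset.mul_sum]
  rw [Finset.sum_comm, Finset.sum_congr rfl fun S _ => h1 S, ← Finset.mul_sum,
    sum_neg_one_pow_card_mul_ncard_weightExps]
  by_cases h : μ = 0
  · obtain rfl := h0 h
    simp [h]
  · rw [if_neg h, if_neg, mul_zero]
    rintro ⟨rfl, e⟩
    exact h (by simpa using e)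

theorem add_sub_lowerWeight (μ : Weight m r) (i : ℕ) (x : Finset (EvenIdx m r) × ℕ) :
    μ - lowerWeight x + (i : ℂ) • δ =
      μ + ((x.1.card + (i + 2 * x.2) : ℕ) : ℂ) • δ - ∑ w ∈ x.1, evenWeight w := by
  simp only [lowerWeight, evenWeight]
  push_cast
  module

theorem leviEnv_smul_indInclusion {V : Type} [AddCommGroup V] [Module ℂ V]
    [Module (Env (levi m r)) V] [IsScalarTower ℂ (Env (levi m r)) V] (u : Env (levi m r)) (v : V) :
    leviEnv m r u • indInclusion V v = indInclusion (m := m) (r := r) V (u • v) := by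
  induction u using Env.induction generalizing v with
  | algebraMap c => rw [AlgHom.commutes, algebraMap_smul, algebraMap_smul, LinearMap.map_smul]
  | env x => rw [leviEnv_env, env_levi_smul_indInclusion V x _ rfl]
  | mul a b ha hb => rw [map_mul, mul_smul, hb, ha, mul_smul]
  | add a b ha hb => rw [map_add, add_smul, ha, hb, add_smul, map_add]

/-! ### Assembly: the generalized Verma modules and the alternating sum -/

section Verma

variable (hm : 0 < m) (hn : 3 ≤ 2 * m + r) (hr : r ≤ 1)
include hn hr

/-- Surjectivity is straightening. For injectivity a vanishing combination is mapped to the Fock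
space, where the monomials act independently on the embedded harmonic polynomials. -/
theorem indSum_leviL_bijective (i : ℕ) :
    Function.Bijective (indSum (m := m) (r := r) (LeviL (nuWeight (r := r) hm i))) := by
  have : Nonempty (EvenIdx m r) := ⟨firstIdx hm⟩
  refine ⟨?_, indSum_surjective _⟩
  rw [← LinearMap.ker_eq_bot, LinearMap.ker_eq_bot']
  intro f hf
  let Φ := indFock (leviFock hm hn hr i) ((leviFock hm hn hr i).restrictScalars ℂ) (fun _ => rfl)
    fun X hX v => by rw [← embed_leviPoly, fockAct_nilradical_embed hX]
  have hΦ : Φ (indSum _ f) = f.sum fun x v =>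
      lowerMonomial x • embed (-(i : ℤ) - 1) (leviPoly hm hn hr i v) := by
    rw [indSum, Finsupp.lsum_apply, Finsupp.sum, map_sum, Finsupp.sum]
    refine Finset.sum_congr rfl fun x _ => ?_
    rw [embed_leviPoly]
    exact indFock_smul_indInclusion _ _ _ _ _ _
  rw [hf, map_zero] at hΦ
  -- The exponent `-i - 1` is negative for every `i ≥ 0`, including `i = 0`.
  have h0 := eq_zero_of_sum_lowerMonomial_smul_embed (s := -(i : ℤ) - 1) (by omega)
    (f.mapRange (leviPoly hm hn hr i) (map_zero _)) (by
      rw [Finsupp.sum_mapRange_index (by simp)]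
      exact hΦ.symm)
  ext1 x
  apply leviPoly_injective hm hn hr i
  rw [Finsupp.zero_apply, map_zero]
  exact DFunLike.congr_fun h0 x

theorem leviWeightSpace_leviL_eq_bot {i : ℕ} {μ : Weight m r}
    (h : weightExps evenWeight i (μ + (i : ℂ) • δ) = ∅) :
    leviWeightSpace (LeviL (nuWeight (r := r) hm i)) μ = ⊥ := by
  rw [← le_bot_iff]
  intro v hv
  rw [mem_leviWeightSpace_leviL hm hn hr, mem_restrictSupport_weightExps] at hv
  apply leviPoly_injective hm hn hr i
  rw [map_zero]
  ext d
  by_contra hd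
  have : d ∈ weightExps evenWeight i (μ + (i : ℂ) • δ) := hv d hd
  rw [h] at this
  exact this

theorem leviWeightSpace_sub_lowerWeight_eq_bot {i N : ℕ} {μ : Weight m r}
    (hN : ∀ n : ℕ, μ (gradingCartan m r) = -(n : ℂ) → n = N) {x : Finset (EvenIdx m r) × ℕ}
    (hx : x ∉ (Finset.univ : Finset (Finset (EvenIdx m r))) ×ˢ Finset.range (N + 1)) :
    leviWeightSpace (LeviL (nuWeight (r := r) hm i)) (μ - lowerWeight x) = ⊥ := by
  refine leviWeightSpace_leviL_eq_bot hm hn hr ?_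
  rw [add_sub_lowerWeight]
  refine weightExps_eq_empty hN fun h => hx ?_
  rw [Finset.mem_product, Finset.mem_range]
  exact ⟨Finset.mem_univ _, by omega⟩

theorem hasCharacter_verma (i : ℕ) : HasCharacter m r (M (nuWeight (r := r) hm i)) := by
  have := finiteDimensional_leviL (r := r) hm hn hr i
  refine ⟨?_, fun μ => ?_⟩
  · refine iSup_weightSpace_eq_top (q := indInclusion _ (Submodule.Quotient.mk 1))
      (μ := nuWeight hm i) (fun H => ?_) ?_
    · rw [env_levi_smul_indInclusion _ ⟨H.1, cartan_mem_levi H⟩ _ rfl, ← LinearMap.map_smul]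
      congr 1
      apply leviFock_injective hm hn hr i
      rw [map_smul, LinearMap.map_smul_of_tower, leviFock_mk, one_smul, env_levi_smul_fock,
        fockAct_cartan_highestVec]
    -- The inducing module is cyclic over the Levi subalgebra, so its highest weight vector
    -- generates the whole induced module.
    · rw [← top_le_iff, ← span_range_indInclusion, Submodule.span_le]
      rintro _ ⟨v, rfl⟩
      obtain ⟨u, rfl⟩ := Submodule.Quotient.mk_surjective _ v
      refine Submodule.mem_span_singleton.2 ⟨leviEnv m r u, ?_⟩
      rw [leviEnv_smul_indInclusion, ← Submodule.Quotient.mk_smul, smul_eq_mul, mul_one]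
  · obtain ⟨N, hN⟩ := exists_eq_of_apply_gradingCartan μ
    exact (finrank_weightSpace_ind (indSum_leviL_bijective hm hn hr i) _
      fun x hx => leviWeightSpace_sub_lowerWeight_eq_bot hm hn hr hN hx).1

theorem ch_verma {i N : ℕ} {μ : Weight m r}
    (hN : ∀ n : ℕ, μ (gradingCartan m r) = -(n : ℂ) → n = N) :
    ch (M (nuWeight (r := r) hm i)) μ = ∑ k ∈ Finset.range (N + 1), ∑ S : Finset (EvenIdx m r),
      (Module.finrank ℂ
        (leviWeightSpace (LeviL (nuWeight (r := r) hm i)) (μ - lowerWeight (S, k))) : ℤ) := by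
  have := finiteDimensional_leviL (r := r) hm hn hr i
  rw [ch, (finrank_weightSpace_ind (indSum_leviL_bijective hm hn hr i) _
      fun x hx => leviWeightSpace_sub_lowerWeight_eq_bot hm hn hr hN hx).2, Finset.sum_product_right]
  push_cast
  rfl

/-- Polynomials of degree at most one are all harmonic, so there is no term `S^{i-2}` to subtract.
These are the two initial values of the telescoping. -/
theorem finrank_leviWeightSpace_of_le_one {i : ℕ} (hi : i ≤ 1) (μ : Weight m r) :
    Module.finrank ℂ (leviWeightSpace (LeviL (nuWeight (r := r) hm i)) μ) =
      (weightExps evenWeight i (μ + (i : ℂ) • δ)).ncard := by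
  rw [finrank_leviWeightSpace hm hn hr, ← finrank_restrictSupport, inf_eq_left.2]
  · rfl
  · intro p hp
    refine laplacian_eq_zero_of_degree_le_one hi fun d hd => ?_
    rw [← ((mem_restrictSupport_weightExps _).1 hp d hd).1, Finsupp.degree_eq_weight_one]
    rfl

theorem finrank_leviWeightSpace_add_two (i : ℕ) (μ : Weight m r) :
    (Module.finrank ℂ (leviWeightSpace (LeviL (nuWeight (r := r) hm (i + 2))) μ) : ℤ) =
      (weightExps evenWeight (i + 2) (μ + ((i + 2 : ℕ) : ℂ) • δ)).ncard -
        (weightExps evenWeight i (μ + ((i + 2 : ℕ) : ℂ) • δ)).ncard := by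
  have : Nonempty (EvenIdx m r) := ⟨firstIdx hm⟩
  rw [finrank_leviWeightSpace hm hn hr, eq_sub_iff_add_eq]
  exact_mod_cast finrank_harmonic_weight_add evenWeight_evenDual i (μ + ((i + 2 : ℕ) : ℂ) • δ)

theorem ch_verma_of_le_one {i N : ℕ} (hi : i ≤ 1) {μ : Weight m r}
    (hN : ∀ n : ℕ, μ (gradingCartan m r) = -(n : ℂ) → n = N) :
    ch (M (nuWeight (r := r) hm i)) μ =
      ∑ k ∈ Finset.range (N + 1), symExtMult μ i (i + 2 * k) := by
  rw [ch_verma hm hn hr hN]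
  refine Finset.sum_congr rfl fun k _ => Finset.sum_congr rfl fun S _ => ?_
  rw [finrank_leviWeightSpace_of_le_one hm hn hr hi, add_sub_lowerWeight]

/-- Both terms carry the shift `i + 2 + 2k`: the polynomials of degree `i` enter through the
harmonics of degree `i + 2`, whose Levi module sits at `-(i + 2)δ`. -/
theorem ch_verma_add_two {i N : ℕ} {μ : Weight m r}
    (hN : ∀ n : ℕ, μ (gradingCartan m r) = -(n : ℂ) → n = N) :
    ch (M (nuWeight (r := r) hm (i + 2))) μ = ∑ k ∈ Finset.range (N + 1),
      (symExtMult μ (i + 2) (i + 2 + 2 * k) - symExtMult μ i (i + 2 + 2 * k)) := by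
  rw [ch_verma hm hn hr hN]
  refine Finset.sum_congr rfl fun k _ => ?_
  rw [symExtMult, symExtMult, ← Finset.sum_sub_distrib]
  refine Finset.sum_congr rfl fun S _ => ?_
  rw [finrank_leviWeightSpace_add_two hm hn hr, add_sub_lowerWeight]

theorem ch_verma_eq_zero {i N : ℕ} {μ : Weight m r}
    (hN : ∀ n : ℕ, μ (gradingCartan m r) = -(n : ℂ) → n = N) (h : N < i) :
    ch (M (nuWeight (r := r) hm i)) μ = 0 := by
  rw [ch_verma hm hn hr hN]
  refine Finset.sum_eq_zero fun k _ => Finset.sum_eq_zero fun S _ => ?_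
  rw [leviWeightSpace_leviL_eq_bot hm hn hr, finrank_bot, Nat.cast_zero]
  rw [add_sub_lowerWeight]
  exact weightExps_eq_empty hN (by omega)

theorem hasSum_ch_verma :
    HasSum (fun i : ℕ => (-1 : ℤ) ^ i • (ch (M (nuWeight (r := r) hm i)) : Weight m r → ℤ))
      (ch (L (0 : Weight m r))) := by
  classical
  rw [Pi.hasSum]
  intro μ
  obtain ⟨N, hN⟩ := exists_eq_of_apply_gradingCartan μ
  have h : ch (L (0 : Weight m r)) μ = ∑ i ∈ Finset.range (N + 3),
      (-1 : ℤ) ^ i * ch (M (nuWeight (r := r) hm i)) μ := by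
    rw [ch_trivial hr, sum_neg_one_pow_mul_of_telescoping (T := symExtMult μ)
      (fun i j hj => symExtMult_eq_zero hN hj)
      (by simpa using ch_verma_of_le_one (i := 0) hm hn hr zero_le_one hN)
      (ch_verma_of_le_one hm hn hr le_rfl hN) (fun i => ch_verma_add_two hm hn hr hN),
      sum_neg_one_pow_mul_symExtMult hN]
  rw [h]
  -- Terms with `i > N` vanish at `μ`; the range `N + 3` is longer than needed, to fit the
  -- telescoping formula.
  refine hasSum_sum_of_ne_finset_zero fun i hi => ?_
  rw [Finset.mem_range, not_lt] at hi
  rw [Pi.smul_apply, ch_verma_eq_zero hm hn hr hN (by omega), smul_zero]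

end Verma

end Osp

end

theorem corollary3p5 (n m r : ℕ) (hn : n = 2 * m + r) (hr : r ≤ 1) (hn3 : 3 ≤ n)
    (ν : ℕ → Osp.Weight m r)
    (hν : ∀ i : ℕ, ν i = (i : ℂ) • Osp.ε ⟨0, by omega⟩ - (i : ℂ) • Osp.δ) :
    -- the irreducible module of highest weight `0` is the trivial module
    (Module.finrank ℂ (Osp.L (0 : Osp.Weight m r)) = 1 ∧
      ∀ (x : (Osp.osp m r).carrier) (v : Osp.L (0 : Osp.Weight m r)),
        Osp.env (Osp.osp m r) x • v = 0) ∧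
    -- the modules and characters in the formula are well defined
    (∀ i : ℕ, FiniteDimensional ℂ (Osp.LeviL (ν i)) ∧
      IsSimpleModule (Osp.Env (Osp.levi m r)) (Osp.LeviL (ν i))) ∧
    Osp.HasCharacter m r (Osp.L (0 : Osp.Weight m r)) ∧
    (∀ i : ℕ, Osp.HasCharacter m r (Osp.M (ν i))) ∧
    -- the character formula: the series converges pointwise on the set of weights, that is, only
    -- finitely many of its terms are nonzero at any given weight
    HasSum (fun i : ℕ => (-1 : ℤ) ^ i • (Osp.ch (Osp.M (ν i)) : Osp.Weight m r → ℤ))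
      (Osp.ch (Osp.L (0 : Osp.Weight m r))) := by
  have hm : 0 < m := by omega
  have hn' : 3 ≤ 2 * m + r := by omega
  obtain rfl : ν = fun i => Osp.nuWeight hm i := funext hν
  exact ⟨⟨Osp.finrank_trivial hr, Osp.env_smul_trivial hr⟩,
    fun i => ⟨Osp.finiteDimensional_leviL hm hn' hr i, Osp.isSimpleModule_leviL hm hn' hr i⟩,
    Osp.hasCharacter_trivial hr, Osp.hasCharacter_verma hm hn' hr,
    Osp.hasSum_ch_verma hm hn' hr⟩
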